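/- Call two subspaces $A_0, A_1 \subseteq \mathbb{F}_2^n$ incomparable if $A_0 \nsubseteq A_1$ and $A_1 \nsubseteq A_0$. For weights $w_0, w_1 > 0$ with $w_0 + w_1 = 1$, let $\mathcal{O}(A_0, A_1, w_0, w_1)$ be the oracle each of whose answers is drawn independently as follows: with probability $w_0$ it is a uniformly random element of $A_0$, and with probability $w_1$ a uniformly random element of $A_1$. There are a single randomized algorithm (a fixed program for a random access machine on natural numbers with unit-cost addition and truncated subtraction, whose instructions can also flip a fair coin at cost $1$ and draw an answer of the oracle, at an extra cost of $n$) and a constant $C$ with the following property. Let $A_0, A_1 \subseteq \mathbb{F}_2^n$ be any incomparable subspaces, let $w_0 + w_1 = 1$, and let $w_{\min}, \delta, \varepsilon$ be rational numbers with $0 < w_{\min} \le \min\{w_0, w_1\}$, $0 < \delta < 1$ and $0 < \varepsilon \le 1$. Given $n$, $w_{\min}$, $\delta$, $\varepsilon$ and access to $\mathcal{O}(A_0, A_1, w_0, w_1)$ (with $A_0, A_1, w_0, w_1$ unknown): 1. the algorithm always halts, and both the number of samples and the number of steps it uses are at most $$C \left(\frac{n}{w_{\min}}\right)^{C} \cdot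 \frac{1}{\varepsilon^2} \cdot \log\frac{2}{\delta};$$ in particular they are $\mathsf{poly}(n/w_{\min}) \cdot \log(2/\delta)$ whenever $\varepsilon$ is at least an inverse polynomial in $n/w_{\min}$; 2. with probability at least $1 - \delta$, the algorithm outputs exactly the two subspaces $A_0$ and $A_1$, each given by a basis, together with estimates $\hat w_0, \hat w_1$ of their respective weights such that $|w_0 - \hat w_0| + |w_1 - \hat w_1| \le \varepsilon$. (The two components are output in unspecified order, since the oracle does not determine which is called $A_0$; each estimate belongs to its own subspace.) -/

import Mathlib

open MeasureTheory ProbabilityTheory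

/-! ### The sampling oracle -/

instance instMeasurableSpaceZModTwo : MeasurableSpace (ZMod 2) := ⊤

instance instDiscreteMeasurableSpaceZModTwo : DiscreteMeasurableSpace (ZMod 2) :=
  ⟨fun _ => trivial⟩

/-- The vector space `𝔽₂ⁿ`. -/
abbrev Vec (n : ℕ) : Type := Fin n → ZMod 2

/-- A subspace of `𝔽₂ⁿ`. -/
abbrev Subsp (n : ℕ) : Type := Submodule (ZMod 2) (Vec n)

/-- Two subspaces are incomparable if neither is contained in the other. -/
def Incomparable {n : ℕ} (A B : Subsp n) : Prop := ¬ A ≤ B ∧ ¬ B ≤ A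

/-- The law of one answer of the oracle `𝒪(A₀, A₁, w₀, w₁)`: with probability `w₀` a uniformly
random element of `A₀`, with probability `w₁` a uniformly random element of `A₁`. -/
noncomputable def oracleLaw {n : ℕ} (A₀ A₁ : Subsp n) (w₀ w₁ : ℝ) : Measure (Vec n) :=
  ENNReal.ofReal w₀ • uniformOn (A₀ : Set (Vec n)) +
    ENNReal.ofReal w₁ • uniformOn (A₁ : Set (Vec n))

/-- The randomness of one execution: the sequence of answers of the oracle, and the sequence of
random bits of the algorithm. -/
abbrev Tape (n : ℕ) : Type := (ℕ → Vec n) × (ℕ → Bool)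

/-- The law of the randomness: the answers of the oracle are i.i.d., the random bits are
independent and fair, and the two sequences are independent of each other. -/
noncomputable def tapeLaw {n : ℕ} (A₀ A₁ : Subsp n) (w₀ w₁ : ℝ) : Measure (Tape n) :=
  (Measure.infinitePi fun _ : ℕ => oracleLaw A₀ A₁ w₀ w₁).prod
    (Measure.infinitePi fun _ : ℕ => uniformOn (Set.univ : Set Bool))

/-! ### The machine model

Randomised random access machine programs over the natural numbers, with the standard additive
instruction set: the only arithmetic operations are addition and truncated subtraction, each of
cost one, so that `T` steps can lengthen the binary expansion of a number by at most `T` bits.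
Memory consists of registers `reg x` and of two-dimensional arrays; the entry `(i, j)` of array
`a` is `mem a i j`. Names of registers and of arrays are part of the program text, array indices
are computed. Memory that has not been written holds `0`. -/

/-- Arithmetic expressions. -/
inductive Expr : Type
  | const (k : ℕ) : Expr
  | reg (x : ℕ) : Expr
  | cell (a : ℕ) (i j : Expr) : Expr
  | add (e f : Expr) : Expr
  | sub (e f : Expr) : Expr

/-- Programs. A program is a finite text that does not depend on the input. -/
inductive Prog : Type
  | skip : Prog
  | set (x : ℕ) (e : Expr) : Prog  -- `reg x := e`
  | store (a : ℕ) (i j e : Expr) : Prog  -- `mem a i j := e`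
  | flip (x : ℕ) : Prog  -- `reg x :=` a fresh random bit
  | sample (a : ℕ) (i : Expr) : Prog  -- row `i` of array `a` `:=` a fresh oracle answer
  | seq (p q : Prog) : Prog
  | cond (e : Expr) (p q : Prog) : Prog  -- if `e ≠ 0` then `p` else `q`
  | loop (e : Expr) (p : Prog) : Prog  -- while `e ≠ 0` do `p`

/-- A state of the machine: the memory, and the numbers of oracle answers and of random bits
used so far. -/
structure State : Type where
  reg : ℕ → ℕ
  mem : ℕ → ℕ → ℕ → ℕ
  samples : ℕ
  flips : ℕ

/-- The value of an expression. -/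
def Expr.eval (s : State) : Expr → ℕ
  | .const k => k
  | .reg x => s.reg x
  | .cell a i j => s.mem a (i.eval s) (j.eval s)
  | .add e f => e.eval s + f.eval s
  | .sub e f => e.eval s - f.eval s

/-- The number of steps needed to evaluate an expression: one per symbol. -/
def Expr.cost : Expr → ℕ
  | .const _ => 1
  | .reg _ => 1
  | .cell _ i j => i.cost + j.cost + 1
  | .add e f => e.cost + f.cost + 1
  | .sub e f => e.cost + f.cost + 1

/-- `reg x := v`. -/
def State.setReg (s : State) (x v : ℕ) : State :=
  { s with reg := Function.update s.reg x v }

/-- `mem a i j := v`. -/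
def State.setCell (s : State) (a i j v : ℕ) : State :=
  { s with mem := fun a' i' j' => if a' = a ∧ i' = i ∧ j' = j then v else s.mem a' i' j' }

/-- Writes the coordinates of `v` into the entries `(i, 0), …, (i, n - 1)` of array `a`. -/
def State.setRow {n : ℕ} (s : State) (a i : ℕ) (v : Vec n) : State :=
  { s with mem := fun a' i' j' =>
      if h : a' = a ∧ i' = i ∧ j' < n then (v ⟨j', h.2.2⟩).val else s.mem a' i' j' }

/-- `Exec ω p s t s'`: with randomness `ω`, program `p` started in state `s` halts in state `s'`
after exactly `t` steps. Drawing an element of `𝔽₂ⁿ` from the oracle takes `n` steps on top of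
the cost of the instruction itself. -/
inductive Exec {n : ℕ} (ω : Tape n) : Prog → State → ℕ → State → Prop
  | skip (s : State) : Exec ω .skip s 1 s
  | set (x : ℕ) (e : Expr) (s : State) :
      Exec ω (.set x e) s (e.cost + 1) (s.setReg x (e.eval s))
  | store (a : ℕ) (i j e : Expr) (s : State) :
      Exec ω (.store a i j e) s (i.cost + j.cost + e.cost + 1)
        (s.setCell a (i.eval s) (j.eval s) (e.eval s))
  | flip (x : ℕ) (s : State) :
      Exec ω (.flip x) s 1
        { s.setReg x (ω.2 s.flips).toNat with flips := s.flips + 1 }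
  | sample (a : ℕ) (i : Expr) (s : State) :
      Exec ω (.sample a i) s (i.cost + n + 1)
        { s.setRow a (i.eval s) (ω.1 s.samples) with samples := s.samples + 1 }
  | seq {p q : Prog} {s s' s'' : State} {t t' : ℕ} :
      Exec ω p s t s' → Exec ω q s' t' s'' → Exec ω (.seq p q) s (t + t') s''
  | cond_true {e : Expr} {p : Prog} (q : Prog) {s s' : State} {t : ℕ} :
      e.eval s ≠ 0 → Exec ω p s t s' → Exec ω (.cond e p q) s (e.cost + 1 + t) s'
  | cond_false {e : Expr} (p : Prog) {q : Prog} {s s' : State} {t : ℕ} :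
      e.eval s = 0 → Exec ω q s t s' → Exec ω (.cond e p q) s (e.cost + 1 + t) s'
  | loop_true {e : Expr} {p : Prog} {s s' s'' : State} {t t' : ℕ} :
      e.eval s ≠ 0 → Exec ω p s t s' → Exec ω (.loop e p) s' t' s'' →
        Exec ω (.loop e p) s (e.cost + 1 + t + t') s''
  | loop_false {e : Expr} (p : Prog) {s : State} :
      e.eval s = 0 → Exec ω (.loop e p) s (e.cost + 1) s

/-! ### Input and output -/

/-- The initial state. The input is the ambient dimension `n` in register `0`, and numerator and
denominator of the weight bound `wmin` (registers `1`, `2`), of the confidence parameter `δ`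
(registers `3`, `4`) and of the accuracy `ε` (registers `5`, `6`). -/
def initState (n : ℕ) (wmin δ ε : ℚ) : State where
  reg
    | 0 => n
    | 1 => wmin.num.natAbs
    | 2 => wmin.den
    | 3 => δ.num.natAbs
    | 4 => δ.den
    | 5 => ε.num.natAbs
    | 6 => ε.den
    | _ => 0
  mem := fun _ _ _ => 0
  samples := 0
  flips := 0

/-- The first `k` rows of array `a` are a basis of the subspace `A`. -/
def HoldsBasis {n : ℕ} (s : State) (a k : ℕ) (A : Subsp n) : Prop :=
  ∃ b : Fin k → Vec n,
    LinearIndependent (ZMod 2) b ∧ Submodule.span (ZMod 2) (Set.range b) = A ∧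
      ∀ (i : Fin k) (j : Fin n), s.mem a i j = (b i j).val

/-- The output stored in state `s` consists of the subspaces `U` and `V` (bases in arrays `0` and
`1`, dimensions in registers `0` and `1`) and of the weights `u` and `v` (numerators and
denominators in registers `2`, `3` and `4`, `5`). -/
def Outputs {n : ℕ} (s : State) (U V : Subsp n) (u v : ℝ) : Prop :=
  HoldsBasis s 0 (s.reg 0) U ∧ HoldsBasis s 1 (s.reg 1) V ∧
    s.reg 3 ≠ 0 ∧ u = (s.reg 2 : ℝ) / (s.reg 3 : ℝ) ∧
    s.reg 5 ≠ 0 ∧ v = (s.reg 4 : ℝ) / (s.reg 5 : ℝ)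

/-- The output is correct: it consists of exactly the two subspaces, each with an estimate of its
own weight, and the estimates have total error at most `ε`. The oracle does not determine which of
the two components is listed first, and neither does the output. -/
def Correct {n : ℕ} (s : State) (A₀ A₁ : Subsp n) (w₀ w₁ ε : ℝ) : Prop :=
  ∃ u₀ u₁ : ℝ, |w₀ - u₀| + |w₁ - u₁| ≤ ε ∧
    (Outputs s A₀ A₁ u₀ u₁ ∨ Outputs s A₁ A₀ u₁ u₀)

/-! ### A program logic for the machine -/

/-! The proof linearises the union of the two subspaces. Write A and B for them and `tsq x` for x ⊗
x. A point x outside A ∪ B is separated from A ∪ B by a product of two linear forms, one vanishing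
on A and one on B. Hence `tsq x` lies in the span of the squares of A ∪ B exactly when x ∈ A ∪ B
(`tsq_mem_span_union`). Gaussian elimination in dimension n² therefore decides membership in the
unknown union, as soon as the squares of the samples span the squares of all its points. This fails
only if some quadratic form that is nonzero somewhere on A ∪ B vanishes on every sample. Such a form
is nonzero on at least a quarter of A or of B (`ncard_le_four_mul`), so it vanishes on one sample
with probability at most 1 - wmin/4, and a union bound over the 2^(n²) forms shows that polynomially
many samples suffice.

At most n² samples are kept, forming together with 0 a set K whose squares have the same span.
Incomparability yields x, y in K with x + y outside A ∪ B, and then one of them lies in A \ B and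
the other in B \ A. If x ∈ A \ B, a point z of A ∪ B lies in A exactly when x + z lies in A ∪ B, so
the test sorts K into its two halves. These span A and B: all of A is contained in span(K ∩ A) ∪ B,
and a subspace covered by two subspaces lies in one of them (`span_inter_eq`).

A sample avoids B with probability w_A (1 - |A ∩ B| / |A|) = w_A (1 - |B| / |A + B|). The bracket is
known once the subspaces are, and it is at least 1/2, so an empirical frequency that is accurate to
ε/4 by Hoeffding's inequality gives the weight up to ε/2 (`Learned.outputs`).

The program uses no coin flips. `Runs.learn` describes its result and cost for every tape,
`one_sub_le_real_good` bounds the probability of bad samples, and `failure_le` and `steps_le_real`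
settle the constants. -/

@[simp] theorem State.setReg_reg (s : State) (x v y : ℕ) :
    (s.setReg x v).reg y = if y = x then v else s.reg y := by
  simp [State.setReg, Function.update_apply]

@[simp] theorem State.setReg_mem (s : State) (x v : ℕ) : (s.setReg x v).mem = s.mem := rfl

@[simp] theorem State.setReg_samples (s : State) (x v : ℕ) :
    (s.setReg x v).samples = s.samples := rfl

/-- All memory cells hold bits. -/
def Bits (s : State) : Prop := ∀ a i j, s.mem a i j ≤ 1

/-- Exclusive or of two bits. -/
def Expr.bxor (e f : Expr) : Expr := .add (.sub e f) (.sub f e)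

/-- Conjunction of two bits. -/
def Expr.band (e f : Expr) : Expr := .sub (.add e f) (.const 1)

/-- Expressions that have a bit as their value whenever the memory consists of bits. -/
inductive Expr.IsBit : Expr → Prop
  | cell (a : ℕ) (i j : Expr) : IsBit (.cell a i j)
  | bxor {e f : Expr} : IsBit e → IsBit f → IsBit (e.bxor f)
  | band {e f : Expr} : IsBit e → IsBit f → IsBit (e.band f)

theorem Expr.IsBit.eval_le {e : Expr} (he : e.IsBit) {s : State} (hs : Bits s) :
    e.eval s ≤ 1 := by
  induction he with
  | cell a i j => exact hs _ _ _
  | bxor _ _ h₁ h₂ => simp only [Expr.bxor, Expr.eval]; omega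
  | band _ _ h₁ h₂ => simp only [Expr.band, Expr.eval]; omega

theorem Expr.IsBit.cast_bxor {e f : Expr} (he : e.IsBit) (hf : f.IsBit) {s : State}
    (hs : Bits s) :
    ((e.bxor f).eval s : ZMod 2) = (e.eval s : ZMod 2) + (f.eval s : ZMod 2) := by
  have h₁ := he.eval_le hs
  have h₂ := hf.eval_le hs
  simp only [Expr.bxor, Expr.eval]
  generalize e.eval s = x at *
  generalize f.eval s = y at *
  interval_cases x <;> interval_cases y <;> decide

theorem Expr.IsBit.cast_band {e f : Expr} (he : e.IsBit) (hf : f.IsBit) {s : State}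
    (hs : Bits s) :
    ((e.band f).eval s : ZMod 2) = (e.eval s : ZMod 2) * (f.eval s : ZMod 2) := by
  have h₁ := he.eval_le hs
  have h₂ := hf.eval_le hs
  simp only [Expr.band, Expr.eval]
  generalize e.eval s = x at *
  generalize f.eval s = y at *
  interval_cases x <;> interval_cases y <;> decide

theorem natCast_zmod_two_eq_zero {k : ℕ} (hk : k ≤ 1) : (k : ZMod 2) = 0 ↔ k = 0 := by
  interval_cases k <;> decide

namespace Prog

/-- The registers that a program may write. -/
def regs : Prog → List ℕ
  | skip => []
  | set x _ => [x]
  | store _ _ _ _ => []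
  | flip x => [x]
  | sample _ _ => []
  | seq p q => p.regs ++ q.regs
  | cond _ p q => p.regs ++ q.regs
  | loop _ p => p.regs

/-- The arrays that a program may write. -/
def arrays : Prog → List ℕ
  | skip => []
  | set _ _ => []
  | store a _ _ _ => [a]
  | flip _ => []
  | sample a _ => [a]
  | seq p q => p.arrays ++ q.arrays
  | cond _ p q => p.arrays ++ q.arrays
  | loop _ p => p.arrays

/-- Whether a program may consult the oracle. -/
def draws : Prog → Bool
  | skip => false
  | set _ _ => false
  | store _ _ _ _ => false
  | flip _ => false
  | sample _ _ => true
  | seq p q => p.draws || q.draws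
  | cond _ p q => p.draws || q.draws
  | loop _ p => p.draws

/-- The program stores only bits in memory. -/
def BitSafe : Prog → Prop
  | skip => True
  | set _ _ => True
  | store _ _ _ e => e.IsBit
  | flip _ => True
  | sample _ _ => True
  | seq p q => p.BitSafe ∧ q.BitSafe
  | cond _ p q => p.BitSafe ∧ q.BitSafe
  | loop _ p => p.BitSafe

/-- `for c = 0, …, b - 1 do p`, where `c` and `b` are registers. -/
def forTo (c b : ℕ) (p : Prog) : Prog :=
  .seq (.set c (.const 0))
    (.loop (.sub (.reg b) (.reg c)) (.seq p (.set c (.add (.reg c) (.const 1)))))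

end Prog

/-- What does not change between the states `s` and `s'` when program `p` is executed. -/
structure Frame (p : Prog) (s s' : State) : Prop where
  reg : ∀ x, x ∉ p.regs → s'.reg x = s.reg x
  mem : ∀ a, a ∉ p.arrays → s'.mem a = s.mem a
  samples : p.draws = false → s'.samples = s.samples
  bits : p.BitSafe → Bits s → Bits s'

theorem Frame.refl (p : Prog) (s : State) : Frame p s s :=
  ⟨fun _ _ => rfl, fun _ _ => rfl, fun _ => rfl, fun _ h => h⟩

theorem Frame.trans {p : Prog} {s s' s'' : State} (h : Frame p s s') (h' : Frame p s' s'') :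
    Frame p s s'' :=
  ⟨fun x hx => (h'.reg x hx).trans (h.reg x hx), fun a ha => (h'.mem a ha).trans (h.mem a ha),
    fun hd => (h'.samples hd).trans (h.samples hd), fun hb hs => h'.bits hb (h.bits hb hs)⟩

theorem Frame.mono {p q : Prog} {s s' : State} (h : Frame p s s')
    (hr : ∀ x ∈ p.regs, x ∈ q.regs) (ha : ∀ x ∈ p.arrays, x ∈ q.arrays)
    (hd : q.draws = false → p.draws = false) (hb : q.BitSafe → p.BitSafe) : Frame q s s' :=
  ⟨fun x hx => h.reg x fun hx' => hx (hr x hx'), fun a ha' => h.mem a fun h' => ha' (ha a h'),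
    fun h' => h.samples (hd h'), fun h' => h.bits (hb h')⟩

section Exec

variable {n : ℕ} {ω : Tape n}

/-- The footprint of a program is read off its text, so that facts about untouched registers and
arrays pass across a subroutine without any analysis of its execution. -/
theorem Exec.frame {p : Prog} {s s' : State} {t : ℕ} (h : Exec ω p s t s') : Frame p s s' := by
  induction h with
  | skip s => exact Frame.refl _ _
  | set x e s =>
    refine ⟨fun y hy => ?_, fun _ _ => rfl, fun _ => rfl, fun _ h => h⟩
    simp only [Prog.regs, List.mem_singleton] at hy
    simp [hy]
  | store a i j e s =>
    refine ⟨fun _ _ => rfl, fun b hb => ?_, fun _ => rfl, fun he hs b k l => ?_⟩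
    · simp only [Prog.arrays, List.mem_singleton] at hb
      simp [State.setCell, hb]
    · simp only [State.setCell]
      split_ifs
      · exact Expr.IsBit.eval_le he hs
      · exact hs _ _ _
  | flip x s =>
    refine ⟨fun y hy => ?_, fun _ _ => rfl, fun _ => rfl, fun _ h => h⟩
    simp only [Prog.regs, List.mem_singleton] at hy
    simp [hy]
  | sample a i s =>
    refine ⟨fun _ _ => rfl, fun b hb => ?_, fun h => by simp [Prog.draws] at h,
      fun _ hs b k l => ?_⟩
    · simp only [Prog.arrays, List.mem_singleton] at hb
      funext k l
      simp [State.setRow, hb]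
    · simp only [State.setRow]
      split_ifs
      · exact Nat.le_of_lt_succ (ZMod.val_lt _)
      · exact hs _ _ _
  | seq _ _ h₁ h₂ =>
    refine Frame.trans (h₁.mono ?_ ?_ ?_ ?_) (h₂.mono ?_ ?_ ?_ ?_) <;>
      simp +contextual [Prog.regs, Prog.arrays, Prog.draws, Prog.BitSafe]
  | cond_true q _ _ h =>
    refine h.mono ?_ ?_ ?_ ?_ <;>
      simp +contextual [Prog.regs, Prog.arrays, Prog.draws, Prog.BitSafe]
  | cond_false p _ _ h =>
    refine h.mono ?_ ?_ ?_ ?_ <;>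
      simp +contextual [Prog.regs, Prog.arrays, Prog.draws, Prog.BitSafe]
  | loop_true _ _ _ h₁ h₂ =>
    refine Frame.trans (h₁.mono ?_ ?_ ?_ ?_) h₂ <;>
      simp +contextual [Prog.regs, Prog.arrays, Prog.draws, Prog.BitSafe]
  | loop_false p _ => exact Frame.refl _ _

/-- Started in state `s`, program `p` halts within `T` steps in a state that satisfies `Q`. -/
def Runs (ω : Tape n) (p : Prog) (s : State) (T : ℕ) (Q : State → Prop) : Prop :=
  ∃ t s', Exec ω p s t s' ∧ t ≤ T ∧ Q s'

theorem Runs.mono {p : Prog} {s : State} {T T' : ℕ} {Q Q' : State → Prop}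
    (h : Runs ω p s T Q) (hT : T ≤ T') (hQ : ∀ s', Frame p s s' → Q s' → Q' s') :
    Runs ω p s T' Q' := by
  obtain ⟨t, s', he, ht, hq⟩ := h
  exact ⟨t, s', he, ht.trans hT, hQ s' he.frame hq⟩

theorem Runs.skip {s : State} {T : ℕ} {Q : State → Prop} (hT : 1 ≤ T) (h : Q s) :
    Runs ω .skip s T Q :=
  ⟨1, s, .skip s, hT, h⟩

theorem Runs.set {s : State} {Q : State → Prop} {x : ℕ} {e : Expr}
    (h : Q (s.setReg x (e.eval s))) : Runs ω (.set x e) s (e.cost + 1) Q :=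
  ⟨_, _, .set x e s, le_rfl, h⟩

theorem Runs.store {s : State} {Q : State → Prop} {a : ℕ} {i j e : Expr}
    (h : Q (s.setCell a (i.eval s) (j.eval s) (e.eval s))) :
    Runs ω (.store a i j e) s (i.cost + j.cost + e.cost + 1) Q :=
  ⟨_, _, .store a i j e s, le_rfl, h⟩

theorem Runs.sample {s : State} {Q : State → Prop} {a : ℕ} {i : Expr}
    (h : Q { s.setRow a (i.eval s) (ω.1 s.samples) with samples := s.samples + 1 }) :
    Runs ω (.sample a i) s (i.cost + n + 1) Q :=
  ⟨_, _, .sample a i s, le_rfl, h⟩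

theorem Runs.seq {p q : Prog} {s : State} {T T' : ℕ} {Q : State → Prop}
    (h : Runs ω p s T fun s' => Frame p s s' → Runs ω q s' T' Q) :
    Runs ω (.seq p q) s (T + T') Q := by
  obtain ⟨t, s', he, ht, h'⟩ := h
  obtain ⟨t', s'', he', ht', hq⟩ := h' he.frame
  exact ⟨t + t', s'', he.seq he', by omega, hq⟩

theorem Runs.cond {p q : Prog} {e : Expr} {s : State} {T : ℕ} {Q : State → Prop}
    (hp : e.eval s ≠ 0 → Runs ω p s T Q) (hq : e.eval s = 0 → Runs ω q s T Q) :
    Runs ω (.cond e p q) s (e.cost + 1 + T) Q := by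
  by_cases h : e.eval s = 0
  · obtain ⟨t, s', he, ht, hQ⟩ := hq h
    exact ⟨_, s', .cond_false p h he, by omega, hQ⟩
  · obtain ⟨t, s', he, ht, hQ⟩ := hp h
    exact ⟨_, s', .cond_true q h he, by omega, hQ⟩

/-- A loop that is left after `k` rounds. -/
theorem Runs.loop {p : Prog} {e : Expr} {T : ℕ} (Inv : ℕ → State → Prop)
    (hstep : ∀ k s, Inv (k + 1) s → e.eval s ≠ 0 ∧ Runs ω p s T (Inv k))
    (hend : ∀ s, Inv 0 s → e.eval s = 0) (k : ℕ) (s : State) (h : Inv k s) :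
    Runs ω (.loop e p) s (k * (T + e.cost + 1) + e.cost + 1) (Inv 0) := by
  induction k generalizing s with
  | zero => exact ⟨_, s, .loop_false p (hend s h), by simp, h⟩
  | succ k ih =>
    obtain ⟨h0, t, s', he, ht, hs'⟩ := hstep k s h
    obtain ⟨t', s'', he', ht', hs''⟩ := ih s' hs'
    exact ⟨_, s'', .loop_true h0 he he', by rw [Nat.succ_mul]; omega, hs''⟩

/-- The body writes neither counter nor bound, so the number of rounds is fixed at the start. Each
round pays 4 for the loop test and 4 for the increment; the remaining 6 are the initialisation and
the last test. -/
theorem Runs.forTo {c b : ℕ} {p : Prog} {s : State} {T : ℕ} (Inv : ℕ → State → Prop)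
    (hc : c ∉ p.regs) (hb : b ∉ p.regs) (hcb : b ≠ c) (h0 : Inv 0 (s.setReg c 0))
    (hstep : ∀ k < s.reg b, ∀ s₁, s₁.reg c = k → Frame (.forTo c b p) s s₁ → Inv k s₁ →
      Runs ω p s₁ T fun s₂ => Frame p s₁ s₂ → Inv (k + 1) (s₂.setReg c (k + 1))) :
    Runs ω (.forTo c b p) s (s.reg b * (T + 8) + 6) fun s' => Inv (s.reg b) s' := by
  let p' : Prog := .seq p (.set c (.add (.reg c) (.const 1)))
  have hfr : ∀ {s₁ s₂}, Frame p' s₁ s₂ → Frame (.forTo c b p) s₁ s₂ := by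
    intro s₁ s₂ h
    refine h.mono ?_ ?_ ?_ ?_ <;>
      simp +contextual [p', Prog.forTo, Prog.regs, Prog.arrays, Prog.draws, Prog.BitSafe]
  -- `Runs.loop` counts the remaining rounds `k`, while `Inv` counts the completed rounds `m`; their
  -- sum is the bound.
  have hmain := Runs.loop (ω := ω) (p := p') (e := .sub (.reg b) (.reg c)) (T := T + 4)
    (fun k s' => ∃ m, m + k = s.reg b ∧ s'.reg c = m ∧ s'.reg b = s.reg b ∧ Inv m s' ∧
      Frame (.forTo c b p) s s') ?_ ?_ (s.reg b) (s.setReg c 0) ?_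
  · obtain ⟨t, s', he, ht, m, hm, -, -, hInv, -⟩ := hmain
    refine ⟨2 + t, s', Exec.seq (.set c (.const 0) s) he, ?_, ?_⟩
    · simp only [Expr.cost] at ht ⊢
      have : s.reg b * (T + 4 + (1 + 1 + 1) + 1) = s.reg b * (T + 8) := by ring
      omega
    · have : m = s.reg b := by omega
      exact this ▸ hInv
  · rintro k s₁ ⟨m, hm, h₁, h₂, hInv, hF⟩
    refine ⟨?_, ?_⟩
    · simp only [Expr.eval, h₁, h₂]; omega
    · obtain ⟨t, s₂, he, ht, hs₂⟩ := hstep m (by omega) s₁ h₁ hF hInv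
      have hF' := he.frame
      have hr : s₂.reg c = m := (hF'.reg c hc).trans h₁
      have he' : Exec ω p' s₁ (t + 4) (s₂.setReg c (m + 1)) := by
        have := Exec.seq he (.set (ω := ω) c (.add (.reg c) (.const 1)) s₂)
        simpa [Expr.eval, Expr.cost, hr] using this
      refine ⟨t + 4, _, he', by omega, m + 1, by omega, by simp, ?_, hs₂ hF',
        hF.trans (hfr he'.frame)⟩
      simp [hcb, hF'.reg b hb, h₂]
  · rintro s₁ ⟨m, hm, h₁, h₂, -⟩
    simp only [Expr.eval, h₁, h₂]; omega
  · refine ⟨0, by omega, by simp, by simp [hcb], h0, ?_⟩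
    have := (Exec.set (ω := ω) c (.const 0) s).frame
    refine this.mono ?_ ?_ ?_ ?_ <;>
      simp +contextual [Prog.forTo, Prog.regs, Prog.arrays, Prog.draws, Prog.BitSafe]

end Exec

/-! ### Echelon forms -/

/-- Row `p` vanishes to the left of position `p`, and vanishes altogether unless it has a pivot at
position `p`. -/
def Echelon {D : ℕ} (r : Fin D → Vec D) : Prop :=
  ∀ p, (∀ j < p, r p j = 0) ∧ (r p p = 0 → r p = 0)

namespace Echelon

variable {D : ℕ} {r : Fin D → Vec D}

theorem zero : Echelon (0 : Fin D → Vec D) := fun _ => ⟨fun _ _ => rfl, fun _ => rfl⟩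

/-- In a combination of the rows that vanishes left of `q`, every term with index below `q` is zero,
by induction: coordinate `m` reads `c m * r m m`, so either the coefficient or the pivot vanishes,
and without its pivot the row is zero. Coordinate `q` is then `c q * r q q = 0`. -/
theorem notMem_span (hr : Echelon r) {q : Fin D} (hq : r q q = 0) {v : Vec D} (hv : v q ≠ 0)
    (hlt : ∀ j < q, v j = 0) : v ∉ Submodule.span (ZMod 2) (Set.range r) := by
  intro hmem
  obtain ⟨c, rfl⟩ := (Submodule.mem_span_range_iff_exists_fun _).1 hmem
  have key : ∀ m : Fin D, m ≤ q → (∀ p < m, c p • r p = 0) →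
      (∑ p, c p • r p) m = c m * r m m := by
    intro m _ hm
    rw [Finset.sum_apply, Finset.sum_eq_single m]
    · simp
    · intro p _ hp
      rcases lt_or_gt_of_ne hp with h | h
      · rw [hm p h]; rfl
      · simp [(hr p).1 m h]
    · simp
  have hz : ∀ m : Fin D, m < q → c m • r m = 0 := by
    intro m
    induction m using WellFoundedLT.induction with
    | _ m ih =>
      intro hm
      have h := key m hm.le fun p hp => ih p hp (hp.trans hm)
      rw [hlt m hm] at h
      rcases mul_eq_zero.1 h.symm with h | h
      · rw [h, zero_smul]
      · rw [(hr m).2 h, smul_zero]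
  apply hv
  rw [key q le_rfl hz, hq, mul_zero]

theorem update (hr : Echelon r) {q : Fin D} {v : Vec D} (hv : v q ≠ 0)
    (hlt : ∀ j < q, v j = 0) : Echelon (Function.update r q v) := by
  intro p
  by_cases hp : p = q
  · subst hp
    simp only [Function.update_self]
    exact ⟨hlt, fun h => absurd h hv⟩
  · simpa [Function.update_of_ne hp] using hr p

end Echelon

theorem span_range_update {K M ι : Type*} [Ring K] [AddCommGroup M] [Module K M] [DecidableEq ι]
    {r : ι → M} {q : ι} (hq : r q = 0) (v : M) :
    Submodule.span K (Set.range (Function.update r q v)) =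
      Submodule.span K (Set.range r) ⊔ Submodule.span K {v} := by
  apply le_antisymm
  · rw [Submodule.span_le]
    rintro _ ⟨p, rfl⟩
    by_cases hp : p = q
    · subst hp
      simpa using Submodule.mem_sup_right (Submodule.mem_span_singleton_self v)
    · rw [Function.update_of_ne hp]
      exact Submodule.mem_sup_left (Submodule.subset_span ⟨p, rfl⟩)
  · refine sup_le ?_ ?_
    · rw [Submodule.span_le]
      rintro _ ⟨p, rfl⟩
      by_cases hp : p = q
      · subst hp; simp [hq]
      · exact Submodule.subset_span ⟨p, by simp [hp]⟩
    · rw [Submodule.span_singleton_le_iff_mem]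
      exact Submodule.subset_span ⟨q, by simp⟩

/-- The state of the reduction of `v₀` modulo the rows `r` after the columns left of `p` have been
processed: `v` is the current remainder, `f` tells whether some column without pivot has been met
in which the remainder does not vanish, and `q` is the first such column. -/
def Reduced {D : ℕ} (r : Fin D → Vec D) (v₀ v : Vec D) (p f q : ℕ) : Prop :=
  v - v₀ ∈ Submodule.span (ZMod 2) (Set.range r) ∧
    ((f = 0 ∧ ∀ j : Fin D, j.val < p → v j = 0) ∨
      (f = 1 ∧ ∃ i : Fin D, i.val = q ∧ i.val < p ∧ r i i = 0 ∧ v i ≠ 0 ∧ ∀ j < i, v j = 0))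

namespace Reduced

variable {D : ℕ} {r : Fin D → Vec D} {v₀ v : Vec D} {f q : ℕ}

theorem start : Reduced r v₀ v₀ 0 0 q := ⟨by simp, .inl ⟨rfl, fun _ h => by simp at h⟩⟩

theorem step_zero {k : Fin D} (h : Reduced r v₀ v k f q) (hk : v k = 0) :
    Reduced r v₀ v (k + 1) f q := by
  refine ⟨h.1, h.2.imp (fun ⟨h₁, h₂⟩ => ⟨h₁, fun j hj => ?_⟩)
    fun ⟨h₁, i, h₂, h₃, h₄⟩ => ⟨h₁, i, h₂, by omega, h₄⟩⟩
  rcases (Nat.lt_succ_iff_lt_or_eq.1 hj) with hj | hj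
  · exact h₂ j hj
  · rwa [Fin.ext hj]

theorem sub_mem_add (h : v - v₀ ∈ Submodule.span (ZMod 2) (Set.range r)) (k : Fin D) :
    v + r k - v₀ ∈ Submodule.span (ZMod 2) (Set.range r) := by
  rw [add_sub_right_comm]
  exact add_mem h (Submodule.subset_span ⟨k, rfl⟩)

theorem zmod_two_add {a b : ZMod 2} (ha : a ≠ 0) (hb : b ≠ 0) : a + b = 0 := by
  revert a b; decide

theorem step_pivot (hr : Echelon r) {k : Fin D} (h : Reduced r v₀ v k f q) (hk : v k ≠ 0)
    (hkk : r k k ≠ 0) : Reduced r v₀ (v + r k) (k + 1) f q := by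
  refine ⟨sub_mem_add h.1 k, h.2.imp (fun ⟨h₁, h₂⟩ => ⟨h₁, fun j hj => ?_⟩)
    fun ⟨h₁, i, h₂, h₃, h₄, h₅, h₆⟩ => ⟨h₁, i, h₂, by omega, h₄, ?_, fun j hj => ?_⟩⟩
  · rcases (Nat.lt_succ_iff_lt_or_eq.1 hj) with hj | hj
    · simp [h₂ j hj, (hr k).1 j hj]
    · rw [Fin.ext hj]; exact zmod_two_add hk hkk
  · simpa [(hr k).1 i h₃] using h₅
  · simp [h₆ j hj, (hr k).1 j (hj.trans h₃)]

/-- A row without pivot is zero, so the unconditional addition of row `k` does no harm. -/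
theorem step_again (hr : Echelon r) {k : Fin D} (h : Reduced r v₀ v k f q) (hf : f ≠ 0)
    (hkk : r k k = 0) : Reduced r v₀ (v + r k) (k + 1) f q := by
  refine ⟨sub_mem_add h.1 k, .inr ?_⟩
  rcases h.2 with ⟨h₁, -⟩ | ⟨h₁, i, h₂, h₃, h₄, h₅, h₆⟩
  · exact absurd h₁ hf
  · rw [(hr k).2 hkk, add_zero]
    exact ⟨h₁, i, h₂, by omega, h₄, h₅, h₆⟩

theorem step_first (hr : Echelon r) {k : Fin D} (h : Reduced r v₀ v k f q) (hf : f = 0)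
    (hk : v k ≠ 0) (hkk : r k k = 0) : Reduced r v₀ (v + r k) (k + 1) 1 k := by
  refine ⟨sub_mem_add h.1 k, .inr ⟨rfl, k, rfl, by omega, hkk, ?_, ?_⟩⟩ <;>
    rw [(hr k).2 hkk, add_zero]
  · exact hk
  · rcases h.2 with ⟨-, h₂⟩ | ⟨h₁, -⟩
    · exact fun j hj => h₂ j hj
    · omega

theorem mem_iff (hr : Echelon r) (h : Reduced r v₀ v D f q) :
    v₀ ∈ Submodule.span (ZMod 2) (Set.range r) ↔ f = 0 := by
  have hv : v₀ ∈ Submodule.span (ZMod 2) (Set.range r) ↔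
      v ∈ Submodule.span (ZMod 2) (Set.range r) := by
    constructor <;> intro hm
    · simpa using add_mem h.1 hm
    · simpa using sub_mem hm h.1
  rw [hv]
  rcases h.2 with ⟨h₁, h₂⟩ | ⟨h₁, i, -, -, h₄, h₅, h₆⟩
  · have : v = 0 := funext fun j => h₂ j j.2
    simp [this, h₁]
  · simp [h₁, hr.notMem_span h₄ h₅ h₆]

/-- This permits the remainder to be stored in place of the original vector. -/
theorem span_sup (h : Reduced r v₀ v D f q) :
    Submodule.span (ZMod 2) (Set.range r) ⊔ Submodule.span (ZMod 2) {v} =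
      Submodule.span (ZMod 2) (Set.range r) ⊔ Submodule.span (ZMod 2) {v₀} := by
  apply le_antisymm <;> refine sup_le le_sup_left ?_ <;>
    rw [Submodule.span_singleton_le_iff_mem]
  · rw [← sub_add_cancel v v₀]
    exact add_mem (Submodule.mem_sup_left h.1)
      (Submodule.mem_sup_right (Submodule.mem_span_singleton_self v₀))
  · rw [← sub_sub_cancel v v₀]
    exact sub_mem (Submodule.mem_sup_right (Submodule.mem_span_singleton_self v))
      (Submodule.mem_sup_left h.1)

/-- If `v₀` is not in the span of the rows, then its remainder is a new row. -/
theorem pivot (h : Reduced r v₀ v D f q) (hf : f ≠ 0) :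
    ∃ i : Fin D, i.val = q ∧ r i i = 0 ∧ v i ≠ 0 ∧ ∀ j < i, v j = 0 := by
  rcases h.2 with ⟨h₁, -⟩ | ⟨-, i, h₂, -, h₄⟩
  · exact absurd h₁ hf
  · exact ⟨i, h₂, h₄⟩

end Reduced

/-! ### Quadratic forms on subspaces -/

/-- The tensor product of two vectors. -/
def tensor {n : ℕ} (x y : Vec n) : Vec (n * n) := fun k => x k.divNat * y k.modNat

/-- The tensor square of a vector. -/
def tsq {n : ℕ} (x : Vec n) : Vec (n * n) := tensor x x

section Tensor

variable {n : ℕ}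

theorem tensor_add_left (x y z : Vec n) : tensor (x + y) z = tensor x z + tensor y z := by
  funext k; simp [tensor, add_mul]

theorem tensor_add_right (x y z : Vec n) : tensor x (y + z) = tensor x y + tensor x z := by
  funext k; simp [tensor, mul_add]

theorem tsq_add (x y : Vec n) : tsq (x + y) = tsq x + tsq y + (tensor x y + tensor y x) := by
  simp only [tsq, tensor_add_left, tensor_add_right]; abel

@[simp] theorem tsq_zero : tsq (0 : Vec n) = 0 := by funext k; simp [tsq, tensor]

theorem Vec.add_self (x : Vec n) : x + x = 0 := by
  funext k; exact CharTwo.add_self_eq_zero (x k)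

/-- The product of two linear forms is a linear form in the tensor product. -/
theorem exists_dual_tensor (f g : Module.Dual (ZMod 2) (Vec n)) :
    ∃ φ : Module.Dual (ZMod 2) (Vec (n * n)), ∀ x y, φ (tensor x y) = f x * g y := by
  refine ⟨∑ k : Fin (n * n),
    (f (Pi.single k.divNat 1) * g (Pi.single k.modNat 1)) • LinearMap.proj k, fun x y => ?_⟩
  have hf : ∀ (f : Module.Dual (ZMod 2) (Vec n)) (x : Vec n),
      f x = ∑ i, x i * f (Pi.single i 1) := by
    intro f x
    conv_lhs => rw [pi_eq_sum_univ' x, map_sum]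
    simp [Pi.single]
  rw [hf f x, hf g y, Finset.sum_mul_sum, ← Fintype.sum_prod_type',
    ← finProdFinEquiv.symm.sum_comp]
  simp [tensor, finProdFinEquiv]
  refine Finset.sum_congr rfl fun k _ => by ring

theorem exists_dual_eq_one {D : ℕ} {A : Subsp D} {x : Vec D} (hx : x ∉ A) :
    ∃ f : Module.Dual (ZMod 2) (Vec D), f x ≠ 0 ∧ ∀ a ∈ A, f a = 0 := by
  obtain ⟨f, hf, hA⟩ := Submodule.exists_le_ker_of_notMem hx
  exact ⟨f, hf, fun a ha => hA ha⟩

/-- The union of two subspaces is cut out by quadratic forms. -/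
theorem tsq_mem_span_union (A B : Subsp n) (x : Vec n) :
    tsq x ∈ Submodule.span (ZMod 2) (tsq '' ((A : Set (Vec n)) ∪ B)) ↔ x ∈ A ∨ x ∈ B := by
  constructor
  · intro h
    by_contra! hx
    -- The form f ⊗ g takes the value f(y) g(y) on `tsq y`: zero on both subspaces, nonzero at `x`.
    obtain ⟨f, hfx, hf⟩ := exists_dual_eq_one hx.1
    obtain ⟨g, hgx, hg⟩ := exists_dual_eq_one hx.2
    obtain ⟨φ, hφ⟩ := exists_dual_tensor f g
    have : Submodule.span (ZMod 2) (tsq '' ((A : Set (Vec n)) ∪ B)) ≤ LinearMap.ker φ := by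
      rw [Submodule.span_le]
      rintro _ ⟨y, hy | hy, rfl⟩
      · simp [tsq, hφ, hf y hy]
      · simp [tsq, hφ, hg y hy]
    have := this h
    simp [tsq, hφ, hfx, hgx] at this
  · exact fun h => Submodule.subset_span ⟨x, h, rfl⟩

/-- A quadratic form that does not vanish on a subspace is nonzero on at least a quarter of it. -/
theorem ncard_le_four_mul (φ : Module.Dual (ZMod 2) (Vec (n * n))) (A : Subsp n)
    (hA : ∃ x ∈ A, φ (tsq x) ≠ 0) :
    (A : Set (Vec n)).ncard ≤ 4 * {x ∈ (A : Set (Vec n)) | φ (tsq x) ≠ 0}.ncard := by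
  obtain ⟨x, hx, hφx⟩ := hA
  set K := {x ∈ (A : Set (Vec n)) | φ (tsq x) ≠ 0} with hK
  let b : Vec n → ZMod 2 := fun u => φ (tensor u x + tensor x u)
  have hb : ∀ u v, b (u + v) = b u + b v := by
    intro u v
    simp only [b, tensor_add_left, tensor_add_right, map_add]; abel
  have hone : ∀ a : ZMod 2, a ≠ 0 → a = 1 := by decide
  have hzero : ∀ u ∈ A, b u = 0 → u ∈ K ∨ u + x ∈ K := by
    -- `b` is the polar form of φ at `x`: where it vanishes, the values at `u` and `u + x` differ by
    -- the nonzero value at `x`, so they are not both zero.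
    intro u hu hbu
    by_cases h : φ (tsq u) = 0
    · refine .inr ⟨A.add_mem hu hx, ?_⟩
      have hbu' : φ (tensor u x + tensor x u) = 0 := hbu
      rw [tsq_add, map_add, map_add, h, hbu']
      simpa using hφx
    · exact .inl ⟨hu, h⟩
  -- The kernel of the additive map `b` on `A` has index at most two.
  obtain ⟨v, hv, hcov⟩ : ∃ v ∈ A, ∀ u ∈ A, b u = 0 ∨ b (u + v) = 0 := by
    by_cases h : ∃ v ∈ A, b v ≠ 0
    · obtain ⟨v, hv, hbv⟩ := h
      refine ⟨v, hv, fun u _ => ?_⟩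
      rw [hb]
      by_cases hu : b u = 0
      · exact .inl hu
      · exact .inr (Reduced.zmod_two_add hu hbv)
    · push Not at h
      exact ⟨0, A.zero_mem, fun u hu => .inl (h u hu)⟩
  -- Consequently four translates of `K` cover `A`.
  have hsub : (A : Set (Vec n)) ⊆
      (K ∪ (· + x) '' K) ∪ ((· + v) '' K ∪ (· + (x + v)) '' K) := by
    have hsh : ∀ u y : Vec n, u + y ∈ K → u ∈ (· + y) '' K := fun u y h =>
      ⟨u + y, h, by simp [add_assoc, Vec.add_self]⟩
    intro u hu
    rcases hcov u hu with h | h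
    · exact .inl ((hzero u hu h).imp id (hsh u x))
    · refine .inr ((hzero _ (A.add_mem hu hv) h).imp (hsh u v) fun h' => hsh u _ ?_)
      rwa [add_assoc, add_comm v x] at h'
  have hfin : ∀ s : Set (Vec n), s.Finite := fun s => s.toFinite
  have him : ∀ y : Vec n, ((· + y) '' K).ncard ≤ K.ncard := fun y => Set.ncard_image_le (hfin K)
  calc (A : Set (Vec n)).ncard ≤ _ := Set.ncard_le_ncard hsub (hfin _)
    _ ≤ (K.ncard + ((· + x) '' K).ncard) +
        (((· + v) '' K).ncard + ((· + (x + v)) '' K).ncard) :=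
      (Set.ncard_union_le _ _).trans
        (add_le_add (Set.ncard_union_le _ _) (Set.ncard_union_le _ _))
    _ ≤ _ := by have := him x; have := him v; have := him (x + v); omega

end Tensor

/-! ### Separating two subspaces -/

section Separate

variable {n : ℕ} {A B : Subsp n} {K : Set (Vec n)}

/-- If the squares of the points of `K ⊆ A ∪ B` span the squares of all points of `A ∪ B`, then
the points of `K` in `A` span `A`. -/
theorem span_inter_eq (hAB : ¬ A ≤ B) (hK : K ⊆ (A : Set (Vec n)) ∪ B)
    (hspan : ∀ z ∈ (A : Set (Vec n)) ∪ B, tsq z ∈ Submodule.span (ZMod 2) (tsq '' K)) :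
    Submodule.span (ZMod 2) (K ∩ A) = A := by
  set A' := Submodule.span (ZMod 2) (K ∩ A) with hA'
  have hle : A' ≤ A := Submodule.span_le.2 Set.inter_subset_right
  have hKA : K ⊆ (A' : Set (Vec n)) ∪ B := fun z hz =>
    (hK hz).imp (fun h => Submodule.subset_span ⟨hz, h⟩) id
  have hcov : ∀ z ∈ A, z ∈ A' ∨ z ∈ B := fun z hz =>
    -- As `K` lies in A' ∪ B, the span of its squares detects nothing outside A' ∪ B; thus `A` is
    -- covered by A' and `B`.
    (tsq_mem_span_union A' B z).1
      (Submodule.span_mono (Set.image_mono hKA) (hspan z (.inl hz)))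
  refine le_antisymm hle fun z hz => ?_
  obtain ⟨a, ha, haB⟩ := Set.not_subset.1 hAB
  have haA' := (hcov a ha).resolve_right haB
  rcases hcov z hz with h | h
  · exact h
  -- Translating a point of `B` by a point `a` outside `B` leaves `B`, so the cover puts the
  -- translate into A', which already contains `a`.
  · have h1 : z + a ∈ A' := (hcov _ (A.add_mem hz ha)).resolve_right fun h' =>
      haB (by simpa using B.sub_mem h' h)
    simpa using A'.sub_mem h1 haA'

/-- If `K ∩ A` were contained in `B`, so would be its span `A`. So `K` meets both A \ B and B \ A,
and the sum of two such points lies in neither subspace. -/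
theorem exists_tsq_add_notMem (hAB : Incomparable A B) (hK : K ⊆ (A : Set (Vec n)) ∪ B)
    (hspan : ∀ z ∈ (A : Set (Vec n)) ∪ B, tsq z ∈ Submodule.span (ZMod 2) (tsq '' K)) :
    ∃ x ∈ K, ∃ y ∈ K, tsq (x + y) ∉ Submodule.span (ZMod 2) (tsq '' K) := by
  have h₁ : ∃ x ∈ K ∩ A, x ∉ B := by
    by_contra! h
    exact hAB.1 ((span_inter_eq hAB.1 hK hspan).ge.trans (Submodule.span_le.2 h))
  have h₂ : ∃ y ∈ K ∩ B, y ∉ A := by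
    by_contra! h
    rw [Set.union_comm] at hK hspan
    exact hAB.2 ((span_inter_eq hAB.2 hK hspan).ge.trans (Submodule.span_le.2 h))
  obtain ⟨x, ⟨hxK, hxA⟩, hxB⟩ := h₁
  obtain ⟨y, ⟨hyK, hyB⟩, hyA⟩ := h₂
  refine ⟨x, hxK, y, hyK, fun h => ?_⟩
  rcases (tsq_mem_span_union A B _).1 (Submodule.span_mono (Set.image_mono hK) h) with h' | h'
  · exact hyA (by simpa using A.sub_mem h' hxA)
  · exact hxB (by simpa using B.sub_mem h' hyB)

/-- Translation by a point of A \ B turns the membership test for the union into one for `A` alone: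
if `z` and `x + z` were both in `B`, then `x` would be too. -/
theorem tsq_add_mem_iff (hK : K ⊆ (A : Set (Vec n)) ∪ B)
    (hspan : ∀ z ∈ (A : Set (Vec n)) ∪ B, tsq z ∈ Submodule.span (ZMod 2) (tsq '' K))
    {x : Vec n} (hxA : x ∈ A) (hxB : x ∉ B) {z : Vec n} (hz : z ∈ (A : Set (Vec n)) ∪ B) :
    tsq (x + z) ∈ Submodule.span (ZMod 2) (tsq '' K) ↔ z ∈ A := by
  constructor
  · intro h
    rcases (tsq_mem_span_union A B _).1 (Submodule.span_mono (Set.image_mono hK) h) with h' | h'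
    · simpa using A.sub_mem h' hxA
    · rcases hz with hz | hz
      · exact hz
      · exact absurd (by simpa using B.sub_mem h' hz) hxB
  · exact fun h => hspan _ (.inl (A.add_mem hxA h))

theorem mem_diff_of_tsq_add_notMem (hK : K ⊆ (A : Set (Vec n)) ∪ B)
    (hspan : ∀ z ∈ (A : Set (Vec n)) ∪ B, tsq z ∈ Submodule.span (ZMod 2) (tsq '' K))
    {x y : Vec n} (hx : x ∈ K) (hy : y ∈ K)
    (hxy : tsq (x + y) ∉ Submodule.span (ZMod 2) (tsq '' K)) :
    (x ∈ A ∧ x ∉ B ∧ y ∈ B ∧ y ∉ A) ∨ (x ∈ B ∧ x ∉ A ∧ y ∈ A ∧ y ∉ B) := by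
  have h₁ : x ∈ A → y ∉ A := fun h h' => hxy (hspan _ (.inl (A.add_mem h h')))
  have h₂ : x ∈ B → y ∉ B := fun h h' => hxy (hspan _ (.inr (B.add_mem h h')))
  have hx' : x ∈ A ∨ x ∈ B := hK hx
  have hy' : y ∈ A ∨ y ∈ B := hK hy
  tauto

/-- The weight formula needs the cardinality of `A ⊔ B`, which the program obtains from the span of
all kept samples. -/
theorem span_eq_sup (hAB : Incomparable A B) (hK : K ⊆ (A : Set (Vec n)) ∪ B)
    (hspan : ∀ z ∈ (A : Set (Vec n)) ∪ B, tsq z ∈ Submodule.span (ZMod 2) (tsq '' K)) :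
    Submodule.span (ZMod 2) K = A ⊔ B := by
  apply le_antisymm
  · rw [Submodule.span_le]
    exact fun z hz => (hK hz).elim (fun h => Submodule.mem_sup_left h)
      fun h => Submodule.mem_sup_right h
  · refine sup_le ?_ ?_
    · exact (span_inter_eq hAB.1 hK hspan).ge.trans (Submodule.span_mono Set.inter_subset_left)
    · rw [Set.union_comm] at hK hspan
      exact (span_inter_eq hAB.2 hK hspan).ge.trans (Submodule.span_mono Set.inter_subset_left)

end Separate

/-! ### Subroutines -/

/-- The first `D` entries of row `i` of array `a`, read as a vector. -/
def State.row (s : State) (D a i : ℕ) : Vec D := fun j => (s.mem a i j : ZMod 2)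

@[simp] theorem State.setReg_row (s : State) (x v D a i : ℕ) :
    (s.setReg x v).row D a i = s.row D a i := rfl

theorem State.row_congr {s s' : State} {a : ℕ} (h : s'.mem a = s.mem a) (D i : ℕ) :
    s'.row D a i = s.row D a i := by
  funext j
  rw [State.row, State.row, h]

theorem Bits.row_eq_zero_iff {s : State} (hs : Bits s) {D a i : ℕ} (j : Fin D) :
    s.row D a i j = 0 ↔ s.mem a i j = 0 :=
  natCast_zmod_two_eq_zero (hs _ _ _)

theorem Bits.val_row {s : State} (hs : Bits s) {D a i : ℕ} (j : Fin D) :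
    (s.row D a i j).val = s.mem a i j := by
  rw [State.row, ZMod.val_natCast, Nat.mod_eq_of_lt]
  exact Nat.lt_succ_of_le (hs _ _ _)

namespace Prog

/-- `for c = 0, …, b - 1 do mem a i j := e`. -/
def fill (c b a : ℕ) (i j e : Expr) : Prog := forTo c b (store a i j e)

/-- Copies the first entries of row `j` of array `b` into row `i` of array `a`; their number is in
register `d`. -/
def copyRow (a : ℕ) (i : Expr) (b : ℕ) (j : Expr) (d : ℕ) : Prog :=
  fill 21 d a i (.reg 21) (.cell b j (.reg 21))

/-- Reduces row `0` of array `5` modulo the echelon form in array `a`; the dimension is in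
register `d`. Register `22` tells whether the remainder is nonzero, and register `23` holds its
first nonzero position. -/
def reduce (a d : ℕ) : Prog :=
  .seq (.set 22 (.const 0)) <| forTo 20 d <|
    .cond (.cell 5 (.const 0) (.reg 20))
      (.seq
        (.cond (.cell a (.reg 20) (.reg 20)) .skip
          (.cond (.reg 22) .skip (.seq (.set 22 (.const 1)) (.set 23 (.reg 20)))))
        (fill 21 d 5 (.const 0) (.reg 21)
          (.bxor (.cell 5 (.const 0) (.reg 21)) (.cell a (.reg 20) (.reg 21)))))
      .skip

/-- Writes the tensor square of the sum of row `i` of array `a` and row `j` of array `b` into row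
`0` of array `5`. -/
def square (a : ℕ) (i : Expr) (b : ℕ) (j : Expr) : Prog :=
  .seq (.set 26 (.const 0)) <| forTo 24 0 <|
    .seq
      (fill 25 0 5 (.const 0) (.add (.reg 26) (.reg 25))
        (.band (.bxor (.cell a i (.reg 24)) (.cell b j (.reg 24)))
          (.bxor (.cell a i (.reg 25)) (.cell b j (.reg 25)))))
      (.set 26 (.add (.reg 26) (.reg 0)))

end Prog

section Subroutines

variable {n : ℕ} {ω : Tape n}

theorem Runs.le {p : Prog} {s : State} {T T' : ℕ} {Q : State → Prop}
    (h : Runs ω p s T Q) (hT : T ≤ T') : Runs ω p s T' Q :=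
  h.mono hT fun _ _ hq => hq

/-- Here `iv`, `off + k` and `E k` are the row, the column and the value written in round `k`. The
expressions are evaluated in a state that may differ from `s` in the counter and the cells already
filled, which is all the hypothesis allows for. -/
theorem Runs.fill {c b a : ℕ} {i j e : Expr} {s : State} (iv off : ℕ) (E : ℕ → ℕ) (hcb : b ≠ c)
    (h : ∀ k < s.reg b, ∀ s' : State, s'.reg c = k → (∀ x, x ≠ c → s'.reg x = s.reg x) →
      (∀ a' i' j', ¬(a' = a ∧ i' = iv ∧ off ≤ j' ∧ j' < off + k) →
        s'.mem a' i' j' = s.mem a' i' j') →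
      i.eval s' = iv ∧ j.eval s' = off + k ∧ e.eval s' = E k) :
    Runs ω (.fill c b a i j e) s (s.reg b * (i.cost + j.cost + e.cost + 9) + 6) fun s' =>
      ∀ a' i' j', s'.mem a' i' j' =
        if a' = a ∧ i' = iv ∧ off ≤ j' ∧ j' < off + s.reg b then E (j' - off)
        else s.mem a' i' j' := by
  refine Runs.forTo (fun k s₁ => ∀ a' i' j', s₁.mem a' i' j' =
        if a' = a ∧ i' = iv ∧ off ≤ j' ∧ j' < off + k then E (j' - off)
        else s.mem a' i' j') (by simp [Prog.regs]) (by simp [Prog.regs]) hcb ?_ ?_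
  · intro a' i' j'
    rw [if_neg (by omega)]; rfl
  · intro k hk s₁ hc hF hI
    obtain ⟨hi, hj, he⟩ := h k hk s₁ hc
      (fun x hx => hF.reg x (by simp [Prog.forTo, Prog.regs, hx]))
      (fun a' i' j' hn => by rw [hI, if_neg hn])
    refine Runs.store fun _ a' i' j' => ?_
    simp only [State.setReg_mem, State.setCell, hi, hj, he, hI]
    by_cases h1 : a' = a ∧ i' = iv ∧ j' = off + k
    · rw [if_pos h1, if_pos (by omega), h1.2.2, Nat.add_sub_cancel_left]
    · rw [if_neg h1]
      congr 1
      simp only [eq_iff_iff]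
      omega

theorem Runs.copyRow {a b d : ℕ} {i j : Expr} {s : State} (iv jv D : ℕ) (hd : d ≠ 21)
    (hab : a ≠ b) (hD : s.reg d = D)
    (hi : ∀ s' : State, (∀ x, x ≠ 21 → s'.reg x = s.reg x) → i.eval s' = iv)
    (hj : ∀ s' : State, (∀ x, x ≠ 21 → s'.reg x = s.reg x) → j.eval s' = jv) :
    Runs ω (.copyRow a i b j d) s (D * (i.cost + j.cost + 12) + 6) fun s' =>
      ∀ a' i' j', s'.mem a' i' j' =
        if a' = a ∧ i' = iv ∧ j' < D then s.mem b jv j' else s.mem a' i' j' := by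
  refine (Runs.fill (s := s) iv 0 (fun k => s.mem b jv k) hd ?_).mono ?_ ?_
  · intro k hk s' hc hr hm
    refine ⟨hi _ hr, by simp [Expr.eval, hc], ?_⟩
    simp only [Expr.eval, hc, hj _ hr]
    exact hm _ _ _ fun h => hab h.1.symm
  · simp only [Expr.cost, hD]
    gcongr 1
    exact le_of_eq (by ring)
  · intro s' _ h a' i' j'
    simpa [hD] using h a' i' j'

/-- The loop invariant is `Reduced` at the current column, and each branch of the body is one of its
step lemmas. -/
theorem Runs.reduce {a d D : ℕ} {s : State} (ha : a ≠ 5) (hd : d ∉ [20, 21, 22, 23])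
    (hs : Bits s) (hD : s.reg d = D) (hr : Echelon fun p : Fin D => s.row D a p) :
    Runs ω (.reduce a d) s (D * (26 * D + 32) + 8) fun s' =>
      Reduced (fun p : Fin D => s.row D a p) (s.row D 5 0) (s'.row D 5 0) D
        (s'.reg 22) (s'.reg 23) := by
  simp only [List.mem_cons, List.not_mem_nil, or_false, not_or] at hd
  obtain ⟨hd0, hd1, hd2, hd3⟩ := hd
  set r := fun p : Fin D => s.row D a p with hrdef
  refine (Runs.seq (T' := D * (26 * D + 32) + 6) (Runs.set fun _ => ?_)).le
    (by simp [Expr.cost]; omega)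
  have hb : (s.setReg 22 (Expr.eval s (.const 0))).reg d = D := by simp [hd2, hD]
  refine (Runs.forTo (T := 26 * D + 24) (fun k s₁ => Reduced r (s.row D 5 0) (s₁.row D 5 0) k
      (s₁.reg 22) (s₁.reg 23)) (by simp [Prog.fill, Prog.forTo, Prog.regs])
      (by simp [Prog.fill, Prog.forTo, Prog.regs, *]) hd0 ?_ ?_).mono (by rw [hb])
      (fun _ _ h => by rwa [hb] at h)
  · simpa [Expr.eval] using Reduced.start
  · rw [hb]
    intro k hk s₁ hc hF hI
    obtain ⟨k, rfl⟩ : ∃ k' : Fin D, k'.val = k := ⟨⟨k, hk⟩, rfl⟩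
    have hs₁ : Bits s₁ := hF.bits
      (by simp [Prog.fill, Prog.forTo, Prog.BitSafe, Expr.IsBit.bxor, Expr.IsBit.cell]) hs
    have hma : s₁.mem a = s.mem a := hF.mem a (by simp [Prog.fill, Prog.forTo, Prog.arrays, ha])
    have hdD : s₁.reg d = D := by
      rw [hF.reg d (by simp [Prog.fill, Prog.forTo, Prog.regs, *]), hb]
    have hkk : r k k = 0 ↔ s₁.mem a k k = 0 := by
      rw [← hs₁.row_eq_zero_iff k, State.row_congr hma]
    refine (Runs.cond (T := 26 * D + 20) (fun hv => ?_) (fun hv => ?_)).le (by simp [Expr.cost]; omega)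
    · have hv' : s₁.row D 5 0 k ≠ 0 := by
        rw [Ne, hs₁.row_eq_zero_iff]
        simpa [Expr.eval, hc] using hv
      refine (Runs.seq (T := 10) (T' := 26 * D + 6) ?_).le (by omega)
      -- All three branches that handle the flag end with the same row addition, so that addition is
      -- analysed once, from the state `s₂` which the branch leaves behind.
      have hfill : ∀ (p : Prog) (s₂ : State), (∀ x, x ≠ 22 → x ≠ 23 → s₂.reg x = s₁.reg x) →
          s₂.mem = s₁.mem →
          Reduced r (s.row D 5 0) (s₁.row D 5 0 + r k) (k + 1) (s₂.reg 22) (s₂.reg 23) →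
          Runs ω (.fill 21 d 5 (.const 0) (.reg 21)
            (.bxor (.cell 5 (.const 0) (.reg 21)) (.cell a (.reg 20) (.reg 21)))) s₂
            (26 * D + 6) fun s₃ => Frame p s₁ s₃ →
              Reduced r (s.row D 5 0) ((s₃.setReg 20 (k + 1)).row D 5 0) (k + 1)
                ((s₃.setReg 20 (k + 1)).reg 22) ((s₃.setReg 20 (k + 1)).reg 23) := by
        intro p s₂ hr₂ hm₂ hI₂
        have hdD₂ : s₂.reg d = D := by rw [hr₂ d hd2 hd3, hdD]
        have hs₂ : Bits s₂ := fun a i j => by rw [hm₂]; exact hs₁ a i j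
        refine (Runs.fill 0 0 (fun j => (Expr.bxor (.cell 5 (.const 0) (.const j))
          (.cell a (.const k) (.const j))).eval s₂) hd1 ?_).mono ?_ ?_
        · intro j hj s' hc' hr' hm'
          refine ⟨rfl, by simp [Expr.eval, hc'], ?_⟩
          have h20 : s'.reg 20 = k := by rw [hr' 20 (by simp), hr₂ 20 (by simp) (by simp), hc]
          simp only [Expr.bxor, Expr.eval, hc', h20]
          rw [hm' 5 0 j (by omega), hm' a k j (fun h => ha h.1)]
        · simp only [Expr.cost, Expr.bxor, hdD₂]
          exact le_of_eq (by ring)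
        · intro s₃ hF₃ h _
          have hrow : s₃.row D 5 0 = s₁.row D 5 0 + r k := by
            funext j
            rw [State.row, h 5 0 j, if_pos (by simp [hdD₂]),
              Expr.IsBit.cast_bxor (.cell _ _ _) (.cell _ _ _) hs₂]
            simp [Expr.eval, hm₂, hma, hrdef, State.row]
          have h22 : s₃.reg 22 = s₂.reg 22 := hF₃.reg 22 (by simp [Prog.fill, Prog.forTo, Prog.regs])
          have h23 : s₃.reg 23 = s₂.reg 23 := hF₃.reg 23 (by simp [Prog.fill, Prog.forTo, Prog.regs])
          have hrow' : (s₃.setReg 20 (k + 1)).row D 5 0 = s₃.row D 5 0 := rfl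
          simpa [hrow', hrow, h22, h23] using hI₂
      refine (Runs.cond (T := 6) (fun hp => ?_) (fun hp => ?_)).le (by simp [Expr.cost])
      · refine Runs.skip (by simp) fun _ => hfill _ s₁ (fun _ _ _ => rfl) rfl ?_
        refine hI.step_pivot hr hv' ?_
        rw [Ne, hkk]
        simpa [Expr.eval, hc] using hp
      · have hp' : r k k = 0 := by
          rw [hkk]
          simpa [Expr.eval, hc] using hp
        refine (Runs.cond (T := 4) (fun hf => ?_) (fun hf => ?_)).le (by simp [Expr.cost])
        · exact Runs.skip (by simp) fun _ => hfill _ s₁ (fun _ _ _ => rfl) rfl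
            (hI.step_again hr hf hp')
        · refine Runs.seq (T := 2) (T' := 2) (Runs.set fun _ => ?_)
          refine Runs.set fun _ => hfill _ _ (fun x h₁ h₂ => by simp [h₁, h₂]) rfl ?_
          have := hI.step_first hr hf hv' hp'
          simpa [Expr.eval, hc] using this
    · refine Runs.skip (by omega) fun _ => ?_
      have := hI.step_zero (k := k) (by
        rw [hs₁.row_eq_zero_iff]
        simpa [Expr.eval, hc] using hv)
      simpa using this

end Subroutines

/-! ### Membership tests and the extension of a subspace by a vector. -/

namespace Prog

/-- Decides whether the tensor square of the sum of row `i` of array `a` and row `j` of array `b`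
lies in the span of the rows of array `6`. -/
def test (a : ℕ) (i : Expr) (b : ℕ) (j : Expr) : Prog := .seq (square a i b j) (reduce 6 7)

/-- Adds row `reg 14` of array `8` to the subspace with echelon form in array `b`, basis in array
`out`, dimension in register `d` and cardinality in register `c`. -/
def insert (b out d c : ℕ) : Prog :=
  .seq (copyRow 5 (.const 0) 8 (.reg 14) 0) <| .seq (reduce b 0) <|
    .cond (.reg 22)
      (.seq (copyRow b (.reg 23) 5 (.const 0) 0) <| .seq (copyRow out (.reg d) 5 (.const 0) 0) <|
        .seq (.set d (.add (.reg d) (.const 1))) (.set c (.add (.reg c) (.reg c))))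
      .skip

end Prog

/-- State `s` holds the subspace `A`: an echelon form in array `b`, a basis in array `out`, the
dimension in register `d` and the cardinality in register `c`. -/
structure Holds {n : ℕ} (s : State) (b out d c : ℕ) (A : Subsp n) : Prop where
  echelon : Echelon fun p : Fin n => s.row n b p
  span : Submodule.span (ZMod 2) (Set.range fun p : Fin n => s.row n b p) = A
  basis : HoldsBasis s out (s.reg d) A
  card : s.reg c = 2 ^ s.reg d

section Subroutines

variable {n : ℕ} {ω : Tape n}

theorem HoldsBasis.congr {s s' : State} {a k : ℕ} {A : Subsp n} (h : HoldsBasis s a k A)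
    (ha : s'.mem a = s.mem a) : HoldsBasis s' a k A := by
  obtain ⟨v, h₁, h₂, h₃⟩ := h
  exact ⟨v, h₁, h₂, fun i j => by rw [ha, h₃]⟩

theorem Holds.congr {s s' : State} {b out d c : ℕ} {A : Subsp n} (h : Holds s b out d c A)
    (hb : s'.mem b = s.mem b) (ho : s'.mem out = s.mem out) (hd : s'.reg d = s.reg d)
    (hc : s'.reg c = s.reg c) : Holds s' b out d c A := by
  have hrow : (fun p : Fin n => s'.row n b p) = fun p : Fin n => s.row n b p :=
    funext fun p => State.row_congr hb _ _
  exact ⟨hrow ▸ h.echelon, hrow ▸ h.span, by rw [hd]; exact h.basis.congr ho,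
    by rw [hc, hd, h.card]⟩

theorem HoldsBasis.snoc {s s' : State} {a k : ℕ} {A : Subsp n} (h : HoldsBasis s a k A)
    {v : Vec n} (hv : v ∉ A)
    (hm : ∀ i j, s'.mem a i j = if h : i = k ∧ j < n then (v ⟨j, h.2⟩).val else s.mem a i j) :
    HoldsBasis s' a (k + 1) (A ⊔ Submodule.span (ZMod 2) {v}) := by
  obtain ⟨w, h₁, h₂, h₃⟩ := h
  refine ⟨Fin.snoc w v, ?_, ?_, fun i j => ?_⟩
  · rw [linearIndependent_finSnoc, h₂]
    exact ⟨h₁, hv⟩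
  · rw [Fin.range_snoc, Submodule.span_insert, h₂, sup_comm]
  · rw [hm]
    induction i using Fin.lastCases with
    | last => simp
    | cast i =>
      rw [dif_neg (by simp; omega)]
      simpa using h₃ i j

/-- Register 26 holds the offset `k * n` of the current block, so positions in the tensor square are
found by addition only. -/
theorem Runs.square {a b iv jv : ℕ} {i j : Expr} {s : State} (hs : Bits s) (ha : a ≠ 5)
    (hb : b ≠ 5) (hn : s.reg 0 = n) (hic : i.cost ≤ 1) (hjc : j.cost ≤ 1)
    (hi : ∀ s' : State, (∀ x, x ∉ [24, 25, 26] → s'.reg x = s.reg x) → i.eval s' = iv)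
    (hj : ∀ s' : State, (∀ x, x ∉ [24, 25, 26] → s'.reg x = s.reg x) → j.eval s' = jv) :
    Runs ω (.square a i b j) s (n * (46 * n + 18) + 8) fun s' =>
      s'.row (n * n) 5 0 = tsq (s.row n a iv + s.row n b jv) := by
  set X : ℕ → ZMod 2 := fun m => (s.mem a iv m : ZMod 2) + (s.mem b jv m : ZMod 2) with hX
  refine (Runs.seq (T' := n * (46 * n + 18) + 6) (Runs.set fun _ => ?_)).le
    (by simp [Expr.cost]; omega)
  refine (Runs.forTo (T := 46 * n + 10) (fun k s₁ => s₁.reg 26 = k * n ∧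
      ∀ m < k * n, (s₁.mem 5 0 m : ZMod 2) = X (m / n) * X (m % n))
      (by simp [Prog.fill, Prog.forTo, Prog.regs])
      (by simp [Prog.fill, Prog.forTo, Prog.regs]) (by simp) (by simp [Expr.eval]) ?_).mono
      (by simp [hn]) ?_
  · intro k hk s₁ hc hF hI
    replace hk : k < n := by simpa [hn] using hk
    have hs₁ : Bits s₁ := hF.bits
      (by simp [Prog.fill, Prog.forTo, Prog.BitSafe, Expr.IsBit.bxor, Expr.IsBit.cell,
        Expr.IsBit.band]) hs
    have hm₁ : ∀ a, a ≠ 5 → s₁.mem a = s.mem a := fun a ha =>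
      hF.mem a (by simp [Prog.fill, Prog.forTo, Prog.arrays, ha])
    have hr₁ : ∀ x, x ∉ [24, 25, 26] → s₁.reg x = s.reg x := by
      intro x hx
      simp only [List.mem_cons, List.not_mem_nil, or_false, not_or] at hx
      rw [hF.reg x (by simp [Prog.fill, Prog.forTo, Prog.regs, hx])]
      simp [hx]
    have h0 : s₁.reg 0 = n := by rw [hr₁ 0 (by simp), hn]
    refine (Runs.seq (T := 46 * n + 6) (T' := 4) ?_).le (by omega)
    refine (Runs.fill 0 (k * n) (fun m => (Expr.band
        (.bxor (.cell a (.const iv) (.const k)) (.cell b (.const jv) (.const k)))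
        (.bxor (.cell a (.const iv) (.const m)) (.cell b (.const jv) (.const m)))).eval s₁)
        (by simp) ?_).mono ?_ ?_
    · intro m hm s' hc' hr' hm'
      have h24 : s'.reg 24 = k := by rw [hr' 24 (by simp), hc]
      have h26 : s'.reg 26 = k * n := by rw [hr' 26 (by simp), hI.1]
      have hr'' : ∀ x, x ∉ [24, 25, 26] → s'.reg x = s.reg x := fun x hx => by
        rw [hr' x (by rintro rfl; simp at hx), hr₁ x hx]
      refine ⟨rfl, by simp [Expr.eval, hc', h26], ?_⟩
      simp only [Expr.bxor, Expr.band, Expr.eval, hc', h24, hi s' hr'', hj s' hr'']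
      simp only [hm' a iv _ (fun h => ha h.1), hm' b jv _ (fun h => hb h.1)]
    · simp only [Expr.cost, Expr.bxor, Expr.band, h0]
      nlinarith
    · intro s₂ hF₂ h _
      refine Runs.set fun _ => ?_
      have h26 : s₂.reg 26 = k * n := by
        rw [hF₂.reg 26 (by simp [Prog.fill, Prog.forTo, Prog.regs]), hI.1]
      have h02 : s₂.reg 0 = n := by
        rw [hF₂.reg 0 (by simp [Prog.fill, Prog.forTo, Prog.regs]), h0]
      refine ⟨by simp [Expr.eval, h26, h02, Nat.succ_mul], fun m hm => ?_⟩
      simp only [State.setReg_mem, h 5 0 m, h0, true_and]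
      rw [Nat.succ_mul] at hm
      by_cases hmk : m < k * n
      · rw [if_neg (by omega)]
        exact hI.2 m hmk
      · rw [if_pos (by omega)]
        -- Position `m` of block `k` stands for the pair (k, m - k n), which is what `Fin.divNat`
        -- and `Fin.modNat` return.
        have hdiv : m / n = k := by
          exact Nat.div_eq_of_lt_le (by omega) (by rw [Nat.succ_mul]; omega)
        have hmod : m % n = m - k * n := by
          have := Nat.div_add_mod m n
          rw [hdiv, mul_comm] at this
          omega
        rw [Expr.IsBit.cast_band (.bxor (.cell _ _ _) (.cell _ _ _))
          (.bxor (.cell _ _ _) (.cell _ _ _)) hs₁,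
          Expr.IsBit.cast_bxor (.cell _ _ _) (.cell _ _ _) hs₁,
          Expr.IsBit.cast_bxor (.cell _ _ _) (.cell _ _ _) hs₁, hdiv, hmod]
        simp [Expr.eval, hm₁ a ha, hm₁ b hb, hX]
  · intro s' _ h
    simp only [State.setReg_reg, OfNat.zero_ne_ofNat, if_false, hn] at h
    funext k
    rw [State.row, h.2 k k.2]
    simp [tsq, tensor, State.row, hX, Fin.divNat, Fin.modNat]

theorem Runs.test {a b iv jv : ℕ} {i j : Expr} {s : State} (hs : Bits s) (ha : a ≠ 5)
    (hb : b ≠ 5) (hn : s.reg 0 = n) (hD : s.reg 7 = n * n) (hic : i.cost ≤ 1) (hjc : j.cost ≤ 1)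
    (hi : ∀ s' : State, (∀ x, x ∉ [24, 25, 26] → s'.reg x = s.reg x) → i.eval s' = iv)
    (hj : ∀ s' : State, (∀ x, x ∉ [24, 25, 26] → s'.reg x = s.reg x) → j.eval s' = jv)
    (hr : Echelon fun p : Fin (n * n) => s.row (n * n) 6 p) :
    Runs ω (.test a i b j) s (n * (46 * n + 18) + 8 + (n * n * (26 * (n * n) + 32) + 8))
      fun s' => Reduced (fun p : Fin (n * n) => s.row (n * n) 6 p)
        (tsq (s.row n a iv + s.row n b jv)) (s'.row (n * n) 5 0) (n * n)
        (s'.reg 22) (s'.reg 23) := by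
  refine Runs.seq ((Runs.square hs ha hb hn hic hjc hi hj).mono le_rfl fun s₁ hF h _ => ?_)
  have hrow : (fun p : Fin (n * n) => s₁.row (n * n) 6 p) = fun p : Fin (n * n) => s.row (n * n) 6 p :=
    funext fun p => State.row_congr
      (hF.mem 6 (by simp [Prog.square, Prog.fill, Prog.forTo, Prog.arrays])) _ _
  have hs₁ : Bits s₁ := hF.bits (by simp [Prog.square, Prog.fill, Prog.forTo, Prog.BitSafe,
    Expr.IsBit.bxor, Expr.IsBit.cell, Expr.IsBit.band]) hs
  have h7 : s₁.reg 7 = n * n := by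
    rw [hF.reg 7 (by simp [Prog.square, Prog.fill, Prog.forTo, Prog.regs]), hD]
  have := Runs.reduce (ω := ω) (a := 6) (by simp) (by simp) hs₁ h7 (hrow ▸ hr)
  rwa [hrow, h] at this

/-- A nonzero remainder serves twice: it fills the empty pivot row of the echelon form and is
appended to the basis. A new dimension doubles the cardinality, so powers of two need no
multiplication. -/
theorem Runs.insert {b out d c : ℕ} {s : State} {A : Subsp n} (hs : Bits s)
    (hb : b ∉ [5, 8]) (ho : out ∉ [5, 8]) (hbo : b ≠ out) (hdc : d ≠ c)
    (hd : d ∉ [0, 14, 20, 21, 22, 23]) (hc : c ∉ [0, 14, 20, 21, 22, 23])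
    (hn : s.reg 0 = n) (hA : Holds s b out d c A) :
    Runs ω (.insert b out d c) s (n * (26 * n + 74) + 36) fun s' =>
      Holds s' b out d c (A ⊔ Submodule.span (ZMod 2) {s.row n 8 (s.reg 14)}) := by
  simp only [List.mem_cons, List.not_mem_nil, or_false, not_or] at hb ho hd hc
  obtain ⟨hd0, hd14, hd20, hd21, hd22, hd23⟩ := hd
  obtain ⟨hc0, hc14, hc20, hc21, hc22, hc23⟩ := hc
  refine (Runs.seq (T := n * 14 + 6) (T' := n * (26 * n + 60) + 30) ?_).le
    (by nlinarith)
  refine (Runs.copyRow 0 (s.reg 14) n (by simp) (by simp) hn (fun _ _ => rfl)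
    (fun s' h => by simpa [Expr.eval] using h 14 (by simp))).mono (by simp [Expr.cost]) fun s₁ hF₁ hm₁ _ => ?_
  have hr₁ : ∀ x, x ≠ 21 → s₁.reg x = s.reg x := fun x hx =>
    hF₁.reg x (by simp [Prog.copyRow, Prog.fill, Prog.forTo, Prog.regs, hx])
  have ha₁ : ∀ a, a ≠ 5 → s₁.mem a = s.mem a := fun a ha =>
    hF₁.mem a (by simp [Prog.copyRow, Prog.fill, Prog.forTo, Prog.arrays, ha])
  have hs₁ : Bits s₁ := hF₁.bits
    (by simp [Prog.copyRow, Prog.fill, Prog.forTo, Prog.BitSafe, Expr.IsBit.cell]) hs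
  have hA₁ : Holds s₁ b out d c A := hA.congr (ha₁ b hb.1) (ha₁ out ho.1) (hr₁ d hd21) (hr₁ c hc21)
  have hv₁ : s₁.row n 5 0 = s.row n 8 (s.reg 14) := by
    funext j
    simp [State.row, hm₁]
  rw [← hv₁]
  have hn₁ : s₁.reg 0 = n := by rw [hr₁ 0 (by simp), hn]
  refine (Runs.seq (T := n * (26 * n + 32) + 8) (T' := n * 28 + 22) ?_).le (by nlinarith)
  refine (Runs.reduce hb.1 (by simp) hs₁ hn₁ hA₁.echelon).mono le_rfl fun s₂ hF₂ hI _ => ?_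
  have hr₂ : ∀ x, x ∉ [20, 21, 22, 23] → s₂.reg x = s₁.reg x := fun x hx =>
    hF₂.reg x (by simpa [Prog.reduce, Prog.fill, Prog.forTo, Prog.regs, and_comm, and_left_comm,
      and_assoc] using hx)
  have ha₂ : ∀ a, a ≠ 5 → s₂.mem a = s₁.mem a := fun a ha =>
    hF₂.mem a (by simp [Prog.reduce, Prog.fill, Prog.forTo, Prog.arrays, ha])
  have hs₂ : Bits s₂ := hF₂.bits (by simp [Prog.reduce, Prog.fill, Prog.forTo, Prog.BitSafe,
    Expr.IsBit.cell, Expr.IsBit.bxor]) hs₁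
  have hA₂ : Holds s₂ b out d c A := hA₁.congr (ha₂ b hb.1) (ha₂ out ho.1)
    (hr₂ d (by simp [*])) (hr₂ c (by simp [*]))
  have hrow : (fun p : Fin n => s₁.row n b p) = fun p : Fin n => s₂.row n b p :=
    funext fun p => (State.row_congr (ha₂ b hb.1) _ _).symm
  rw [hrow] at hI
  have hn₂ : s₂.reg 0 = n := by rw [hr₂ 0 (by simp), hn₁]
  refine (Runs.cond (T := n * 28 + 20) (fun hf => ?_) (fun hf => ?_)).le
    (by simp [Expr.cost]; omega)
  · obtain ⟨q, hq, hqq, hvq, hlt⟩ := hI.pivot hf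
    refine (Runs.seq (T := n * 14 + 6) (T' := n * 14 + 14) ?_).le (by omega)
    refine (Runs.copyRow q 0 n (by simp) hb.1 hn₂ (fun s' h => by simp [Expr.eval, h, hq])
      (fun s' h => rfl)).mono (by simp [Expr.cost]) fun s₃ hF₃ hm₃ _ => ?_
    have hr₃ : ∀ x, x ≠ 21 → s₃.reg x = s₂.reg x := fun x hx =>
      hF₃.reg x (by simp [Prog.copyRow, Prog.fill, Prog.forTo, Prog.regs, hx])
    have ha₃ : ∀ a, a ≠ b → s₃.mem a = s₂.mem a := fun a ha =>
      hF₃.mem a (by simp [Prog.copyRow, Prog.fill, Prog.forTo, Prog.arrays, ha])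
    have hn₃ : s₃.reg 0 = n := by rw [hr₃ 0 (by simp), hn₂]
    refine (Runs.seq (T := n * 14 + 6) (T' := 8) ?_).le (by omega)
    refine (Runs.copyRow (s₂.reg d) 0 n (by simp) ho.1 hn₃
      (fun s' h => by simp [Expr.eval, h d hd21, hr₃ d hd21])
      (fun s' h => rfl)).mono (by simp [Expr.cost]) fun s₄ hF₄ hm₄ _ => ?_
    have hr₄ : ∀ x, x ≠ 21 → s₄.reg x = s₂.reg x := fun x hx => by
      rw [← hr₃ x hx]
      exact hF₄.reg x (by simp [Prog.copyRow, Prog.fill, Prog.forTo, Prog.regs, hx])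
    refine (Runs.seq (T := 4) (T' := 4) (Runs.set fun _ => Runs.set ?_))
    set s₅ := (s₄.setReg d ((Expr.add (.reg d) (.const 1)).eval s₄)).setReg c
      ((Expr.add (.reg c) (.reg c)).eval
        (s₄.setReg d ((Expr.add (.reg d) (.const 1)).eval s₄))) with hs₅
    have hd₅ : s₅.reg d = s₂.reg d + 1 := by simp [hs₅, hdc, Expr.eval, hr₄ d hd21]
    have hc₅ : s₅.reg c = s₂.reg c + s₂.reg c := by
      simp [hs₅, hdc.symm, Expr.eval, hr₄ c hc21]
    have hnot : s₂.row n 5 0 ∉ A := by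
      rw [← hA₂.span]
      exact hA₂.echelon.notMem_span hqq hvq hlt
    have hspan : A ⊔ Submodule.span (ZMod 2) {s₁.row n 5 0} =
        A ⊔ Submodule.span (ZMod 2) {s₂.row n 5 0} := by
      rw [← hA₂.span]
      exact hI.span_sup.symm
    have hupd : (fun p : Fin n => s₅.row n b p) =
        Function.update (fun p : Fin n => s₂.row n b p) q (s₂.row n 5 0) := by
      have hmb : s₅.mem b = s₃.mem b :=
        hF₄.mem b (by simp [Prog.copyRow, Prog.fill, Prog.forTo, Prog.arrays, hbo])
      funext p j
      rw [State.row_congr hmb, State.row, hm₃]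
      by_cases hp : p = q
      · subst hp
        simp [State.row]
      · rw [Function.update_of_ne hp, if_neg (fun h => hp (Fin.ext h.2.1))]
        rfl
    rw [hspan]
    refine ⟨?_, ?_, ?_, ?_⟩
    · rw [hupd]
      exact hA₂.echelon.update hvq hlt
    · rw [hupd, span_range_update (r := fun p : Fin n => s₂.row n b p) ((hA₂.echelon q).2 hqq), hA₂.span]
    · rw [hd₅]
      refine hA₂.basis.snoc hnot fun i j => ?_
      have hmo : s₅.mem out i j = s₄.mem out i j := rfl
      rw [hmo, hm₄]
      by_cases h : i = s₂.reg d ∧ j < n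
      · rw [if_pos ⟨rfl, h⟩, dif_pos h, hs₂.val_row, ha₃ 5 (Ne.symm hb.1)]
      · rw [if_neg (fun h' => h h'.2), dif_neg h, ha₃ out (Ne.symm hbo)]
    · rw [hc₅, hd₅, hA₂.card, pow_succ, mul_two]
  · refine Runs.skip (by omega) ?_
    have hmem := (hI.mem_iff hA₂.echelon).2 hf
    rw [hA₂.span, ← Submodule.span_singleton_le_iff_mem] at hmem
    rwa [sup_eq_left.2 hmem]

end Subroutines

-- Footprints of the subroutines, and the learning algorithm.

attribute [simp] Prog.regs Prog.arrays Prog.draws Prog.BitSafe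

namespace Prog

@[simp] theorem mem_regs_forTo {x c b : ℕ} {p : Prog} :
    x ∈ (forTo c b p).regs ↔ x = c ∨ x ∈ p.regs := by
  simp [forTo]; tauto

@[simp] theorem arrays_forTo {c b : ℕ} {p : Prog} : (forTo c b p).arrays = p.arrays := by
  simp [forTo]

@[simp] theorem draws_forTo {c b : ℕ} {p : Prog} : (forTo c b p).draws = p.draws := by
  simp [forTo]

@[simp] theorem bitSafe_forTo {c b : ℕ} {p : Prog} : (forTo c b p).BitSafe ↔ p.BitSafe := by
  simp [forTo]

@[simp] theorem mem_regs_copyRow {x a b d : ℕ} {i j : Expr} :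
    x ∈ (copyRow a i b j d).regs ↔ x = 21 := by
  simp [copyRow, fill]

@[simp] theorem arrays_copyRow {a b d : ℕ} {i j : Expr} : (copyRow a i b j d).arrays = [a] := by
  simp [copyRow, fill]

@[simp] theorem draws_copyRow {a b d : ℕ} {i j : Expr} : (copyRow a i b j d).draws = false := by
  simp [copyRow, fill]

@[simp] theorem bitSafe_copyRow {a b d : ℕ} {i j : Expr} : (copyRow a i b j d).BitSafe := by
  simp [copyRow, fill, Expr.IsBit.cell]

@[simp] theorem mem_regs_reduce {x a d : ℕ} :
    x ∈ (reduce a d).regs ↔ x = 20 ∨ x = 21 ∨ x = 22 ∨ x = 23 := by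
  simp [reduce, fill]; tauto

@[simp] theorem mem_arrays_reduce {x a d : ℕ} : x ∈ (reduce a d).arrays ↔ x = 5 := by
  simp [reduce, fill]

@[simp] theorem draws_reduce {a d : ℕ} : (reduce a d).draws = false := by
  simp [reduce, fill]

@[simp] theorem bitSafe_reduce {a d : ℕ} : (reduce a d).BitSafe := by
  simp [reduce, fill, Expr.IsBit.cell, Expr.IsBit.bxor]

@[simp] theorem mem_regs_test {x a b : ℕ} {i j : Expr} : x ∈ (test a i b j).regs ↔
    x = 20 ∨ x = 21 ∨ x = 22 ∨ x = 23 ∨ x = 24 ∨ x = 25 ∨ x = 26 := by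
  simp [test, square, fill]; tauto

@[simp] theorem mem_arrays_test {x a b : ℕ} {i j : Expr} : x ∈ (test a i b j).arrays ↔ x = 5 := by
  simp [test, square, fill]

@[simp] theorem draws_test {a b : ℕ} {i j : Expr} : (test a i b j).draws = false := by
  simp [test, square, fill]

@[simp] theorem bitSafe_test {a b : ℕ} {i j : Expr} : (test a i b j).BitSafe := by
  simp [test, square, fill, Expr.IsBit.cell, Expr.IsBit.bxor, Expr.IsBit.band]

@[simp] theorem mem_regs_insert {x b out d c : ℕ} : x ∈ (insert b out d c).regs ↔
    x = 20 ∨ x = 21 ∨ x = 22 ∨ x = 23 ∨ x = d ∨ x = c := by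
  simp [insert]; tauto

@[simp] theorem mem_arrays_insert {x b out d c : ℕ} : x ∈ (insert b out d c).arrays ↔
    x = 5 ∨ x = b ∨ x = out := by
  simp [insert]

@[simp] theorem draws_insert {b out d c : ℕ} : (insert b out d c).draws = false := by
  simp [insert]

@[simp] theorem bitSafe_insert {b out d c : ℕ} : (insert b out d c).BitSafe := by
  simp [insert]

/-- Starting from `init`, replaces register `acc` by `e` until it is at least register `b`, and
adds the number of rounds to register `out`. -/
def countUntil (b acc out : ℕ) (init e : Expr) : Prog :=
  .seq (.set acc init) <| .loop (.sub (.reg b) (.reg acc)) <|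
    .seq (.set acc e) (.set out (.add (.reg out) (.const 1)))

/-- Puts the product of registers `x` and `y` into register `out`. -/
def mul (out x y : ℕ) : Prog :=
  .seq (.set out (.const 0)) (forTo 24 y (.set out (.add (.reg out) (.reg x))))

/-- Computes the square of the dimension (register `7`) and the sample size (register `8`). -/
def setup : Prog :=
  .seq (mul 7 0 0) <|
  .seq (countUntil 2 12 9 (.const 0) (.add (.reg 12) (.reg 1))) <|
  .seq (countUntil 6 12 10 (.const 0) (.add (.reg 12) (.reg 5))) <|
  -- The count of doublings starts at 3, so register 11 ends as `l + 3`; the extra 3 becomes a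
  -- factor 1/8 in the failure probability.
  .seq (.set 11 (.const 3)) <|
  .seq (countUntil 4 12 11 (.reg 3) (.add (.reg 12) (.reg 12))) <|
  .seq (mul 18 7 9) <| .seq (mul 19 18 10) <| .seq (mul 18 19 10) <| .seq (mul 19 18 11) <|
  -- Three doublings, the last one on the next line, give the factor 8 of the sample size.
  .seq (.set 19 (.add (.reg 19) (.reg 19))) <| .seq (.set 19 (.add (.reg 19) (.reg 19))) <|
  .set 8 (.add (.reg 19) (.reg 19))

/-- Draws the samples into array `7`, maintains an echelon form of their tensor squares in
array `6`, and keeps in array `8` the samples that enlarge it. -/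
def collect : Prog :=
  -- Array 9 is never written: its row 0 is the zero vector, so the sample itself is tested.
  forTo 13 8 <| .seq (.sample 7 (.reg 13)) <| .seq (test 7 (.reg 13) 9 (.const 0)) <|
    .cond (.reg 22)
      -- The pivot position is the slot of both the new echelon row and the kept sample, so at most
      -- n² samples are kept.
      (.seq (copyRow 6 (.reg 23) 5 (.const 0) 7) (copyRow 8 (.reg 23) 7 (.reg 13) 0)) .skip

/-- Searches for two rows of array `8` whose sum fails the test. -/
def search : Prog :=
  forTo 14 7 <| forTo 15 7 <| .seq (test 8 (.reg 14) 8 (.reg 15)) <|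
    -- There is no early exit: the last failing pair wins, and the pair (0, 0) remains if none
    -- fails.
    .cond (.reg 22) (.seq (.set 16 (.reg 14)) (.set 17 (.reg 15))) .skip

/-- Adds row `reg 14` of array `8` to a subspace if its sum with row `reg r` passes the test. -/
def insertIf (b out d c r : ℕ) : Prog :=
  .seq (test 8 (.reg 14) 8 (.reg r)) (.cond (.reg 22) .skip (insert b out d c))

@[simp] theorem mem_regs_insertIf {x b out d c r : ℕ} : x ∈ (insertIf b out d c r).regs ↔
    x = 20 ∨ x = 21 ∨ x = 22 ∨ x = 23 ∨ x = 24 ∨ x = 25 ∨ x = 26 ∨ x = d ∨ x = c := by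
  simp [insertIf]; tauto

@[simp] theorem mem_arrays_insertIf {x b out d c r : ℕ} :
    x ∈ (insertIf b out d c r).arrays ↔ x = 5 ∨ x = b ∨ x = out := by
  simp [insertIf]

@[simp] theorem draws_insertIf {b out d c r : ℕ} : (insertIf b out d c r).draws = false := by
  simp [insertIf]

@[simp] theorem bitSafe_insertIf {b out d c r : ℕ} : (insertIf b out d c r).BitSafe := by
  simp [insertIf]

/-- Computes the spans of the rows of array `8` whose sum with row `reg 16` (with row `reg 17`)
passes the test, and the span of all rows. -/
def bases : Prog :=
  -- The zero subspace has one element.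
  .seq (.set 31 (.const 1)) <| .seq (.set 33 (.const 1)) <| .seq (.set 35 (.const 1)) <|
  forTo 14 7 <|
    .seq (insertIf 10 0 30 31 16) <| .seq (insertIf 11 1 32 33 17) <| insert 12 13 34 35

/-- Estimates the weight of the first component. -/
def count : Prog :=
  forTo 13 8 <|
    .seq (test 7 (.reg 13) 8 (.reg 17)) <|
    -- Each sample outside the second subspace contributes |A + B| to the numerator, and every
    -- sample contributes |A + B| - |B| to the denominator. Repeated addition replaces both
    -- products.
    .seq (.cond (.reg 22) (.set 36 (.add (.reg 36) (.reg 35))) .skip)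
      (.set 37 (.add (.reg 37) (.sub (.reg 35) (.reg 33))))

/-- Moves the results into the output registers. -/
def output : Prog :=
  .seq (.set 0 (.reg 30)) <| .seq (.set 1 (.reg 32)) <| .seq (.set 2 (.reg 36)) <|
  .seq (.set 3 (.reg 37)) <| .seq (.set 4 (.sub (.reg 37) (.reg 36))) (.set 5 (.reg 37))

/-- The learning algorithm. -/
def learn : Prog :=
  .seq setup <| .seq collect <| .seq search <| .seq bases <| .seq count output

end Prog

/-! ### Arithmetic by repeated addition, and the sample size. -/

section Numerics

variable {n : ℕ} {ω : Tape n}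

/-- `f k` is the content of the accumulator after `k` rounds. With multiples this computes a
rounded-up quotient, with doublings a rounded-up logarithm. -/
theorem Runs.countUntil {b acc out : ℕ} {init e : Expr} {s : State} (f : ℕ → ℕ) (m : ℕ)
    (hbo : b ≠ out) (hba : b ≠ acc) (hao : acc ≠ out) (h0 : init.eval s = f 0)
    (hf : ∀ k, ∀ s' : State, s'.reg acc = f k → (∀ x, x ≠ acc → x ≠ out → s'.reg x = s.reg x) →
      e.eval s' = f (k + 1))
    (hlt : ∀ j < m, f j < s.reg b) (hm : s.reg b ≤ f m) :
    Runs ω (.countUntil b acc out init e) s (m * (e.cost + 9) + init.cost + 5) fun s' =>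
      s'.reg out = s.reg out + m ∧ s'.mem = s.mem := by
  refine (Runs.seq (T := init.cost + 1) (T' := m * (e.cost + 9) + 4) ?_).le (by omega)
  refine Runs.set fun _ => ?_
  refine (Runs.loop (T := e.cost + 5) (fun k s' => ∃ j, j + k = m ∧ s'.reg acc = f j ∧
    s'.reg out = s.reg out + j ∧ (∀ x, x ≠ acc → x ≠ out → s'.reg x = s.reg x) ∧
    s'.mem = s.mem) ?_ ?_ m _ ?_).mono ?_ ?_
  · rintro k s' ⟨j, hj, h₁, h₂, h₃, h₄⟩
    refine ⟨?_, ?_⟩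
    · have := hlt j (by omega)
      simp only [Expr.eval, h₁, h₃ b hba hbo]
      omega
    · refine (Runs.seq (T := e.cost + 1) (T' := 4) (Runs.set fun _ => Runs.set ?_)).le (by omega)
      refine ⟨j + 1, by omega, ?_, ?_, ?_, h₄⟩
      · simp [hao, hf j s' h₁ h₃]
      · simp [Expr.eval, hao.symm, h₂]; omega
      · intro x hx hx'
        simp [hx, hx', h₃]
  · rintro s' ⟨j, hj, h₁, h₂, h₃, h₄⟩
    have : j = m := by omega
    subst this
    simp only [Expr.eval, h₁, h₃ b hba hbo]
    omega
  · exact ⟨0, by omega, by simp [h0], by simp [hao.symm], by intro x hx _; simp [hx], rfl⟩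
  · simp only [Expr.cost]
    exact le_of_eq (by ring)
  · rintro s' - ⟨j, hj, h₁, h₂, h₃, h₄⟩
    exact ⟨by rw [h₂]; omega, h₄⟩

/-- The cost is linear in the value of the second factor, so `Prog.setup` always puts the
accumulated product first. -/
theorem Runs.mul {out x y : ℕ} {s : State} (hx : x ≠ out) (hy : y ≠ out) (hx' : x ≠ 24)
    (hy' : y ≠ 24) (ho : out ≠ 24) :
    Runs ω (.mul out x y) s (s.reg y * 12 + 8) fun s' =>
      s'.reg out = s.reg x * s.reg y := by
  refine (Runs.seq (T := 2) (T' := s.reg y * 12 + 6) (Runs.set fun _ => ?_)).le (by omega)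
  refine (Runs.forTo (T := 4) (fun k s' => s'.reg out = s.reg x * k) (by simp [ho.symm])
    (by simp [hy]) hy' (by simp [Expr.eval, ho]) ?_).mono (by simp [hy])
    (fun s' _ h => by simpa [hy] using h)
  intro k hk s₁ hc hF hI
  refine Runs.set fun _ => ?_
  have h₁ : s₁.reg x = s.reg x := by rw [hF.reg x (by simp [hx, hx'])]; simp [hx]
  simp [Expr.eval, ho, hI, h₁, Nat.mul_succ]

theorem Runs.setup {s : State} {m e l : ℕ} (hn : s.reg 0 = n) (h9 : s.reg 9 = 0)
    (h10 : s.reg 10 = 0) (hm : ∀ j < m, j * s.reg 1 < s.reg 2) (hm' : s.reg 2 ≤ m * s.reg 1)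
    (he : ∀ j < e, j * s.reg 5 < s.reg 6) (he' : s.reg 6 ≤ e * s.reg 5)
    (hl : ∀ j < l, 2 ^ j * s.reg 3 < s.reg 4) (hl' : s.reg 4 ≤ 2 ^ l * s.reg 3) :
    Runs ω .setup s (12 * (n + 2 * m + 3 * e + 2 * (l + 3)) + 80) fun s' =>
      s'.reg 7 = n * n ∧ s'.reg 8 = 8 * (n * n * m * e * e * (l + 3)) ∧ s'.mem = s.mem ∧
        s'.samples = s.samples := by
  have gmul : ∀ {out x y : ℕ} {s s' : State}, Frame (.mul out x y) s s' →
      (∀ z, z ≠ out → z ≠ 24 → s'.reg z = s.reg z) ∧ s'.mem = s.mem ∧ s'.samples = s.samples :=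
    fun F => ⟨fun z h₁ h₂ => F.reg z (by simp [Prog.mul, h₁, h₂]),
      funext fun a => F.mem a (by simp [Prog.mul]), F.samples (by simp [Prog.mul])⟩
  have gcount : ∀ {b acc out : ℕ} {i e : Expr} {s s' : State},
      Frame (.countUntil b acc out i e) s s' →
      (∀ z, z ≠ acc → z ≠ out → s'.reg z = s.reg z) ∧ s'.samples = s.samples :=
    fun F => ⟨fun z h₁ h₂ => F.reg z (by simp [Prog.countUntil, h₁, h₂]),
      F.samples (by simp [Prog.countUntil])⟩
  refine (Runs.seq (T' := 24 * m + 36 * e + 24 * (l + 3) + 72) ((Runs.mul (by simp) (by simp)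
    (by simp) (by simp) (by simp)).mono le_rfl fun s₁ F₁ h₁ _ => ?_)).le (by rw [hn]; omega)
  obtain ⟨r₁, m₁, q₁⟩ := gmul F₁
  refine (Runs.seq (T := m * 12 + 6) (T' := 12 * m + 36 * e + 24 * (l + 3) + 66)
    ((Runs.countUntil (fun j => j * s.reg 1) m (by simp) (by simp) (by simp) (by simp [Expr.eval])
    (fun k s' h h' => by simp [Expr.eval, h, h', r₁, Nat.succ_mul])
    (by simpa [r₁] using hm) (by simpa [r₁] using hm')).mono (by simp [Expr.cost])
    fun s₂ F₂ h₂ _ => ?_)).le (by omega)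
  obtain ⟨r₂, q₂⟩ := gcount F₂
  refine (Runs.seq (T := e * 12 + 6) (T' := 12 * m + 24 * e + 24 * (l + 3) + 60)
    ((Runs.countUntil (fun j => j * s.reg 5) e (by simp) (by simp) (by simp) (by simp [Expr.eval])
    (fun k s' h h' => by simp [Expr.eval, h, h', r₁, r₂, Nat.succ_mul])
    (by simpa [r₁, r₂] using he) (by simpa [r₁, r₂] using he')).mono (by simp [Expr.cost])
    fun s₃ F₃ h₃ _ => ?_)).le (by omega)
  obtain ⟨r₃, q₃⟩ := gcount F₃
  refine (Runs.seq (T := 2) (T' := 12 * m + 24 * e + 24 * (l + 3) + 58)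
    (Runs.set fun _ => ?_)).le (by omega)
  refine (Runs.seq (T := l * 12 + 6) (T' := 12 * m + 24 * e + 12 * (l + 3) + 52)
    ((Runs.countUntil (fun j => 2 ^ j * s.reg 3) l (by simp) (by simp) (by simp)
    (by simp [Expr.eval, r₁, r₂, r₃])
    (fun k s' h h' => by simp [Expr.eval, h, pow_succ]; ring)
    (by simpa [r₁, r₂, r₃] using hl) (by simpa [r₁, r₂, r₃] using hl')).mono (by simp [Expr.cost])
    fun s₄ F₄ h₄ _ => ?_)).le (by omega)
  obtain ⟨r₄, q₄⟩ := gcount F₄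
  simp only [State.setReg_reg, State.setReg_mem, State.setReg_samples, Expr.eval, if_true] at h₄ r₄ q₄
  have e9 : s₄.reg 9 = m := by simp [r₄, r₃, h₂, r₁, h9]
  have e10 : s₄.reg 10 = e := by simp [r₄, h₃, r₂, r₁, h10]
  have e7 : s₄.reg 7 = n * n := by simp [r₄, r₃, r₂, h₁, hn]
  have e11 : s₄.reg 11 = l + 3 := by rw [h₄.1, add_comm]
  refine (Runs.seq (T := m * 12 + 8) (T' := 24 * e + 12 * (l + 3) + 44) ((Runs.mul (by simp)
    (by simp) (by simp) (by simp) (by simp)).mono (by rw [e9]) fun s₅ F₅ h₅ _ => ?_)).le (by omega)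
  obtain ⟨r₅, m₅, q₅⟩ := gmul F₅
  refine (Runs.seq (T := e * 12 + 8) (T' := 12 * e + 12 * (l + 3) + 36) ((Runs.mul (by simp)
    (by simp) (by simp) (by simp) (by simp)).mono (by simp [r₅, e10]) fun s₆ F₆ h₆ _ => ?_)).le
    (by omega)
  obtain ⟨r₆, m₆, q₆⟩ := gmul F₆
  refine (Runs.seq (T := e * 12 + 8) (T' := 12 * (l + 3) + 28) ((Runs.mul (by simp)
    (by simp) (by simp) (by simp) (by simp)).mono (by simp [r₆, r₅, e10]) fun s₇ F₇ h₇ _ => ?_)).le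
    (by omega)
  obtain ⟨r₇, m₇, q₇⟩ := gmul F₇
  refine (Runs.seq (T := (l + 3) * 12 + 8) (T' := 20) ((Runs.mul (by simp)
    (by simp) (by simp) (by simp) (by simp)).mono (by simp [r₇, r₆, r₅, e11])
    fun s₈ F₈ h₈ _ => ?_)).le (by omega)
  obtain ⟨r₈, m₈, q₈⟩ := gmul F₈
  refine (Runs.seq (T := 4) (T' := 8) (Runs.set fun _ => ?_)).le (by omega)
  refine Runs.seq (T := 4) (T' := 4) (Runs.set fun _ => Runs.set ⟨?_, ?_, ?_, ?_⟩)
  · simp [r₈, r₇, r₆, r₅, e7]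
  · simp [Expr.eval, h₈, h₇, h₆, h₅, r₅, r₆, r₇, e7, e9, e10, e11]
    ring
  · simp [m₈, m₇, m₆, m₅, h₄.2, h₃.2, h₂.2, m₁]
  · simp [q₈, q₇, q₆, q₅, q₄, q₃, q₂, q₁]

end Numerics

/-- The rows `r` are an echelon form of the tensor squares of the points of `S`, and the tensor
squares of the points `κ p` of `S` have the same span. -/
structure Kept {n : ℕ} (r : Fin (n * n) → Vec (n * n)) (κ : Fin (n * n) → Vec n)
    (S : Set (Vec n)) : Prop where
  echelon : Echelon r
  mem : ∀ p, κ p = 0 ∨ κ p ∈ S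
  span : Submodule.span (ZMod 2) (Set.range r) = Submodule.span (ZMod 2) (tsq '' S)
  span_kept : Submodule.span (ZMod 2) (Set.range fun p => tsq (κ p)) =
    Submodule.span (ZMod 2) (Set.range r)
  -- A slot without pivot is still empty, hence overwriting it loses nothing from the span of the
  -- kept squares.
  zero : ∀ p, r p p = 0 → κ p = 0

namespace Kept

variable {n : ℕ} {r : Fin (n * n) → Vec (n * n)} {κ : Fin (n * n) → Vec n} {S : Set (Vec n)}

theorem empty : Kept (0 : Fin (n * n) → Vec (n * n)) 0 ∅ := by
  refine ⟨Echelon.zero, fun _ => .inl rfl, ?_, ?_, fun _ _ => rfl⟩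
  · rw [Set.image_empty, Submodule.span_empty, eq_bot_iff, Submodule.span_le]
    rintro _ ⟨p, rfl⟩
    simp
  · apply le_antisymm <;> rw [Submodule.span_le]
    · rintro _ ⟨p, rfl⟩
      simp
    · rintro _ ⟨p, rfl⟩
      simp

theorem insert_of_mem (h : Kept r κ S) {x : Vec n}
    (hx : tsq x ∈ Submodule.span (ZMod 2) (Set.range r)) : Kept r κ (insert x S) := by
  refine ⟨h.echelon, fun p => (h.mem p).imp id fun h => .inr h, ?_, h.span_kept, h.zero⟩
  rw [h.span] at hx
  rw [h.span, Set.image_insert_eq, Submodule.span_insert_eq_span hx]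

/-- The echelon form receives the remainder and the kept list receives the sample, in the same empty
slot. Modulo the old span the remainder equals `tsq x`, so both spans grow alike. -/
theorem insert_pivot (h : Kept r κ S) {x : Vec n} {v : Vec (n * n)} {f q : ℕ}
    (hR : Reduced r (tsq x) v (n * n) f q) (hf : f ≠ 0) :
    ∃ i : Fin (n * n), i.val = q ∧
      Kept (Function.update r i v) (Function.update κ i x) (insert x S) := by
  obtain ⟨i, hi, hii, hv, hlt⟩ := hR.pivot hf
  have hr0 := (h.echelon i).2 hii
  refine ⟨i, hi, h.echelon.update hv hlt, fun p => ?_, ?_, ?_, fun p hp => ?_⟩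
  · by_cases hp : p = i
    · subst hp; simp
    · simpa [hp] using (h.mem p).imp id fun h => Or.inr h
  · rw [span_range_update hr0, hR.span_sup, h.span, Set.image_insert_eq, Submodule.span_insert,
      sup_comm]
  · have : (fun p => tsq (Function.update κ i x p)) =
        Function.update (fun p => tsq (κ p)) i (tsq x) := by
      funext p
      by_cases hp : p = i
      · subst hp; simp
      · simp [hp]
    rw [this, span_range_update (r := fun p => tsq (κ p)) (by simp [h.zero i hii]),
      span_range_update hr0, hR.span_sup, h.span_kept]
  · by_cases hpi : p = i
    · subst hpi
      simp [hv] at hp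
    · simp only [Function.update_of_ne hpi] at hp ⊢
      exact h.zero p hp

end Kept

theorem test_cost_le {n : ℕ} (hn : 1 ≤ n) :
    n * (46 * n + 18) + 8 + (n * n * (26 * (n * n) + 32) + 8) ≤ 138 * n ^ 4 := by
  have h₁ : 1 ≤ n ^ 4 := Nat.one_le_pow _ _ hn
  have h₂ : n ≤ n ^ 4 := Nat.le_self_pow (by simp) n
  have h₃ : n ^ 2 ≤ n ^ 4 := Nat.pow_le_pow_right hn (by simp)
  calc _ = 26 * n ^ 4 + 78 * n ^ 2 + 18 * n + 16 := by ring
    _ ≤ _ := by omega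

/-! ### Correctness and cost of the phases of the algorithm. -/

section Phases

variable {n : ℕ} {ω : Tape n}

/-- The span of the tensor squares that is stored in array `6`. -/
def State.squares (s : State) (n : ℕ) : Subsp (n * n) :=
  Submodule.span (ZMod 2) (Set.range fun p : Fin (n * n) => s.row (n * n) 6 p)

theorem State.squares_congr {s s' : State} (h : s'.mem 6 = s.mem 6) :
    s'.squares n = s.squares n := by
  simp only [State.squares, State.row_congr h]

/-- The outcome of a test in terms of the subspace stored in array `6`. -/
theorem Runs.test_iff {a b iv jv : ℕ} {i j : Expr} {s : State} (h1 : 1 ≤ n) (hs : Bits s)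
    (ha : a ≠ 5) (hb : b ≠ 5) (hn : s.reg 0 = n) (hD : s.reg 7 = n * n) (hic : i.cost ≤ 1)
    (hjc : j.cost ≤ 1)
    (hi : ∀ s' : State, (∀ x, x ∉ [24, 25, 26] → s'.reg x = s.reg x) → i.eval s' = iv)
    (hj : ∀ s' : State, (∀ x, x ∉ [24, 25, 26] → s'.reg x = s.reg x) → j.eval s' = jv)
    (hr : Echelon fun p : Fin (n * n) => s.row (n * n) 6 p) :
    Runs ω (.test a i b j) s (138 * n ^ 4) fun s' =>
      s'.reg 22 = 0 ↔ tsq (s.row n a iv + s.row n b jv) ∈ s.squares n :=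
  (Runs.test hs ha hb hn hD hic hjc hi hj hr).mono (test_cost_le h1) fun _ _ h =>
    (h.mem_iff hr).symm

theorem Runs.collect {s : State} {N : ℕ} (h1 : 1 ≤ n) (hn : s.reg 0 = n)
    (h7 : s.reg 7 = n * n) (h8 : s.reg 8 = N) (hm : s.mem = fun _ _ _ => 0)
    (hsm : s.samples = 0) :
    Runs ω .collect s (N * (198 * n ^ 4) + 6) fun s' =>
      (∀ i < N, s'.row n 7 i = ω.1 i) ∧ s'.samples = N ∧
        Kept (fun p : Fin (n * n) => s'.row (n * n) 6 p) (fun p => s'.row n 8 p)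
          (ω.1 '' Set.Iio N) ∧ Bits s' := by
  have hp₁ : 1 ≤ n ^ 4 := Nat.one_le_pow _ _ h1
  have hp₂ : n ≤ n ^ 4 := Nat.le_self_pow (by simp) n
  have hp₃ : n * n ≤ n ^ 4 := by rw [← sq]; exact Nat.pow_le_pow_right h1 (by simp)
  have hs : Bits s := by rw [Bits, hm]; simp
  refine (Runs.forTo (T := 190 * n ^ 4) (fun k s₁ => (∀ i < k, s₁.row n 7 i = ω.1 i) ∧
    s₁.samples = k ∧ Kept (fun p : Fin (n * n) => s₁.row (n * n) 6 p) (fun p => s₁.row n 8 p)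
          (ω.1 '' Set.Iio k)) (by simp) (by simp) (by simp) ?_ ?_).mono ?_ ?_
  · refine ⟨by simp, hsm, ?_⟩
    have h₁ : (fun p : Fin (n * n) => (s.setReg 13 0).row (n * n) 6 p) = 0 := by
      funext p j; simp [State.row, hm]
    have h₂ : (fun p : Fin (n * n) => (s.setReg 13 0).row n 8 p) = 0 := by
      funext p j; simp [State.row, hm]
    rw [h₁, h₂]
    simpa using Kept.empty
  · rintro k - s₁ hc hF ⟨hI₁, hI₂, hI₃⟩
    have hs₁ : Bits s₁ := hF.bits (by simp) hs
    have hr₁ : ∀ x ∈ [0, 7], s₁.reg x = s.reg x := fun x hx =>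
      hF.reg x (by simp at hx ⊢; omega)
    have hm₁ : s₁.mem 9 = s.mem 9 := hF.mem 9 (by simp)
    refine (Runs.seq (T := n + 2) (T' := 180 * n ^ 4) ?_).le (by omega)
    refine (Runs.sample ?_).le (by simp [Expr.cost]; omega)
    intro F₂
    set s₂ : State := { s₁.setRow 7 ((Expr.reg 13).eval s₁) (ω.1 s₁.samples) with
      samples := s₁.samples + 1 } with hs₂def
    have hs₂ : Bits s₂ := F₂.bits (by simp) hs₁
    have hx : s₂.row n 7 k = ω.1 k := by
      funext j
      simp [State.row, hs₂def, State.setRow, Expr.eval, hc, hI₂]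
    have hx' : ∀ i < k, s₂.row n 7 i = ω.1 i := by
      intro i hi
      rw [← hI₁ i hi]
      funext j
      simp [State.row, hs₂def, State.setRow, Expr.eval, hc, hi.ne]
    have hz : s₂.row n 9 0 = 0 := by
      funext j
      simp [State.row, F₂.mem 9 (by simp), hm₁, hm]
    have hr₂ : s₂.reg = s₁.reg := rfl
    have hrow6 : ∀ p, s₂.row (n * n) 6 p = s₁.row (n * n) 6 p :=
      State.row_congr (F₂.mem 6 (by simp)) _
    have hrow8 : ∀ p, s₂.row n 8 p = s₁.row n 8 p :=
      State.row_congr (F₂.mem 8 (by simp)) _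
    have hI₃' : Kept (fun p : Fin (n * n) => s₂.row (n * n) 6 p) (fun p => s₂.row n 8 p)
        (ω.1 '' Set.Iio k) := by simpa only [hrow6, hrow8] using hI₃
    have hS : ω.1 '' Set.Iio (k + 1) = Insert.insert (ω.1 k) (ω.1 '' Set.Iio k) := by
      rw [← Set.image_insert_eq]
      congr 1
      ext i
      simp only [Set.mem_Iio, Set.mem_insert_iff]
      omega
    refine (Runs.seq (T := 138 * n ^ 4) (T' := 42 * n ^ 4) ?_).le (by omega)
    refine (Runs.test (iv := k) (jv := 0) hs₂ (by simp) (by simp)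
      (by rw [hr₂, hr₁ 0 (by simp), hn]) (by rw [hr₂, hr₁ 7 (by simp), h7]) (by simp [Expr.cost])
      (by simp [Expr.cost])
      (fun s' h => by simp [Expr.eval, h, hr₂, hc]) (fun s' h => rfl) hI₃'.echelon).mono
      (test_cost_le h1) fun s₃ F₃ hR _ => ?_
    rw [hx, hz, add_zero] at hR
    have hr₃ : ∀ x ∈ [0, 7, 13], s₃.reg x = s₁.reg x := fun x hx =>
      F₃.reg x (by simp at hx ⊢; omega)
    have ha₃ : ∀ a, a ≠ 5 → s₃.mem a = s₂.mem a := fun a ha => F₃.mem a (by simpa using ha)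
    have hsm₃ : s₃.samples = k + 1 := by rw [F₃.samples (by simp), hs₂def, hI₂]
    have hx₃ : ∀ i < k + 1, s₃.row n 7 i = ω.1 i := by
      intro i hi
      rw [State.row_congr (ha₃ 7 (by simp))]
      rcases Nat.lt_succ_iff_lt_or_eq.1 hi with hi | rfl
      · exact hx' i hi
      · exact hx
    have hr6₃ : ∀ p, s₃.row (n * n) 6 p = s₂.row (n * n) 6 p := State.row_congr (ha₃ 6 (by simp)) _
    have hr8₃ : ∀ p, s₃.row n 8 p = s₂.row n 8 p := State.row_congr (ha₃ 8 (by simp)) _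
    simp only [← hr6₃] at hR
    simp only [← hr6₃, ← hr8₃] at hI₃'
    refine (Runs.cond (T := n * n * 14 + 6 + (n * 14 + 6)) (fun hf => ?_) (fun hf => ?_)).le
      (by simp [Expr.cost]; omega)
    · obtain ⟨q, hq, hK⟩ := hI₃'.insert_pivot hR hf
      refine Runs.seq ((Runs.copyRow q 0 (n * n) (by simp) (by simp)
        (by rw [hr₃ 7 (by simp), hr₁ 7 (by simp), h7])
        (fun s' h => by simp [Expr.eval, h, hq]) (fun s' h => rfl)).mono (by simp [Expr.cost])
        fun s₄ F₄ h₄ _ => ?_)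
      have hr₄ : ∀ x, x ≠ 21 → s₄.reg x = s₃.reg x := fun x hx => F₄.reg x (by simpa using hx)
      have ha₄ : ∀ a, a ≠ 6 → s₄.mem a = s₃.mem a := fun a ha => F₄.mem a (by simpa using ha)
      refine (Runs.copyRow q k n (by simp) (by simp)
        (by rw [hr₄ 0 (by simp), hr₃ 0 (by simp), hr₁ 0 (by simp), hn])
        (fun s' h => by simp [Expr.eval, h, hr₄, hq])
        (fun s' h => by simp [Expr.eval, h, hr₄, hr₃, hc])).mono (by simp [Expr.cost])
        fun s₅ F₅ h₅ _ => ?_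
      have ha₅ : ∀ a, a ≠ 8 → s₅.mem a = s₄.mem a := fun a ha => F₅.mem a (by simpa using ha)
      refine ⟨fun i hi => ?_, ?_, ?_⟩
      · rw [State.setReg_row, State.row_congr (ha₅ 7 (by simp)), State.row_congr (ha₄ 7 (by simp)),
          hx₃ i hi]
      · rw [State.setReg_samples, F₅.samples (by simp), F₄.samples (by simp), hsm₃]
      · have hr6₅ : (fun p : Fin (n * n) => (s₅.setReg 13 (k + 1)).row (n * n) 6 p) =
            Function.update (fun p : Fin (n * n) => s₃.row (n * n) 6 p) q (s₃.row (n * n) 5 0) := by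
          funext p j
          rw [State.setReg_row, State.row_congr (ha₅ 6 (by simp)), State.row, h₄]
          by_cases hp : p = q
          · subst hp; simp [State.row]
          · rw [Function.update_of_ne hp, if_neg fun h => hp (Fin.ext h.2.1)]; rfl
        have hr8₅ : (fun p : Fin (n * n) => (s₅.setReg 13 (k + 1)).row n 8 p) =
            Function.update (fun p : Fin (n * n) => s₃.row n 8 p) q (ω.1 k) := by
          funext p j
          rw [State.setReg_row, State.row, h₅]
          by_cases hp : p = q
          · subst hp
            rw [if_pos ⟨rfl, rfl, j.2⟩, Function.update_self, ← hx₃ k (by omega), ha₄ 7 (by simp)]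
            rfl
          · rw [Function.update_of_ne hp, if_neg fun h => hp (Fin.ext h.2.1), ha₄ 8 (by simp)]; rfl
        rw [hr6₅, hr8₅, hS]
        exact hK
    · refine Runs.skip (by omega) fun _ => ⟨hx₃, hsm₃, ?_⟩
      rw [hS]
      exact hI₃'.insert_of_mem ((hR.mem_iff hI₃'.echelon).2 hf)
  · rw [h8]
    have : N * (190 * n ^ 4 + 8) ≤ N * (198 * n ^ 4) := Nat.mul_le_mul_left _ (by omega)
    omega
  · rintro s' hF ⟨h₁, h₂, h₃⟩
    rw [h8] at h₁ h₂ h₃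
    exact ⟨h₁, h₂, h₃, hF.bits (by simp) hs⟩

/-- The data that are available after the samples have been processed. -/
structure Ready (s : State) (n : ℕ) : Prop where
  pos : 1 ≤ n
  bits : Bits s
  dim : s.reg 0 = n
  dim_sq : s.reg 7 = n * n
  echelon : Echelon fun p : Fin (n * n) => s.row (n * n) 6 p

theorem Ready.frame {p : Prog} {s s' : State} (h : Ready s n) (hF : Frame p s s')
    (h0 : 0 ∉ p.regs) (h7 : 7 ∉ p.regs) (h6 : 6 ∉ p.arrays) (hb : p.BitSafe) : Ready s' n :=
  ⟨h.pos, hF.bits hb h.bits, by rw [hF.reg 0 h0, h.dim], by rw [hF.reg 7 h7, h.dim_sq],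
    by simpa only [State.row_congr (hF.mem 6 h6)] using h.echelon⟩

theorem Ready.setReg {s : State} (h : Ready s n) {x v : ℕ} (h0 : x ≠ 0) (h7 : x ≠ 7) :
    Ready (s.setReg x v) n :=
  ⟨h.pos, h.bits, by simp [h0.symm, h.dim], by simp [h7.symm, h.dim_sq], h.echelon⟩

/-- The sum of rows `i` and `j` of array `8` fails the test. -/
def State.Bad (s : State) (n i j : ℕ) : Prop :=
  tsq (s.row n 8 i + s.row n 8 j) ∉ s.squares n

theorem State.bad_congr {s s' : State} (h6 : s'.mem 6 = s.mem 6) (h8 : s'.mem 8 = s.mem 8)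
    (i j : ℕ) : s'.Bad n i j ↔ s.Bad n i j := by
  simp only [State.Bad, State.squares_congr h6, State.row_congr h8]

theorem Runs.search {s : State} (hs : Ready s n) (h16 : s.reg 16 < n * n)
    (h17 : s.reg 17 < n * n) :
    Runs ω .search s (172 * n ^ 8) fun s' =>
      s'.reg 16 < n * n ∧ s'.reg 17 < n * n ∧
        ∀ a < n * n, ∀ b < n * n, s.Bad n a b → s.Bad n (s'.reg 16) (s'.reg 17) := by
  have h1 := hs.pos
  refine (Runs.forTo (T := n * n * (138 * n ^ 4 + 14) + 6) (fun k s' =>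
    s'.reg 16 < n * n ∧ s'.reg 17 < n * n ∧
      ∀ a < k, ∀ b < n * n, s.Bad n a b → s.Bad n (s'.reg 16) (s'.reg 17)) (by simp)
    (by simp) (by simp) (by simp [h16, h17]) ?_).mono ?_
    (fun s' _ h => by simpa only [hs.dim_sq] using h)
  · rintro k hk s₁ hc hF ⟨hI₁, hI₂, hI₃⟩
    rw [hs.dim_sq] at hk
    have hs₁ : Ready s₁ n := hs.frame hF (by simp) (by simp) (by simp) (by simp)
    have hbad₁ : ∀ a b, s₁.Bad n a b ↔ s.Bad n a b :=
      State.bad_congr (hF.mem 6 (by simp)) (hF.mem 8 (by simp))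
    refine (Runs.forTo (T := 138 * n ^ 4 + 6) (fun k' s' =>
      s'.reg 16 < n * n ∧ s'.reg 17 < n * n ∧
      -- The condition on `b` restricts the claim to the pairs already visited in lexicographic
      -- order.
      ∀ a < k + 1, ∀ b < n * n, (a = k → b < k') → s.Bad n a b →
        s.Bad n (s'.reg 16) (s'.reg 17)) (by simp) (by simp) (by simp) ?_ ?_).mono ?_ ?_
    · refine ⟨by simpa using hI₁, by simpa using hI₂, fun a ha b hb hab hbad => ?_⟩
      have hak : a < k := by
        by_contra h
        have := hab (by omega)
        omega
      simpa using hI₃ a hak b hb hbad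
    · rintro k' hk' s₂ hc' hF' ⟨hJ₁, hJ₂, hJ₃⟩
      rw [hs₁.dim_sq] at hk'
      have hs₂ : Ready s₂ n := hs₁.frame hF' (by simp) (by simp) (by simp) (by simp)
      have hbad₂ : s₂.Bad n k k' ↔ s.Bad n k k' := by
        rw [State.bad_congr (hF'.mem 6 (by simp)) (hF'.mem 8 (by simp)), hbad₁]
      have h14 : s₂.reg 14 = k := by rw [hF'.reg 14 (by simp), hc]
      refine (Runs.seq (T := 138 * n ^ 4) (T' := 6) ?_).le (by omega)
      refine (Runs.test_iff (iv := k) (jv := k') h1 hs₂.bits (by simp) (by simp) hs₂.dim hs₂.dim_sq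
        (by simp [Expr.cost]) (by simp [Expr.cost]) (fun s' h => by simp [Expr.eval, h, h14])
        (fun s' h => by simp [Expr.eval, h, hc']) hs₂.echelon).mono le_rfl fun s₃ F₃ h₃ _ => ?_
      have hr₃ : ∀ x ∈ [14, 15, 16, 17], s₃.reg x = s₂.reg x := fun x hx =>
        F₃.reg x (by simp at hx ⊢; omega)
      refine (Runs.cond (T := 4) (fun hf => ?_) (fun hf => ?_)).le (by simp [Expr.cost])
      · have hbad : s.Bad n k k' := hbad₂.1 fun h => hf (h₃.2 h)
        refine Runs.seq (T := 2) (T' := 2) (Runs.set fun _ => Runs.set fun _ => ?_)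
        simp only [State.setReg_reg, Expr.eval]
        simp [hr₃, h14, hc', hk, hk', hbad]
      · have hgood : ¬ s.Bad n k k' := fun h => hbad₂.2 h (h₃.1 hf)
        refine Runs.skip (by simp) fun _ => ?_
        have e16 : (s₃.setReg 15 (k' + 1)).reg 16 = s₂.reg 16 := by simp [hr₃]
        have e17 : (s₃.setReg 15 (k' + 1)).reg 17 = s₂.reg 17 := by simp [hr₃]
        rw [e16, e17]
        refine ⟨hJ₁, hJ₂, fun a ha b hb hab hbad => hJ₃ a ha b hb (fun h => ?_) hbad⟩
        have := hab h
        have : b ≠ k' := by rintro rfl; exact hgood (h ▸ hbad)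
        omega
    · rw [hs₁.dim_sq]
    · rintro s₂ - ⟨hJ₁, hJ₂, hJ₃⟩ -
      rw [hs₁.dim_sq] at hJ₃
      have e16 : (s₂.setReg 14 (k + 1)).reg 16 = s₂.reg 16 := by simp
      have e17 : (s₂.setReg 14 (k + 1)).reg 17 = s₂.reg 17 := by simp
      rw [e16, e17]
      exact ⟨hJ₁, hJ₂, fun a ha b hb => hJ₃ a ha b hb fun _ => hb⟩
  · rw [hs.dim_sq]
    have hp₁ : 1 ≤ n ^ 8 := Nat.one_le_pow _ _ h1
    have hp₂ : n ^ 2 ≤ n ^ 8 := Nat.pow_le_pow_right h1 (by simp)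
    have hp₃ : n ^ 4 ≤ n ^ 8 := Nat.pow_le_pow_right h1 (by simp)
    have hp₄ : n * n * (n * n * (138 * n ^ 4 + 14) + 6 + 8) + 6 =
      138 * n ^ 8 + 14 * n ^ 4 + 14 * n ^ 2 + 6 := by ring
    rw [hp₄]
    omega

end Phases

theorem HoldsBasis.natCard {n : ℕ} {s : State} {a k : ℕ} {A : Subsp n} (h : HoldsBasis s a k A) :
    Nat.card A = 2 ^ k := by
  obtain ⟨b, h₁, rfl, -⟩ := h
  rw [Module.natCard_eq_pow_finrank (K := ZMod 2), finrank_span_eq_card h₁]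
  simp

section Phases

variable {n : ℕ} {ω : Tape n}

/-- The first `k` rows of array `8` that satisfy `P`. -/
def State.kept (s : State) (P : Vec n → Prop) (k : ℕ) : Set (Vec n) :=
  {z | P z ∧ ∃ p < k, s.row n 8 p = z}

theorem State.span_kept_succ_of {s : State} {P : Vec n → Prop} {k : ℕ} (h : P (s.row n 8 k)) :
    Submodule.span (ZMod 2) (s.kept P (k + 1)) =
      Submodule.span (ZMod 2) (s.kept P k) ⊔ Submodule.span (ZMod 2) {s.row n 8 k} := by
  rw [sup_comm, ← Submodule.span_insert]
  congr 1
  ext z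
  simp only [State.kept, Set.mem_ofPred_eq, Set.mem_insert_iff, Nat.lt_succ_iff_lt_or_eq]
  constructor
  · rintro ⟨hz, p, hp | rfl, rfl⟩
    · exact .inr ⟨hz, p, hp, rfl⟩
    · exact .inl rfl
  · rintro (rfl | ⟨hz, p, hp, rfl⟩)
    · exact ⟨h, k, .inr rfl, rfl⟩
    · exact ⟨hz, p, .inl hp, rfl⟩

theorem State.kept_succ_of_not {s : State} {P : Vec n → Prop} {k : ℕ} (h : ¬ P (s.row n 8 k)) :
    s.kept P (k + 1) = s.kept P k := by
  ext z
  simp only [State.kept, Set.mem_ofPred_eq, Nat.lt_succ_iff_lt_or_eq]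
  constructor
  · rintro ⟨hz, p, hp | rfl, rfl⟩
    · exact ⟨hz, p, hp, rfl⟩
    · exact absurd hz h
  · rintro ⟨hz, p, hp, rfl⟩
    exact ⟨hz, p, .inl hp, rfl⟩

theorem Holds.bot {s : State} {b out d c : ℕ} (hb : s.mem b = 0) (hd : s.reg d = 0)
    (hc : s.reg c = 1) : Holds s b out d c (⊥ : Subsp n) := by
  have hrow : (fun p : Fin n => s.row n b p) = 0 := by
    funext p j
    simp [State.row, hb]
  refine ⟨hrow ▸ Echelon.zero, ?_, ?_, by rw [hd, hc, pow_zero]⟩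
  · rw [hrow, eq_bot_iff, Submodule.span_le]
    rintro _ ⟨p, rfl⟩
    simp
  · rw [hd]
    exact ⟨Fin.elim0, linearIndependent_empty_type, by simp, fun i => i.elim0⟩

theorem insert_cost_le {n : ℕ} (hn : 1 ≤ n) : n * (26 * n + 74) + 36 ≤ 136 * n ^ 4 := by
  have h₁ : 1 ≤ n ^ 4 := Nat.one_le_pow _ _ hn
  have h₂ : n ≤ n ^ 4 := Nat.le_self_pow (by simp) n
  have h₃ : n ^ 2 ≤ n ^ 4 := Nat.pow_le_pow_right hn (by simp)
  calc _ = 26 * n ^ 2 + 74 * n + 36 := by ring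
    _ ≤ _ := by omega

theorem Runs.insertIf {b out d c r k i : ℕ} {s : State} {P : Vec n → Prop} (hs : Ready s n)
    (hb : b ∉ [5, 6, 8]) (ho : out ∉ [5, 6, 8]) (hbo : b ≠ out) (hdc : d ≠ c)
    (hd : d ∉ [0, 7, 14, 20, 21, 22, 23, 24, 25, 26])
    (hc : c ∉ [0, 7, 14, 20, 21, 22, 23, 24, 25, 26]) (hr : r ∉ [24, 25, 26])
    (hk : s.reg 14 = k) (hi : s.reg r = i) (hP : ∀ z, P z ↔ tsq (z + s.row n 8 i) ∈ s.squares n)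
    (hA : Holds s b out d c (Submodule.span (ZMod 2) (s.kept P k))) :
    Runs ω (.insertIf b out d c r) s (276 * n ^ 4) fun s' =>
      Holds s' b out d c (Submodule.span (ZMod 2) (s.kept P (k + 1))) := by
  have hp₁ : 1 ≤ n ^ 4 := Nat.one_le_pow _ _ hs.pos
  simp only [List.mem_cons, List.not_mem_nil, or_false, not_or] at hb ho hd hc
  refine (Runs.seq (T := 138 * n ^ 4) (T' := 138 * n ^ 4) ?_).le (by omega)
  refine (Runs.test_iff (iv := k) (jv := i) hs.pos hs.bits (by simp) (by simp) hs.dim hs.dim_sq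
    (by simp [Expr.cost]) (by simp [Expr.cost]) (fun s' h => by simp [Expr.eval, h, hk])
    (fun s' h => by simp [Expr.eval, h r hr, hi]) hs.echelon).mono le_rfl fun s₁ F₁ h₁ _ => ?_
  rw [← hP] at h₁
  have hs₁ : Ready s₁ n := hs.frame F₁ (by simp) (by simp) (by simp) (by simp)
  have hA₁ := hA.congr (F₁.mem b (by simp [hb])) (F₁.mem out (by simp [ho]))
    (F₁.reg d (by simp [hd])) (F₁.reg c (by simp [hc]))
  have h14 : s₁.reg 14 = k := by rw [F₁.reg 14 (by simp), hk]
  have hrow : s₁.row n 8 k = s.row n 8 k := State.row_congr (F₁.mem 8 (by simp)) _ _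
  refine (Runs.cond (T := 136 * n ^ 4) (fun hf => ?_) (fun hf => ?_)).le
    (by simp [Expr.cost]; omega)
  · refine Runs.skip (by omega) ?_
    rw [State.kept_succ_of_not fun h => hf (h₁.2 h)]
    exact hA₁
  · refine (Runs.insert hs₁.bits (by simp [hb]) (by simp [ho]) hbo hdc (by simp [hd])
      (by simp [hc]) hs₁.dim hA₁).mono (insert_cost_le hs.pos) fun s₂ _ h₂ => ?_
    rw [State.span_kept_succ_of (h₁.1 hf), ← hrow]
    rwa [h14] at h₂

theorem Runs.bases {s : State} {i j : ℕ} (hs : Ready s n) (h16 : s.reg 16 = i)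
    (h17 : s.reg 17 = j) (h30 : s.reg 30 = 0) (h32 : s.reg 32 = 0) (h34 : s.reg 34 = 0)
    (hm₁₀ : s.mem 10 = 0) (hm₁₁ : s.mem 11 = 0) (hm₁₂ : s.mem 12 = 0) :
    Runs ω .bases s (708 * n ^ 8) fun s' =>
      Holds s' 10 0 30 31 (Submodule.span (ZMod 2)
        (s.kept (fun z => tsq (z + s.row n 8 i) ∈ s.squares n) (n * n))) ∧
      Holds s' 11 1 32 33 (Submodule.span (ZMod 2)
        (s.kept (fun z => tsq (z + s.row n 8 j) ∈ s.squares n) (n * n))) ∧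
      Holds s' 12 13 34 35 (Submodule.span (ZMod 2)
        (s.kept (fun _ : Vec n => True) (n * n))) := by
  have hp₁ : 1 ≤ n ^ 4 := Nat.one_le_pow _ _ hs.pos
  set P := fun z => tsq (z + s.row n 8 i) ∈ s.squares n with hP
  set Q := fun z => tsq (z + s.row n 8 j) ∈ s.squares n with hQ
  have hcost : n * n * (688 * n ^ 4 + 8) + 6 + 6 ≤ 708 * n ^ 8 := by
    have hp₂ : n ^ 6 ≤ n ^ 8 := Nat.pow_le_pow_right hs.pos (by simp)
    have hp₃ : n ^ 2 ≤ n ^ 8 := Nat.pow_le_pow_right hs.pos (by simp)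
    have hp₄ : 1 ≤ n ^ 8 := Nat.one_le_pow _ _ hs.pos
    calc _ = 688 * n ^ 6 + 8 * n ^ 2 + 12 := by ring
      _ ≤ _ := by omega
  refine (Runs.seq (T := 2) (T' := n * n * (688 * n ^ 4 + 8) + 10) (Runs.set fun _ => ?_)).le
    (by omega)
  refine (Runs.seq (T := 2) (T' := n * n * (688 * n ^ 4 + 8) + 8) (Runs.set fun _ => ?_)).le
    (by omega)
  refine (Runs.seq (T := 2) (T' := n * n * (688 * n ^ 4 + 8) + 6) (Runs.set fun _ => ?_)).le
    (by omega)
  simp only [Expr.eval]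
  set s₀ : State := ((s.setReg 31 1).setReg 33 1).setReg 35 1 with hs₀def
  have hs₀ : Ready s₀ n := ((hs.setReg (by simp) (by simp)).setReg (by simp)
    (by simp)).setReg (by simp) (by simp)
  have hr₀ : ∀ x, x ≠ 31 → x ≠ 33 → x ≠ 35 → s₀.reg x = s.reg x := by
    intro x h₁ h₂ h₃
    simp [hs₀def, h₁, h₂, h₃]
  refine (Runs.forTo (T := 688 * n ^ 4) (fun k s' =>
    Holds s' 10 0 30 31 (Submodule.span (ZMod 2) (s.kept P k)) ∧
    Holds s' 11 1 32 33 (Submodule.span (ZMod 2) (s.kept Q k)) ∧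
    Holds s' 12 13 34 35 (Submodule.span (ZMod 2) (s.kept (fun _ : Vec n => True) k)))
    (by simp) (by simp) (by simp) ?_ ?_).mono (by rw [hs₀.dim_sq])
    (fun s' _ h => by simpa only [hs₀.dim_sq] using h)
  · have hbot : ∀ P : Vec n → Prop, Submodule.span (ZMod 2) (s.kept P 0) = ⊥ := by
      intro P
      simp [State.kept]
    rw [hbot, hbot, hbot]
    exact ⟨Holds.bot hm₁₀ (by simp [hs₀def, h30]) (by simp [hs₀def]),
      Holds.bot hm₁₁ (by simp [hs₀def, h32]) (by simp [hs₀def]),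
      Holds.bot hm₁₂ (by simp [hs₀def, h34]) (by simp [hs₀def])⟩
  · rintro k - s₁ hc hF ⟨hI₁, hI₂, hI₃⟩
    have hs₁ : Ready s₁ n := hs₀.frame hF (by simp) (by simp) (by simp) (by simp)
    have hm8₁ : s₁.mem 8 = s.mem 8 := hF.mem 8 (by simp)
    have hm6₁ : s₁.mem 6 = s.mem 6 := hF.mem 6 (by simp)
    have hr₁ : ∀ x ∈ [16, 17], s₁.reg x = s.reg x := fun x hx => by
      rw [hF.reg x (by simp at hx ⊢; omega), hr₀ x] <;> simp at hx ⊢ <;> omega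
    have hkept : ∀ (s' : State), s'.mem 8 = s.mem 8 → ∀ (P : Vec n → Prop) k,
        s'.kept P k = s.kept P k := fun s' h P k => by
      simp only [State.kept, State.row_congr h]
    refine (Runs.seq (T := 276 * n ^ 4) (T' := 412 * n ^ 4) ?_).le (by omega)
    refine (Runs.insertIf (P := P) (k := k) (i := i) hs₁ (by simp) (by simp) (by simp) (by simp)
      (by simp) (by simp) (by simp) hc (by rw [hr₁ 16 (by simp), h16])
      (fun z => by rw [State.squares_congr hm6₁, State.row_congr hm8₁])
      (by rwa [hkept _ hm8₁])).mono le_rfl fun s₂ F₂ h₂ _ => ?_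
    rw [hkept _ hm8₁] at h₂
    have hs₂ : Ready s₂ n := hs₁.frame F₂ (by simp) (by simp) (by simp) (by simp)
    have hm8₂ : s₂.mem 8 = s.mem 8 := by rw [F₂.mem 8 (by simp), hm8₁]
    have hm6₂ : s₂.mem 6 = s.mem 6 := by rw [F₂.mem 6 (by simp), hm6₁]
    have hI₂' := hI₂.congr (F₂.mem 11 (by simp)) (F₂.mem 1 (by simp)) (F₂.reg 32 (by simp))
      (F₂.reg 33 (by simp))
    have hI₃' := hI₃.congr (F₂.mem 12 (by simp)) (F₂.mem 13 (by simp)) (F₂.reg 34 (by simp))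
      (F₂.reg 35 (by simp))
    refine (Runs.seq (T := 276 * n ^ 4) (T' := 136 * n ^ 4) ?_).le (by omega)
    refine (Runs.insertIf (P := Q) (k := k) (i := j) hs₂ (by simp) (by simp) (by simp) (by simp)
      (by simp) (by simp) (by simp) (by rw [F₂.reg 14 (by simp), hc])
      (by rw [F₂.reg 17 (by simp), hr₁ 17 (by simp), h17])
      (fun z => by rw [State.squares_congr hm6₂, State.row_congr hm8₂])
      (by rwa [hkept _ hm8₂])).mono le_rfl fun s₃ F₃ h₃ _ => ?_
    rw [hkept _ hm8₂] at h₃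
    have hs₃ : Ready s₃ n := hs₂.frame F₃ (by simp) (by simp) (by simp) (by simp)
    have hm8₃ : s₃.mem 8 = s.mem 8 := by rw [F₃.mem 8 (by simp), hm8₂]
    have h14₃ : s₃.reg 14 = k := by rw [F₃.reg 14 (by simp), F₂.reg 14 (by simp), hc]
    have h₂' := h₂.congr (F₃.mem 10 (by simp)) (F₃.mem 0 (by simp)) (F₃.reg 30 (by simp))
      (F₃.reg 31 (by simp))
    have hI₃'' := hI₃'.congr (F₃.mem 12 (by simp)) (F₃.mem 13 (by simp)) (F₃.reg 34 (by simp))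
      (F₃.reg 35 (by simp))
    refine (Runs.insert hs₃.bits (by simp) (by simp) (by simp) (by simp) (by simp) (by simp)
      hs₃.dim hI₃'').mono (insert_cost_le hs.pos) fun s₄ F₄ h₄ _ => ⟨?_, ?_, ?_⟩
    · exact h₂'.congr (F₄.mem 10 (by simp)) (F₄.mem 0 (by simp)) (by simp [F₄.reg 30])
        (by simp [F₄.reg 31])
    · exact h₃.congr (F₄.mem 11 (by simp)) (F₄.mem 1 (by simp)) (by simp [F₄.reg 32])
        (by simp [F₄.reg 33])
    · rw [State.span_kept_succ_of (s := s) trivial]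
      rw [h14₃, State.row_congr hm8₃] at h₄
      exact h₄.congr rfl rfl (by simp) (by simp)

open Classical in
theorem Runs.count {s : State} {N j : ℕ} (hs : Ready s n) (h8 : s.reg 8 = N)
    (h17 : s.reg 17 = j) (h36 : s.reg 36 = 0) (h37 : s.reg 37 = 0) :
    Runs ω .count s (N * (158 * n ^ 4) + 6) fun s' =>
      s'.reg 36 = s.reg 35 *
        {i ∈ Finset.range N | tsq (s.row n 7 i + s.row n 8 j) ∉ s.squares n}.card ∧
      s'.reg 37 = N * (s.reg 35 - s.reg 33) := by
  have hp₁ : 1 ≤ n ^ 4 := Nat.one_le_pow _ _ hs.pos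
  refine (Runs.forTo (T := 138 * n ^ 4 + 12) (fun k s' => s'.reg 36 = s.reg 35 *
        {i ∈ Finset.range k | tsq (s.row n 7 i + s.row n 8 j) ∉ s.squares n}.card ∧
      s'.reg 37 = k * (s.reg 35 - s.reg 33)) (by simp) (by simp) (by simp)
      (by simp [h36, h37]) ?_).mono ?_ (fun s' _ h => by simpa only [h8] using h)
  · rintro k - s₁ hc hF ⟨hI₁, hI₂⟩
    have hs₁ : Ready s₁ n := hs.frame hF (by simp) (by simp) (by simp) (by simp)
    have hr₁ : ∀ x ∈ [17, 33, 35], s₁.reg x = s.reg x := fun x hx =>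
      hF.reg x (by simp at hx ⊢; omega)
    refine (Runs.seq (T := 138 * n ^ 4) (T' := 12) ?_).le (by omega)
    refine (Runs.test_iff (iv := k) (jv := j) hs.pos hs₁.bits (by simp) (by simp) hs₁.dim
      hs₁.dim_sq (by simp [Expr.cost]) (by simp [Expr.cost])
      (fun s' h => by simp [Expr.eval, h, hc])
      (fun s' h => by simp [Expr.eval, h, hr₁, h17]) hs₁.echelon).mono le_rfl
      fun s₂ F₂ h₂ _ => ?_
    rw [State.squares_congr (hF.mem 6 (by simp)), State.row_congr (hF.mem 7 (by simp)),
      State.row_congr (hF.mem 8 (by simp))] at h₂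
    have hr₂ : ∀ x ∈ [33, 35, 36, 37], s₂.reg x = s₁.reg x := fun x hx =>
      F₂.reg x (by simp at hx ⊢; omega)
    refine Runs.seq (T := 6) (T' := 6) ?_
    have hfin : ∀ s₃ : State, s₃.reg 33 = s.reg 33 → s₃.reg 35 = s.reg 35 →
        s₃.reg 37 = s₁.reg 37 → s₃.reg 36 = s.reg 35 *
          {i ∈ Finset.range (k + 1) | tsq (s.row n 7 i + s.row n 8 j) ∉ s.squares n}.card →
        ∀ F : Prog, Runs ω (.set 37 (.add (.reg 37) (.sub (.reg 35) (.reg 33)))) s₃ 6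
          fun s₄ => Frame F s₁ s₄ → (s₄.setReg 13 (k + 1)).reg 36 = s.reg 35 *
            {i ∈ Finset.range (k + 1) | tsq (s.row n 7 i + s.row n 8 j) ∉ s.squares n}.card ∧
            (s₄.setReg 13 (k + 1)).reg 37 = (k + 1) * (s.reg 35 - s.reg 33) := by
      intro s₃ e33 e35 e37 e36 F
      refine Runs.set fun _ => ?_
      simp [Expr.eval, e33, e35, e37, e36, hI₂, Nat.succ_mul]
    refine (Runs.cond (T := 4) (fun hf => ?_) (fun hf => ?_)).le (by simp [Expr.cost])
    · refine Runs.set fun _ => hfin _ ?_ ?_ ?_ ?_ _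
      · simp [hr₂, hr₁]
      · simp [hr₂, hr₁]
      · simp [hr₂]
      rw [Finset.range_add_one, Finset.filter_insert, if_pos fun h => hf (h₂.2 h),
        Finset.card_insert_of_notMem (by simp)]
      simp [Expr.eval, hr₂, hr₁, hI₁, Nat.mul_succ]
    · refine Runs.skip (by simp) fun _ => hfin _ ?_ ?_ ?_ ?_ _
      · simp [hr₂, hr₁]
      · simp [hr₂, hr₁]
      · simp [hr₂]
      rw [Finset.range_add_one, Finset.filter_insert, if_neg (not_not.2 (h₂.1 hf))]
      simp [hr₂, hI₁]
  · rw [h8]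
    have : N * (138 * n ^ 4 + 12 + 8) ≤ N * (158 * n ^ 4) := Nat.mul_le_mul_left _ (by omega)
    omega

open Classical in
/-- What the learning algorithm computes from the samples, for every outcome of the oracle. -/
structure Learned (S : ℕ → Vec n) (N : ℕ) (s : State) (K : Set (Vec n)) (x y : Vec n) : Prop where
  -- Empty slots contribute the zero vector.
  subset : K ⊆ Insert.insert 0 (S '' Set.Iio N)
  span : Submodule.span (ZMod 2) (tsq '' K) = Submodule.span (ZMod 2) (tsq '' (S '' Set.Iio N))
  left_mem : x ∈ K
  right_mem : y ∈ K
  separates : ∀ a ∈ K, ∀ b ∈ K, tsq (a + b) ∉ Submodule.span (ZMod 2) (tsq '' K) →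
    tsq (x + y) ∉ Submodule.span (ZMod 2) (tsq '' K)
  left : HoldsBasis s 0 (s.reg 0) (Submodule.span (ZMod 2)
    {z ∈ K | tsq (z + x) ∈ Submodule.span (ZMod 2) (tsq '' K)})
  right : HoldsBasis s 1 (s.reg 1) (Submodule.span (ZMod 2)
    {z ∈ K | tsq (z + y) ∈ Submodule.span (ZMod 2) (tsq '' K)})
  num : s.reg 2 = Nat.card (Submodule.span (ZMod 2) K) *
    {i ∈ Finset.range N | tsq (S i + y) ∉ Submodule.span (ZMod 2) (tsq '' K)}.card
  den : s.reg 3 = N * (Nat.card (Submodule.span (ZMod 2) K) -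
    Nat.card (Submodule.span (ZMod 2)
      {z ∈ K | tsq (z + y) ∈ Submodule.span (ZMod 2) (tsq '' K)}))
  num' : s.reg 4 = s.reg 3 - s.reg 2
  den' : s.reg 5 = s.reg 3

theorem Runs.output {s : State} : Runs ω .output s 14 fun s' =>
    s'.reg 0 = s.reg 30 ∧ s'.reg 1 = s.reg 32 ∧ s'.reg 2 = s.reg 36 ∧ s'.reg 3 = s.reg 37 ∧
      s'.reg 4 = s.reg 37 - s.reg 36 ∧ s'.reg 5 = s.reg 37 ∧ s'.mem = s.mem ∧
      s'.samples = s.samples := by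
  refine Runs.seq (T := 2) (T' := 12) (Runs.set fun _ => ?_)
  refine Runs.seq (T := 2) (T' := 10) (Runs.set fun _ => ?_)
  refine Runs.seq (T := 2) (T' := 8) (Runs.set fun _ => ?_)
  refine Runs.seq (T := 2) (T' := 6) (Runs.set fun _ => ?_)
  refine Runs.seq (T := 4) (T' := 2) (Runs.set fun _ => Runs.set ?_)
  simp [Expr.eval]

open Classical in
-- Nothing is assumed about the tape: halting, cost and the relations in `Learned` hold always, and
-- luck only decides whether they force a correct output.
theorem Runs.learn {s : State} {m e l N : ℕ} (h1 : 1 ≤ n) (hmem : s.mem = fun _ _ _ => 0)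
    (hsm : s.samples = 0) (hreg : ∀ x, 6 < x → s.reg x = 0) (hn : s.reg 0 = n)
    (hm : ∀ j < m, j * s.reg 1 < s.reg 2) (hm' : s.reg 2 ≤ m * s.reg 1)
    (he : ∀ j < e, j * s.reg 5 < s.reg 6) (he' : s.reg 6 ≤ e * s.reg 5)
    (hl : ∀ j < l, 2 ^ j * s.reg 3 < s.reg 4) (hl' : s.reg 4 ≤ 2 ^ l * s.reg 3)
    (hN : N = 8 * (n * n * m * e * e * (l + 3))) :
    Runs ω .learn s
      (12 * (n + 2 * m + 3 * e + 2 * (l + 3)) + 356 * N * n ^ 4 + 880 * n ^ 8 + 106) fun s' =>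
      s'.samples = N ∧ ∃ K x y, Learned ω.1 N s' K x y := by
  have hnn : 0 < n * n := Nat.mul_pos h1 h1
  refine (Runs.seq (T' := 356 * N * n ^ 4 + 880 * n ^ 8 + 26)
    ((Runs.setup hn (hreg 9 (by simp)) (hreg 10 (by simp)) hm hm' he he' hl hl').mono le_rfl
      fun s₁ F₁ ⟨h7, h8, hmem₁, hsm₁⟩ _ => ?_)).le (by omega)
  rw [← hN] at h8
  rw [hmem] at hmem₁
  rw [hsm] at hsm₁
  have hz₁ : ∀ x ∈ [16, 17, 30, 32, 34, 36, 37], s₁.reg x = 0 := fun x hx => by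
    rw [F₁.reg x, hreg x] <;>
      simp [Prog.setup, Prog.mul, Prog.countUntil] at hx ⊢ <;> omega
  have hn₁ : s₁.reg 0 = n := by
    rw [F₁.reg 0 (by simp [Prog.setup, Prog.mul, Prog.countUntil]), hn]
  refine (Runs.seq (T' := 158 * N * n ^ 4 + 880 * n ^ 8 + 20)
    ((Runs.collect h1 hn₁ h7 h8 hmem₁ hsm₁).mono le_rfl
      fun s₂ F₂ ⟨hx, hsm₂, hK, hs₂⟩ _ => ?_)).le
    (by have : N * (198 * n ^ 4) + 158 * N * n ^ 4 = 356 * N * n ^ 4 := by ring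
        omega)
  have hr₂ : ∀ x ∈ [0, 7, 8, 16, 17, 30, 32, 34, 36, 37], s₂.reg x = s₁.reg x := fun x hx =>
    F₂.reg x (by simp [Prog.collect] at hx ⊢; omega)
  have hR₂ : Ready s₂ n := ⟨h1, hs₂, by rw [hr₂ 0 (by simp), hn₁], by rw [hr₂ 7 (by simp), h7],
    hK.echelon⟩
  have hm₂ : ∀ a ∈ [10, 11, 12], s₂.mem a = 0 := fun a ha => by
    rw [F₂.mem a (by simp [Prog.collect] at ha ⊢; omega), hmem₁]; rfl
  refine (Runs.seq (T' := 158 * N * n ^ 4 + 708 * n ^ 8 + 20)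
    ((Runs.search hR₂ (by rw [hr₂ 16 (by simp), hz₁ 16 (by simp)]; exact hnn)
      (by rw [hr₂ 17 (by simp), hz₁ 17 (by simp)]; exact hnn)).mono le_rfl
      fun s₃ F₃ ⟨hi, hj, hij⟩ _ => ?_)).le (by omega)
  set i := s₃.reg 16 with hi_def
  set j := s₃.reg 17 with hj_def
  have hr₃ : ∀ x ∈ [8, 30, 32, 34, 36, 37], s₃.reg x = s₂.reg x := fun x hx =>
    F₃.reg x (by simp [Prog.search] at hx ⊢; omega)
  have hR₃ : Ready s₃ n := hR₂.frame F₃ (by simp [Prog.search]) (by simp [Prog.search])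
    (by simp [Prog.search]) (by simp [Prog.search])
  have hm₃ : ∀ a, a ≠ 5 → s₃.mem a = s₂.mem a := fun a ha => F₃.mem a (by simp [Prog.search, ha])
  refine (Runs.seq (T' := 158 * N * n ^ 4 + 20)
    ((Runs.bases hR₃ hi_def.symm hj_def.symm
      (by rw [hr₃ 30 (by simp), hr₂ 30 (by simp), hz₁ 30 (by simp)])
      (by rw [hr₃ 32 (by simp), hr₂ 32 (by simp), hz₁ 32 (by simp)])
      (by rw [hr₃ 34 (by simp), hr₂ 34 (by simp), hz₁ 34 (by simp)])
      (by rw [hm₃ 10 (by simp), hm₂ 10 (by simp)])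
      (by rw [hm₃ 11 (by simp), hm₂ 11 (by simp)])
      (by rw [hm₃ 12 (by simp), hm₂ 12 (by simp)])).mono le_rfl
      fun s₄ F₄ ⟨hA, hB, hC⟩ _ => ?_)).le (by omega)
  have hr₄ : ∀ x ∈ [8, 17, 36, 37], s₄.reg x = s₃.reg x := fun x hx =>
    F₄.reg x (by simp [Prog.bases] at hx ⊢; omega)
  have hR₄ : Ready s₄ n := hR₃.frame F₄ (by simp [Prog.bases]) (by simp [Prog.bases])
    (by simp [Prog.bases]) (by simp [Prog.bases])
  have hm₄ : ∀ a ∈ [6, 7, 8], s₄.mem a = s₂.mem a := fun a ha => by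
    rw [F₄.mem a (by simp [Prog.bases] at ha ⊢; omega), hm₃ a (by simp at ha ⊢; omega)]
  refine (Runs.seq (T := N * (158 * n ^ 4) + 6) (T' := 14)
    ((Runs.count hR₄ (N := N) (j := j)
      (by rw [hr₄ 8 (by simp), hr₃ 8 (by simp), hr₂ 8 (by simp), h8])
      (by rw [hr₄ 17 (by simp)])
      (by rw [hr₄ 36 (by simp), hr₃ 36 (by simp), hr₂ 36 (by simp), hz₁ 36 (by simp)])
      (by rw [hr₄ 37 (by simp), hr₃ 37 (by simp), hr₂ 37 (by simp), hz₁ 37 (by simp)])).mono le_rfl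
      fun s₅ F₅ ⟨h36, h37⟩ _ => ?_)).le
    (by have : N * (158 * n ^ 4) = 158 * N * n ^ 4 := by ring
        omega)
  have hr₅ : ∀ x ∈ [30, 31, 32, 33, 34, 35], s₅.reg x = s₄.reg x := fun x hx =>
    F₅.reg x (by simp [Prog.count] at hx ⊢; omega)
  have hsm₅ : s₅.samples = N := by
    rw [F₅.samples (by simp [Prog.count]), F₄.samples (by simp [Prog.bases]),
      F₃.samples (by simp [Prog.search]), hsm₂]
  have hm₅ : ∀ a, a ≠ 5 → s₅.mem a = s₄.mem a := fun a ha => F₅.mem a (by simp [Prog.count, ha])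
  refine Runs.output.mono le_rfl fun s₆ _ ⟨o0, o1, o2, o3, o4, o5, hmem₆, hsm₆⟩ => ?_
  set K : Set (Vec n) := Set.range fun p : Fin (n * n) => s₂.row n 8 p with hKdef
  have hKspan : s₂.squares n = Submodule.span (ZMod 2) (tsq '' K) := by
    rw [State.squares, ← hK.span_kept, hKdef, ← Set.range_comp]
    rfl
  have hrow₃ : ∀ i, s₃.row n 8 i = s₂.row n 8 i := State.row_congr (hm₃ 8 (by simp)) n
  have hkept : ∀ P : Vec n → Prop, s₃.kept P (n * n) = {z ∈ K | P z} := by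
    intro P
    ext z
    simp only [State.kept, hrow₃, hKdef, Set.mem_ofPred_eq, Set.mem_range]
    constructor
    · rintro ⟨hz, p, hp, rfl⟩
      exact ⟨⟨⟨p, hp⟩, rfl⟩, hz⟩
    · rintro ⟨⟨p, rfl⟩, hz⟩
      exact ⟨hz, p, p.2, rfl⟩
  rw [hkept, hrow₃, State.squares_congr (hm₃ 6 (by simp)), hKspan] at hA hB
  have hC' : {z ∈ K | True} = K := by simp
  rw [hkept, hC'] at hC
  have hsq₄ : s₄.squares n = Submodule.span (ZMod 2) (tsq '' K) :=
    (State.squares_congr (hm₄ 6 (by simp))).trans hKspan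
  have hrow₄ : s₄.row n 8 j = s₂.row n 8 j := State.row_congr (hm₄ 8 (by simp)) _ _
  have hx₄ : ∀ i < N, s₄.row n 7 i = ω.1 i := fun i hi => by
    rw [State.row_congr (hm₄ 7 (by simp)), hx i hi]
  rw [hsq₄, hrow₄, Finset.filter_congr (q := fun i => tsq (ω.1 i + s₂.row n 8 j) ∉
    Submodule.span (ZMod 2) (tsq '' K)) fun i hi => by rw [hx₄ i (Finset.mem_range.1 hi)]] at h36
  refine ⟨hsm₆.trans hsm₅, K, s₂.row n 8 i, s₂.row n 8 j, ?_⟩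
  refine ⟨?_, ?_, ⟨⟨i, hi⟩, rfl⟩, ⟨⟨j, hj⟩, rfl⟩, ?_, ?_, ?_, ?_, ?_, ?_, ?_⟩
  · rintro _ ⟨p, rfl⟩
    exact hK.mem p
  · rw [← hKspan, State.squares, hK.span]
  · rintro _ ⟨p, rfl⟩ _ ⟨q, rfl⟩ hpq
    have := hij p p.2 q q.2
    simp only [State.Bad, hKspan] at this
    exact this hpq
  · rw [o0, hr₅ 30 (by simp)]
    exact hA.basis.congr (by rw [hmem₆, hm₅ 0 (by simp)])
  · rw [o1, hr₅ 32 (by simp)]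
    exact hB.basis.congr (by rw [hmem₆, hm₅ 1 (by simp)])
  · rw [o2, hC.basis.natCard, ← hC.card, h36]
  · rw [o3, hC.basis.natCard, hB.basis.natCard, ← hC.card, ← hB.card, h37]
  · rw [o4, o3, o2]
  · rw [o5, o3]

end Phases

/-! ### Correctness on good samples -/

section Correctness

variable {n : ℕ}

theorem natCard_subsp (A : Subsp n) : Nat.card A = 2 ^ Module.finrank (ZMod 2) A := by
  rw [Module.natCard_eq_pow_finrank (K := ZMod 2)]
  simp

/-- This eliminates `A ⊓ B`, for which the program computes no basis. -/
theorem natCard_sup_mul_natCard_inf (A B : Subsp n) :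
    Nat.card (A ⊔ B : Subsp n) * Nat.card (A ⊓ B : Subsp n) = Nat.card A * Nat.card B := by
  simp only [natCard_subsp, ← pow_add, Submodule.finrank_sup_add_finrank_inf_eq]

/-- A proper subspace over 𝔽₂ has index at least two. This keeps 1 - |B| / |A + B| above 1/2, so
dividing by it is stable. -/
theorem two_mul_natCard_le {A B : Subsp n} (h : ¬ A ≤ B) :
    2 * Nat.card B ≤ Nat.card (A ⊔ B : Subsp n) := by
  rw [natCard_subsp, natCard_subsp, ← pow_succ']
  exact Nat.pow_le_pow_right (by simp) (Submodule.finrank_lt_finrank_of_lt (by simpa using h))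

open Classical in
theorem Learned.outputs {S : ℕ → Vec n} {N : ℕ} {s : State} {K : Set (Vec n)} {x y : Vec n}
    {A B : Subsp n} {a b ε : ℝ} (h : Learned S N s K x y) (hAB : Incomparable A B)
    (hab : a + b = 1) (hb : 0 ≤ b) (hN : 0 < N) (hS : ∀ i < N, S i ∈ A ∨ S i ∈ B)
    (hK : K ⊆ (A : Set (Vec n)) ∪ B)
    (hspan : ∀ z ∈ (A : Set (Vec n)) ∪ B, tsq z ∈ Submodule.span (ZMod 2) (tsq '' K))
    (hx : x ∈ A ∧ x ∉ B) (hy : y ∈ B ∧ y ∉ A)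
    (hc : |({i ∈ Finset.range N | S i ∉ B}.card : ℝ) / N -
      a * (1 - Nat.card B / Nat.card (A ⊔ B : Subsp n))| ≤ ε / 4) :
    ∃ u v : ℝ, |a - u| + |b - v| ≤ ε ∧ Outputs s A B u v := by
  have hK' : K ⊆ (B : Set (Vec n)) ∪ A := by rwa [Set.union_comm]
  have hspan' : ∀ z ∈ (B : Set (Vec n)) ∪ A, tsq z ∈ Submodule.span (ZMod 2) (tsq '' K) := by
    rwa [Set.union_comm]
  have hA : Submodule.span (ZMod 2)
      {z ∈ K | tsq (z + x) ∈ Submodule.span (ZMod 2) (tsq '' K)} = A := by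
    rw [← span_inter_eq hAB.1 hK hspan]
    congr 1
    ext z
    refine and_congr_right fun hz => ?_
    rw [add_comm, tsq_add_mem_iff hK hspan hx.1 hx.2 (hK hz)]
    rfl
  have hB : Submodule.span (ZMod 2)
      {z ∈ K | tsq (z + y) ∈ Submodule.span (ZMod 2) (tsq '' K)} = B := by
    rw [← span_inter_eq hAB.2 hK' hspan']
    congr 1
    ext z
    refine and_congr_right fun hz => ?_
    rw [add_comm, tsq_add_mem_iff hK' hspan' hy.1 hy.2 (hK' hz)]
    rfl
  have hnum := h.num
  have hden := h.den
  have hcount : {i ∈ Finset.range N | tsq (S i + y) ∉ Submodule.span (ZMod 2) (tsq '' K)} =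
      {i ∈ Finset.range N | S i ∉ B} := by
    refine Finset.filter_congr fun i hi => ?_
    rw [add_comm, tsq_add_mem_iff hK' hspan' hy.1 hy.2 (hS i (Finset.mem_range.1 hi)).symm]
  rw [span_eq_sup hAB hK hspan, hcount] at hnum
  rw [span_eq_sup hAB hK hspan, hB] at hden
  have h2 := two_mul_natCard_le hAB.1
  have hBpos : 0 < Nat.card B := Nat.card_pos
  set M := Nat.card (A ⊔ B : Subsp n)
  set β := Nat.card B
  set c := {i ∈ Finset.range N | S i ∉ B}.card
  have hden0 : s.reg 3 ≠ 0 := by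
    rw [hden]
    exact (Nat.mul_pos hN (by omega)).ne'
  have hNr : (0 : ℝ) < N := by exact_mod_cast hN
  have hMr : (0 : ℝ) < M := by exact_mod_cast (by omega : 0 < M)
  have h2r : 2 * (β : ℝ) ≤ M := by exact_mod_cast h2
  have hdenr : (s.reg 3 : ℝ) = N * (M - β) := by
    rw [hden, Nat.cast_mul, Nat.cast_sub (by omega)]
  have hMβ : (0 : ℝ) < M - β := by linarith
  have hu : |a - (s.reg 2 : ℝ) / s.reg 3| ≤ ε / 2 := by
    -- The estimate is the empirical frequency divided by 1 - β/M, so its error is that of the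
    -- frequency times M/(M - β) ≤ 2.
    have : a - (s.reg 2 : ℝ) / s.reg 3 = -((c : ℝ) / N - a * (1 - β / M)) * (M / (M - β)) := by
      rw [hnum, hdenr, Nat.cast_mul]
      field_simp
      ring
    rw [this, abs_mul, abs_neg, abs_of_pos (div_pos hMr hMβ)]
    have h3 : (M : ℝ) / (M - β) ≤ 2 := by
      rw [div_le_iff₀ hMβ]; linarith
    calc _ ≤ ε / 4 * 2 := mul_le_mul hc h3 (div_pos hMr hMβ).le ((abs_nonneg _).trans hc)
      _ = ε / 2 := by ring
  refine ⟨(s.reg 2 : ℝ) / s.reg 3, (s.reg 4 : ℝ) / s.reg 5, ?_, ?_⟩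
  -- By truncation the second estimate is 1 - u or 0, whichever is larger. Clipping at 0 cannot
  -- increase the distance to `b ≥ 0`.
  · have hv : |b - (s.reg 4 : ℝ) / s.reg 5| ≤ |a - (s.reg 2 : ℝ) / s.reg 3| := by
      have hb' : b = 1 - a := by linarith
      have h3 : (0 : ℝ) < s.reg 3 := by exact_mod_cast Nat.pos_of_ne_zero hden0
      rw [h.num', h.den']
      rcases le_total (s.reg 2) (s.reg 3) with hle | hle
      · rw [Nat.cast_sub hle, sub_div, div_self h3.ne', hb', ← abs_neg]
        apply le_of_eq
        congr 1
        ring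
      · have h4 : (1 : ℝ) ≤ (s.reg 2 : ℝ) / s.reg 3 := by
          rw [one_le_div h3]; exact_mod_cast hle
        rw [Nat.sub_eq_zero_of_le hle, Nat.cast_zero, zero_div, sub_zero, abs_of_nonneg hb,
          abs_of_nonpos (by linarith)]
        linarith
    linarith
  · refine ⟨?_, ?_, hden0, rfl, by rw [h.den']; exact hden0, rfl⟩
    · have := h.left
      rwa [hA] at this
    · have := h.right
      rwa [hB] at this

/-- By duality, spanning becomes a finite list of conditions, one for each form, to which a union
bound applies. -/
theorem mem_span_of_forall_dual {D : ℕ} {T : Set (Vec D)} {x : Vec D}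
    (h : ∀ φ : Module.Dual (ZMod 2) (Vec D), φ x ≠ 0 → ∃ t ∈ T, φ t ≠ 0) :
    x ∈ Submodule.span (ZMod 2) T := by
  by_contra hx
  obtain ⟨φ, hφ, hT⟩ := exists_dual_eq_one hx
  obtain ⟨t, ht, hne⟩ := h φ hφ
  exact hne (hT t (Submodule.subset_span ht))

open Classical in
/-- If the samples lie in `A₀ ∪ A₁`, no quadratic form that is nonzero on `A₀ ∪ A₁` vanishes on all
of them, and their empirical distribution is close to the truth, then the output is correct. -/
theorem Learned.correct {S : ℕ → Vec n} {N : ℕ} {s : State} {K : Set (Vec n)} {x y : Vec n}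
    {A₀ A₁ : Subsp n} {w₀ w₁ ε : ℝ} (h : Learned S N s K x y) (hA : Incomparable A₀ A₁)
    (hw : w₀ + w₁ = 1) (hw₀ : 0 ≤ w₀) (hw₁ : 0 ≤ w₁) (hN : 0 < N)
    (hS : ∀ i < N, S i ∈ A₀ ∨ S i ∈ A₁)
    (hφ : ∀ φ : Module.Dual (ZMod 2) (Vec (n * n)),
      (∃ z ∈ (A₀ : Set (Vec n)) ∪ A₁, φ (tsq z) ≠ 0) → ∃ i < N, φ (tsq (S i)) ≠ 0)
    (h₀ : |({i ∈ Finset.range N | S i ∉ A₁}.card : ℝ) / N -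
      w₀ * (1 - Nat.card A₁ / Nat.card (A₀ ⊔ A₁ : Subsp n))| ≤ ε / 4)
    (h₁ : |({i ∈ Finset.range N | S i ∉ A₀}.card : ℝ) / N -
      w₁ * (1 - Nat.card A₀ / Nat.card (A₀ ⊔ A₁ : Subsp n))| ≤ ε / 4) :
    Correct s A₀ A₁ w₀ w₁ ε := by
  have hspan : ∀ z ∈ (A₀ : Set (Vec n)) ∪ A₁, tsq z ∈ Submodule.span (ZMod 2) (tsq '' K) := by
    intro z hz
    rw [h.span]
    refine mem_span_of_forall_dual fun φ hne => ?_
    obtain ⟨i, hi, hne'⟩ := hφ φ ⟨z, hz, hne⟩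
    exact ⟨_, ⟨_, ⟨i, hi, rfl⟩, rfl⟩, hne'⟩
  have hK : K ⊆ (A₀ : Set (Vec n)) ∪ A₁ := by
    intro z hz
    rcases h.subset hz with rfl | ⟨i, hi, rfl⟩
    · exact .inl A₀.zero_mem
    · exact hS i hi
  obtain ⟨p, hp, q, hq, hpq⟩ := exists_tsq_add_notMem hA hK hspan
  have hxy := h.separates p hp q hq hpq
  -- The search may have found the components in either order; the second case is the first with the
  -- roles exchanged.
  rcases mem_diff_of_tsq_add_notMem hK hspan h.left_mem h.right_mem hxy with
    ⟨hx, hx', hy, hy'⟩ | ⟨hx, hx', hy, hy'⟩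
  · obtain ⟨u, v, huv, ho⟩ := h.outputs hA hw hw₁ hN hS hK hspan ⟨hx, hx'⟩ ⟨hy, hy'⟩ h₀
    exact ⟨u, v, huv, .inl ho⟩
  · rw [sup_comm] at h₁
    rw [Set.union_comm] at hK hspan
    obtain ⟨u, v, huv, ho⟩ := h.outputs ⟨hA.2, hA.1⟩ (by rwa [add_comm]) hw₀ hN
      (fun i hi => (hS i hi).symm) hK hspan ⟨hx, hx'⟩ ⟨hy, hy'⟩ h₁
    exact ⟨v, u, by rwa [add_comm], .inr ho⟩

end Correctness

/-! ### The samples are good with high probability -/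

section Probability

variable {n : ℕ} {A₀ A₁ : Subsp n} {w₀ w₁ : ℝ}

theorem uniformOn_real_apply {Ω : Type*} [MeasurableSpace Ω] [MeasurableSingletonClass Ω]
    [Finite Ω] (s t : Set Ω) : (uniformOn s).real t = ((s ∩ t).ncard : ℝ) / s.ncard := by
  rw [Measure.real, uniformOn, cond_apply s.toFinite.measurableSet,
    Measure.count_apply s.toFinite.measurableSet,
    Measure.count_apply (s ∩ t).toFinite.measurableSet, ← s.toFinite.cast_ncard_eq,
    ← (s ∩ t).toFinite.cast_ncard_eq]
  simp only [div_eq_inv_mul, ENNReal.toReal_mul, ENNReal.toReal_inv, ENat.toENNReal_coe,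
    ENNReal.toReal_natCast]

instance isProbabilityMeasure_uniformOn_subsp (A : Subsp n) :
    IsProbabilityMeasure (uniformOn (A : Set (Vec n))) :=
  isProbabilityMeasure_uniformOn (Set.toFinite _) ⟨0, A.zero_mem⟩

theorem oracleLaw_real (hw₀ : 0 ≤ w₀) (hw₁ : 0 ≤ w₁) (t : Set (Vec n)) :
    (oracleLaw A₀ A₁ w₀ w₁).real t =
      w₀ * (uniformOn (A₀ : Set (Vec n))).real t + w₁ * (uniformOn (A₁ : Set (Vec n))).real t := by
  rw [Measure.real, oracleLaw, Measure.add_apply, Measure.smul_apply, Measure.smul_apply,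
    ENNReal.toReal_add (by simp [ENNReal.mul_eq_top]) (by simp [ENNReal.mul_eq_top])]
  simp [Measure.real, hw₀, hw₁]

theorem isProbabilityMeasure_oracleLaw (hw₀ : 0 ≤ w₀) (hw₁ : 0 ≤ w₁) (hw : w₀ + w₁ = 1) :
    IsProbabilityMeasure (oracleLaw A₀ A₁ w₀ w₁) := by
  constructor
  simp [oracleLaw, ← ENNReal.ofReal_add hw₀ hw₁, hw]

theorem oracleLaw_real_union_compl (hw₀ : 0 ≤ w₀) (hw₁ : 0 ≤ w₁) :
    (oracleLaw A₀ A₁ w₀ w₁).real ((A₀ : Set (Vec n)) ∪ A₁)ᶜ = 0 := by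
  rw [oracleLaw_real hw₀ hw₁, uniformOn_real_apply, uniformOn_real_apply]
  have h₀ : (A₀ : Set (Vec n)) ∩ ((A₀ : Set (Vec n)) ∪ A₁)ᶜ = ∅ := by
    ext z; simp; tauto
  have h₁ : (A₁ : Set (Vec n)) ∩ ((A₀ : Set (Vec n)) ∪ A₁)ᶜ = ∅ := by
    ext z; simp; tauto
  rw [h₀, h₁]
  simp

theorem uniformOn_real_compl_self (A : Subsp n) :
    (uniformOn (A : Set (Vec n))).real (A : Set (Vec n))ᶜ = 0 := by
  simp [uniformOn_real_apply]

/-- The dimension formula gives |A ∩ B| / |A| = |B| / |A + B|. -/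
theorem uniformOn_real_compl (A B : Subsp n) :
    (uniformOn (A : Set (Vec n))).real (B : Set (Vec n))ᶜ =
      1 - Nat.card B / Nat.card (A ⊔ B : Subsp n) := by
  rw [probReal_compl_eq_one_sub (Set.toFinite _).measurableSet, uniformOn_real_apply]
  congr 1
  have h := natCard_sup_mul_natCard_inf A B
  have hA : (A : Set (Vec n)).ncard = Nat.card A := rfl
  have hI : ((A : Set (Vec n)) ∩ B).ncard = Nat.card (A ⊓ B : Subsp n) := rfl
  rw [hA, hI]
  have h₁ : (0 : ℝ) < Nat.card A := by exact_mod_cast Nat.card_pos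
  have h₂ : (0 : ℝ) < Nat.card (A ⊔ B : Subsp n) := by exact_mod_cast Nat.card_pos
  rw [div_eq_div_iff h₁.ne' h₂.ne']
  exact_mod_cast (by rw [mul_comm, h, mul_comm])

theorem uniformOn_real_quadratic (φ : Module.Dual (ZMod 2) (Vec (n * n))) {A : Subsp n}
    (hA : ∃ x ∈ A, φ (tsq x) ≠ 0) :
    1 / 4 ≤ (uniformOn (A : Set (Vec n))).real {z | φ (tsq z) ≠ 0} := by
  have h := ncard_le_four_mul φ A hA
  have hpos : (0 : ℝ) < (A : Set (Vec n)).ncard := by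
    exact_mod_cast (Set.ncard_pos (Set.toFinite _)).2 ⟨0, A.zero_mem⟩
  rw [uniformOn_real_apply, div_le_div_iff₀ (by norm_num) hpos]
  have h' : ((A : Set (Vec n)).ncard : ℝ) ≤ 4 * ((A : Set (Vec n)) ∩ {z | φ (tsq z) ≠ 0}).ncard := by
    exact_mod_cast h
  linarith

/-- The form is nonzero on a quarter of one component, which has weight at least `w`. -/
theorem oracleLaw_real_quadratic {w : ℝ} (hw₀ : w ≤ w₀) (hw₁ : w ≤ w₁) (hpos : 0 ≤ w)
    (hw : w₀ + w₁ = 1) (φ : Module.Dual (ZMod 2) (Vec (n * n)))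
    (hφ : ∃ z ∈ (A₀ : Set (Vec n)) ∪ A₁, φ (tsq z) ≠ 0) :
    (oracleLaw A₀ A₁ w₀ w₁).real {z | φ (tsq z) = 0} ≤ 1 - w / 4 := by
  have h₀ := hpos.trans hw₀
  have h₁ := hpos.trans hw₁
  have := isProbabilityMeasure_oracleLaw (A₀ := A₀) (A₁ := A₁) h₀ h₁ hw
  have hcompl : {z : Vec n | φ (tsq z) = 0} = {z : Vec n | φ (tsq z) ≠ 0}ᶜ := by
    ext z; simp
  rw [hcompl, probReal_compl_eq_one_sub (Set.toFinite _).measurableSet, oracleLaw_real h₀ h₁]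
  have hn₀ : 0 ≤ (uniformOn (A₀ : Set (Vec n))).real {z | φ (tsq z) ≠ 0} := measureReal_nonneg
  have hn₁ : 0 ≤ (uniformOn (A₁ : Set (Vec n))).real {z | φ (tsq z) ≠ 0} := measureReal_nonneg
  obtain ⟨z, hz | hz, hne⟩ := hφ
  · have := uniformOn_real_quadratic φ ⟨z, hz, hne⟩
    nlinarith
  · have := uniformOn_real_quadratic φ ⟨z, hz, hne⟩
    nlinarith

/-! ### Concentration for independent samples. -/

section Sequence

variable {Ω : Type*} [MeasurableSpace Ω] {μ : Measure Ω} [IsProbabilityMeasure μ]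

theorem infinitePi_real_forall_lt (N : ℕ) {T : Set Ω} (hT : MeasurableSet T) :
    (Measure.infinitePi fun _ : ℕ => μ).real {S | ∀ i < N, S i ∈ T} = μ.real T ^ N := by
  have : {S : ℕ → Ω | ∀ i < N, S i ∈ T} = Set.pi (Finset.range N) fun _ => T := by
    ext S; simp
  rw [this, Measure.real, Measure.infinitePi_pi _ fun _ _ => hT]
  simp [Measure.real]

open Classical in
-- Hoeffding's inequality: a centred indicator is sub-Gaussian with variance proxy 1/4.
theorem infinitePi_real_card_ge (N : ℕ) {T : Set Ω} (hT : MeasurableSet T) {η : ℝ} (hη : 0 ≤ η) :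
    (Measure.infinitePi fun _ : ℕ => μ).real
      {S | N * η ≤ ({i ∈ Finset.range N | S i ∈ T}.card : ℝ) - N * μ.real T} ≤
        Real.exp (-2 * N * η ^ 2) := by
  set ν := Measure.infinitePi fun _ : ℕ => μ
  set f : Ω → ℝ := T.indicator 1 with hf
  have hfm : Measurable f := measurable_one.indicator hT
  have hind : iIndepFun (fun (i : ℕ) (S : ℕ → Ω) => f (S i) - μ.real T) ν :=
    iIndepFun_infinitePi (X := fun _ z => f z - μ.real T) fun _ => hfm.sub_const _
  have hmean : ∀ i : ℕ, ∫ S, f (S i) ∂ν = μ.real T := by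
    intro i
    have h := integral_map (μ := ν) (measurable_pi_apply i).aemeasurable
      (hfm.aestronglyMeasurable (μ := ν.map fun S : ℕ → Ω => S i))
    rw [← h, Measure.infinitePi_map_eval, hf, integral_indicator_one hT]
  have hsub : ∀ i < N, HasSubgaussianMGF (fun S : ℕ → Ω => f (S i) - μ.real T) (1 / 4) ν := by
    intro i _
    have h := hasSubgaussianMGF_of_mem_Icc (μ := ν) (X := fun S : ℕ → Ω => f (S i)) (a := 0) (b := 1)
      (hfm.comp (measurable_pi_apply i)).aemeasurable (ae_of_all _ fun S => by
        by_cases h : S i ∈ T <;> simp [hf, h])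
    rw [hmean] at h
    convert h using 1
    norm_num
  have h := HasSubgaussianMGF.measure_sum_range_ge_le_of_iIndepFun hind hsub
    (ε := N * η) (by positivity)
  have hset : {S : ℕ → Ω | N * η ≤ ∑ i ∈ Finset.range N, (f (S i) - μ.real T)} =
      {S | N * η ≤ ({i ∈ Finset.range N | S i ∈ T}.card : ℝ) - N * μ.real T} := by
    ext S
    simp only [Set.mem_ofPred_eq, Finset.sum_sub_distrib, Finset.sum_const, Finset.card_range,
      nsmul_eq_mul, hf, Set.indicator_apply, Pi.one_apply, Finset.sum_boole]
  rw [hset] at h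
  refine h.trans (Real.exp_le_exp.2 ?_)
  rcases Nat.eq_zero_or_pos N with rfl | hN
  · simp
  · have : (0 : ℝ) < N := by exact_mod_cast hN
    apply le_of_eq
    push_cast
    field_simp
    ring

open Classical in
-- A downward deviation for `T` is an upward deviation for its complement.
theorem infinitePi_real_card_dist (N : ℕ) (hN : 0 < N) {T : Set Ω} (hT : MeasurableSet T) {η : ℝ}
    (hη : 0 ≤ η) :
    (Measure.infinitePi fun _ : ℕ => μ).real
      {S | ¬ |({i ∈ Finset.range N | S i ∈ T}.card : ℝ) / N - μ.real T| ≤ η} ≤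
        2 * Real.exp (-2 * N * η ^ 2) := by
  have hNr : (0 : ℝ) < N := by exact_mod_cast hN
  have hsub : {S : ℕ → Ω | ¬ |({i ∈ Finset.range N | S i ∈ T}.card : ℝ) / N - μ.real T| ≤ η} ⊆
      {S | N * η ≤ ({i ∈ Finset.range N | S i ∈ T}.card : ℝ) - N * μ.real T} ∪
      {S | N * η ≤ ({i ∈ Finset.range N | S i ∈ Tᶜ}.card : ℝ) - N * μ.real Tᶜ} := by
    intro S hS
    have hcard : ({i ∈ Finset.range N | S i ∈ T}.card : ℝ) +
        ({i ∈ Finset.range N | S i ∈ Tᶜ}.card : ℝ) = N := by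
      have := Finset.card_filter_add_card_filter_not (s := Finset.range N) (fun i => S i ∈ T)
      rw [Finset.card_range] at this
      exact_mod_cast this
    rw [probReal_compl_eq_one_sub hT]
    simp only [Set.mem_ofPred_eq, not_le, Set.mem_union, lt_abs] at hS ⊢
    set c : ℝ := ({i ∈ Finset.range N | S i ∈ T}.card : ℝ)
    have hc : (N : ℝ) * (c / N - μ.real T) = c - N * μ.real T := by field_simp
    rcases hS with h | h
    · left
      rw [← hc]
      exact (mul_lt_mul_of_pos_left h hNr).le
    · right
      have := (mul_lt_mul_of_pos_left h hNr).le
      linarith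
  calc _ ≤ _ := measureReal_mono hsub
    _ ≤ _ := measureReal_union_le _ _
    _ ≤ _ := add_le_add (infinitePi_real_card_ge N hT hη) 
      (by convert! infinitePi_real_card_ge (μ := μ) N hT.compl hη)
    _ = _ := by ring

end Sequence

end Probability

/-! ### The union bound over the bad events. -/

section Probability

variable {n : ℕ} {A₀ A₁ : Subsp n} {w₀ w₁ : ℝ}

theorem finite_dual_card (D : ℕ) :
    ∃ F : Finset (Module.Dual (ZMod 2) (Vec D)), (∀ φ, φ ∈ F) ∧ F.card = 2 ^ D := by
  have : Finite (Module.Dual (ZMod 2) (Vec D)) := Module.finite_of_finite (ZMod 2)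
  have := Fintype.ofFinite (Module.Dual (ZMod 2) (Vec D))
  refine ⟨Finset.univ, Finset.mem_univ, ?_⟩
  rw [Finset.card_univ, ← Nat.card_eq_fintype_card,
    Module.natCard_eq_pow_finrank (K := ZMod 2), Subspace.dual_finrank_eq]
  simp

theorem infinitePi_real_not_forall_lt {Ω : Type*} [MeasurableSpace Ω] {μ : Measure Ω}
    [IsProbabilityMeasure μ] (N : ℕ) {T : Set Ω} (hT : MeasurableSet T) (h : μ.real Tᶜ = 0) :
    (Measure.infinitePi fun _ : ℕ => μ).real {S | ¬ ∀ i < N, S i ∈ T} = 0 := by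
  have hm : MeasurableSet {S : ℕ → Ω | ∀ i < N, S i ∈ T} := by
    have : {S : ℕ → Ω | ∀ i < N, S i ∈ T} = Set.pi (Finset.range N) fun _ => T := by
      ext S; simp
    rw [this]
    exact MeasurableSet.pi (Finset.countable_toSet _) fun _ _ => hT
  have hc : {S : ℕ → Ω | ¬ ∀ i < N, S i ∈ T} = {S : ℕ → Ω | ∀ i < N, S i ∈ T}ᶜ := rfl
  rw [probReal_compl_eq_one_sub hT] at h
  rw [hc, probReal_compl_eq_one_sub hm, infinitePi_real_forall_lt N hT,
    show μ.real T = 1 by linarith]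
  simp

open Classical in
/-- The conditions on the samples under which the output is correct. -/
def Good (A₀ A₁ : Subsp n) (w₀ w₁ ε : ℝ) (N : ℕ) (S : ℕ → Vec n) : Prop :=
  (∀ i < N, S i ∈ (A₀ : Set (Vec n)) ∪ A₁) ∧
  (∀ φ : Module.Dual (ZMod 2) (Vec (n * n)),
    (∃ z ∈ (A₀ : Set (Vec n)) ∪ A₁, φ (tsq z) ≠ 0) → ∃ i < N, φ (tsq (S i)) ≠ 0) ∧
  |({i ∈ Finset.range N | S i ∈ (A₁ : Set (Vec n))ᶜ}.card : ℝ) / N -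
    (oracleLaw A₀ A₁ w₀ w₁).real (A₁ : Set (Vec n))ᶜ| ≤ ε / 4 ∧
  |({i ∈ Finset.range N | S i ∈ (A₀ : Set (Vec n))ᶜ}.card : ℝ) / N -
    (oracleLaw A₀ A₁ w₀ w₁).real (A₀ : Set (Vec n))ᶜ| ≤ ε / 4

theorem one_sub_le_real_good {w ε : ℝ} {N : ℕ} (hw₀ : w ≤ w₀) (hw₁ : w ≤ w₁) (hpos : 0 ≤ w)
    (hw : w₀ + w₁ = 1) (hN : 0 < N) (hε : 0 ≤ ε) :
    1 - (2 ^ (n * n) * (1 - w / 4) ^ N + 4 * Real.exp (-2 * N * (ε / 4) ^ 2)) ≤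
      (Measure.infinitePi fun _ : ℕ => oracleLaw A₀ A₁ w₀ w₁).real
        {S | Good A₀ A₁ w₀ w₁ ε N S} := by
  classical
  have := isProbabilityMeasure_oracleLaw (A₀ := A₀) (A₁ := A₁) (hpos.trans hw₀)
    (hpos.trans hw₁) hw
  set μ := oracleLaw A₀ A₁ w₀ w₁ with hμ
  set ν := Measure.infinitePi fun _ : ℕ => μ with hν
  have hmeas : ∀ T : Set (Vec n), MeasurableSet T := fun T => T.toFinite.measurableSet
  obtain ⟨F, hF, hcard⟩ := finite_dual_card (n * n)
  set F' := F.filter fun φ => ∃ z ∈ (A₀ : Set (Vec n)) ∪ A₁, φ (tsq z) ≠ 0 with hF'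
  set B₁ : Set (ℕ → Vec n) := {S | ¬ ∀ i < N, S i ∈ (A₀ : Set (Vec n)) ∪ A₁}
  set B₂ : Set (ℕ → Vec n) := ⋃ φ ∈ F', {S | ∀ i < N, S i ∈ {z | φ (tsq z) = 0}} with hB₂def
  set B₃ : Set (ℕ → Vec n) := {S | ¬ |({i ∈ Finset.range N | S i ∈ (A₁ : Set (Vec n))ᶜ}.card : ℝ) / N -
    μ.real (A₁ : Set (Vec n))ᶜ| ≤ ε / 4}
  set B₄ : Set (ℕ → Vec n) := {S | ¬ |({i ∈ Finset.range N | S i ∈ (A₀ : Set (Vec n))ᶜ}.card : ℝ) / N -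
    μ.real (A₀ : Set (Vec n))ᶜ| ≤ ε / 4}
  have hB₁ : ν.real B₁ = 0 := infinitePi_real_not_forall_lt N (hmeas _)
    (oracleLaw_real_union_compl (hpos.trans hw₀) (hpos.trans hw₁))
  have hB₂ : ν.real B₂ ≤ 2 ^ (n * n) * (1 - w / 4) ^ N := by
    have hle : 0 ≤ 1 - w / 4 := by linarith
    calc ν.real B₂ ≤ ∑ φ ∈ F', ν.real {S | ∀ i < N, S i ∈ {z | φ (tsq z) = 0}} :=
          measureReal_biUnion_finset_le _ _
      _ ≤ ∑ φ ∈ F', (1 - w / 4) ^ N := by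
          refine Finset.sum_le_sum fun φ hφ => ?_
          rw [infinitePi_real_forall_lt N (hmeas _)]
          exact pow_le_pow_left₀ measureReal_nonneg
            (oracleLaw_real_quadratic hw₀ hw₁ hpos hw φ (Finset.mem_filter.1 hφ).2) N
      _ = F'.card * (1 - w / 4) ^ N := by rw [Finset.sum_const, nsmul_eq_mul]
      _ ≤ 2 ^ (n * n) * (1 - w / 4) ^ N := by
          refine mul_le_mul_of_nonneg_right ?_ (pow_nonneg hle N)
          have : F'.card ≤ 2 ^ (n * n) := hcard ▸ Finset.card_filter_le _ _
          exact_mod_cast this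
  have hB₃ : ν.real B₃ ≤ 2 * Real.exp (-2 * N * (ε / 4) ^ 2) := by
    convert! infinitePi_real_card_dist (μ := μ) N hN (hmeas (A₁ : Set (Vec n))ᶜ)
      (η := ε / 4) (by linarith)
  have hB₄ : ν.real B₄ ≤ 2 * Real.exp (-2 * N * (ε / 4) ^ 2) := by
    convert! infinitePi_real_card_dist (μ := μ) N hN (hmeas (A₀ : Set (Vec n))ᶜ)
      (η := ε / 4) (by linarith)
  -- Covering the whole space uses only monotonicity and subadditivity, so measurability of the good
  -- event is not needed.
  have hcov : (Set.univ : Set (ℕ → Vec n)) ⊆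
      {S | Good A₀ A₁ w₀ w₁ ε N S} ∪ (B₁ ∪ B₂ ∪ (B₃ ∪ B₄)) := by
    intro S _
    by_contra hS
    simp only [Set.mem_union, not_or] at hS
    obtain ⟨hG, ⟨h₁, h₂⟩, h₃, h₄⟩ := hS
    refine hG ⟨not_not.1 h₁, fun φ hφ => ?_, ?_, ?_⟩
    · by_contra! hall
      exact h₂ (Set.mem_biUnion (x := φ) (Finset.mem_filter.2 ⟨hF φ, hφ⟩) hall)
    · convert! not_not.1 h₃
    · convert! not_not.1 h₄
  have h1 : (1 : ℝ) ≤ ν.real {S | Good A₀ A₁ w₀ w₁ ε N S} +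
      (ν.real B₁ + ν.real B₂ + (ν.real B₃ + ν.real B₄)) :=
    calc (1 : ℝ) = ν.real Set.univ := probReal_univ.symm
      _ ≤ _ := measureReal_mono hcov
      _ ≤ _ := measureReal_union_le _ _
      _ ≤ _ := add_le_add le_rfl ((measureReal_union_le _ _).trans
        (add_le_add (measureReal_union_le _ _) (measureReal_union_le _ _)))
  linarith

theorem tapeLaw_real_fst (hw₀ : 0 ≤ w₀) (hw₁ : 0 ≤ w₁) (hw : w₀ + w₁ = 1)
    (G : Set (ℕ → Vec n)) :
    (tapeLaw A₀ A₁ w₀ w₁).real {ω | ω.1 ∈ G} =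
      (Measure.infinitePi fun _ : ℕ => oracleLaw A₀ A₁ w₀ w₁).real G := by
  have := isProbabilityMeasure_oracleLaw (A₀ := A₀) (A₁ := A₁) hw₀ hw₁ hw
  have hset : {ω : Tape n | ω.1 ∈ G} = G ×ˢ Set.univ := by
    ext ω; simp
  rw [hset, Measure.real, tapeLaw, Measure.prod_prod, measure_univ, mul_one, Measure.real]

theorem isProbabilityMeasure_tapeLaw (hw₀ : 0 ≤ w₀) (hw₁ : 0 ≤ w₁) (hw : w₀ + w₁ = 1) :
    IsProbabilityMeasure (tapeLaw A₀ A₁ w₀ w₁) := by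
  have := isProbabilityMeasure_oracleLaw (A₀ := A₀) (A₁ := A₁) hw₀ hw₁ hw
  unfold tapeLaw
  infer_instance

theorem Learned.correct_of_good {S : ℕ → Vec n} {N : ℕ} {s : State} {K : Set (Vec n)}
    {x y : Vec n} {ε : ℝ} (h : Learned S N s K x y) (hA : Incomparable A₀ A₁)
    (hw : w₀ + w₁ = 1) (hw₀ : 0 ≤ w₀) (hw₁ : 0 ≤ w₁) (hN : 0 < N)
    (hS : Good A₀ A₁ w₀ w₁ ε N S) : Correct s A₀ A₁ w₀ w₁ ε := by
  obtain ⟨h₁, h₂, h₃, h₄⟩ := hS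
  rw [oracleLaw_real hw₀ hw₁, uniformOn_real_compl_self, uniformOn_real_compl, mul_zero,
    add_zero] at h₃
  rw [oracleLaw_real hw₀ hw₁, uniformOn_real_compl_self, uniformOn_real_compl, mul_zero,
    zero_add, sup_comm] at h₄
  exact h.correct hA hw hw₀ hw₁ hN h₁ h₂ h₃ h₄

end Probability

/-! ### The sample size -/

theorem exists_count_until (f : ℕ → ℕ) (b : ℕ) (h : ∃ m, b ≤ f m) :
    ∃ m, (∀ j < m, f j < b) ∧ b ≤ f m :=
  ⟨Nat.find h, fun _ hj => not_le.1 (Nat.find_min h hj), Nat.find_spec h⟩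

/-- The reciprocal of a rational number in `(0, 1]`, rounded up. -/
theorem exists_ceil_inv {r : ℚ} (hr : 0 < r) (hr1 : r ≤ 1) :
    ∃ m : ℕ, (∀ j < m, j * r.num.natAbs < r.den) ∧ r.den ≤ m * r.num.natAbs ∧ 1 ≤ m ∧
      1 ≤ m * (r : ℝ) ∧ m * (r : ℝ) ≤ 2 := by
  have hnum : 0 < r.num := Rat.num_pos.2 hr
  have hp : 0 < r.num.natAbs := Int.natAbs_pos.2 hnum.ne'
  have hcast : (r : ℝ) = (r.num.natAbs : ℝ) / r.den := by
    rw [Nat.cast_natAbs, abs_of_pos hnum]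
    exact_mod_cast (Rat.num_div_den r).symm
  have hd : (0 : ℝ) < r.den := by exact_mod_cast r.den_pos
  obtain ⟨m, h₁, h₂⟩ := exists_count_until (fun j => j * r.num.natAbs) r.den
    ⟨r.den, Nat.le_mul_of_pos_right _ hp⟩
  have hm : 1 ≤ m := by
    by_contra h
    have : m = 0 := by omega
    subst this
    have := r.den_pos
    omega
  refine ⟨m, h₁, h₂, hm, ?_, ?_⟩
  · rw [hcast, ← mul_div_assoc, one_le_div hd]
    exact_mod_cast h₂
  -- Minimality of `m` gives (m - 1) r < 1, and r ≤ 1 turns this into m r ≤ 2.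
  · have h₃ := h₁ (m - 1) (by omega)
    have h₄ : ((m : ℝ) - 1) * r.num.natAbs < r.den := by
      have : (((m - 1 : ℕ) : ℝ)) * r.num.natAbs < r.den := by exact_mod_cast h₃
      rwa [Nat.cast_sub hm, Nat.cast_one] at this
    have h₅ : ((m : ℝ) - 1) * r < 1 := by
      rw [hcast, ← mul_div_assoc, div_lt_one hd]
      exact h₄
    have h₆ : (r : ℝ) ≤ 1 := by exact_mod_cast hr1
    linarith

/-- The binary logarithm of the reciprocal of a rational number in `(0, 1)`, rounded up. -/
theorem exists_ceil_log_inv {r : ℚ} (hr : 0 < r) (hr1 : r < 1) :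
    ∃ l : ℕ, (∀ j < l, 2 ^ j * r.num.natAbs < r.den) ∧ r.den ≤ 2 ^ l * r.num.natAbs ∧
      1 ≤ 2 ^ l * (r : ℝ) ∧ (l + 3 : ℝ) ≤ 8 * Real.log (2 / (r : ℝ)) := by
  have hnum : 0 < r.num := Rat.num_pos.2 hr
  have hp : 0 < r.num.natAbs := Int.natAbs_pos.2 hnum.ne'
  have hcast : (r : ℝ) = (r.num.natAbs : ℝ) / r.den := by
    rw [Nat.cast_natAbs, abs_of_pos hnum]
    exact_mod_cast (Rat.num_div_den r).symm
  have hd : (0 : ℝ) < r.den := by exact_mod_cast r.den_pos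
  have hr0 : (0 : ℝ) < r := by exact_mod_cast hr
  have hr1' : (r : ℝ) < 1 := by exact_mod_cast hr1
  obtain ⟨l, h₁, h₂⟩ := exists_count_until (fun j => 2 ^ j * r.num.natAbs) r.den
    ⟨r.den, (Nat.lt_two_pow_self.le).trans (Nat.le_mul_of_pos_right _ hp)⟩
  refine ⟨l, h₁, h₂, ?_, ?_⟩
  · rw [hcast, ← mul_div_assoc, one_le_div hd]
    exact_mod_cast h₂
  · have h₃ : (2 : ℝ) ^ l ≤ 2 / r := by
      rw [le_div_iff₀ hr0]
      rcases Nat.eq_zero_or_pos l with rfl | hl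
      · norm_num; linarith
      · have h := h₁ (l - 1) (by omega)
        have h' : (2 : ℝ) ^ (l - 1) * r < 1 := by
          rw [hcast, ← mul_div_assoc, div_lt_one hd]
          exact_mod_cast h
        have : (2 : ℝ) ^ l = 2 * 2 ^ (l - 1) := by rw [← pow_succ']; congr 1; omega
        rw [this]
        linarith
    have h₄ : l * Real.log 2 ≤ Real.log (2 / r) := by
      rw [← Real.log_pow]
      exact Real.log_le_log (by positivity) h₃
    have h₅ : Real.log 2 ≤ Real.log (2 / r) :=
      Real.log_le_log (by norm_num) (by rw [le_div_iff₀ hr0]; linarith)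
    -- As log 2 > 1/2, both l ≤ 2 log(2/r) and 3 ≤ 6 log(2/r) hold; this is the constant 8.
    have h₆ := Real.log_two_gt_d9
    have h₇ : (l : ℝ) * 0.5 ≤ l * Real.log 2 :=
      mul_le_mul_of_nonneg_left (by linarith) (Nat.cast_nonneg l)
    linarith

theorem exp_neg_le_half_pow {x : ℝ} {k : ℕ} (h : (k : ℝ) ≤ x) : Real.exp (-x) ≤ (1 / 2) ^ k := by
  have h₁ : Real.exp (-1) ≤ 1 / 2 := by
    rw [Real.exp_neg, ← one_div]
    exact one_div_le_one_div_of_le (by norm_num) (by linarith [Real.exp_one_gt_d9])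
  calc Real.exp (-x) ≤ Real.exp (k * (-1)) := Real.exp_le_exp.2 (by linarith)
    _ = Real.exp (-1) ^ k := Real.exp_nat_mul _ _
    _ ≤ _ := pow_le_pow_left₀ (Real.exp_nonneg _) h₁ k

/-- The chosen sample size makes the failure probability at most `δ`. -/
theorem failure_le {n m e l N : ℕ} {w δ ε : ℝ} (hn : 1 ≤ n) (hm : 1 ≤ m) (he : 1 ≤ e)
    (hw1 : w ≤ 1) (hmw : 1 ≤ m * w) (heε : 1 ≤ e * ε) (hδ : 0 < δ)
    (hl : 1 ≤ 2 ^ l * δ) (hN : N = 8 * (n * n * m * e * e * (l + 3))) :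
    2 ^ (n * n) * (1 - w / 4) ^ N + 4 * Real.exp (-2 * N * (ε / 4) ^ 2) ≤ δ := by
  -- Each of the five units of failure, one for the union bound and four for the frequencies, is to
  -- be at most δ/8.
  have hpow : ((1 : ℝ) / 2) ^ (l + 3) ≤ δ / 8 := by
    rw [one_div, inv_pow, pow_add, inv_le_comm₀ (by positivity) (by positivity), inv_div,
      div_le_iff₀ hδ]
    nlinarith
  have hn' : (1 : ℝ) ≤ n * n := by exact_mod_cast Nat.mul_pos hn hn
  have hm' : (1 : ℝ) ≤ m := by exact_mod_cast hm
  have he' : (1 : ℝ) ≤ e * e := by exact_mod_cast Nat.mul_pos he he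
  have hl' : (3 : ℝ) ≤ l + 3 := by linarith [(Nat.cast_nonneg l : (0 : ℝ) ≤ l)]
  have hNr : (N : ℝ) = 8 * (n * n * m * e * e * (l + 3)) := by rw [hN]; push_cast; ring
  have h₁ : 2 ^ (n * n) * (1 - w / 4) ^ N ≤ δ / 8 := by
    -- The summand `n * n` in the exponent cancels the number of quadratic forms.
    have hexp : (1 - w / 4) ^ N ≤ (1 / 2) ^ (n * n + (l + 3)) := by
      calc (1 - w / 4) ^ N ≤ Real.exp (-(w / 4)) ^ N :=
            pow_le_pow_left₀ (by linarith) (by linarith [Real.add_one_le_exp (-(w / 4))]) N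
        _ = Real.exp (-(N * (w / 4))) := by rw [← Real.exp_nat_mul]; congr 1; ring
        _ ≤ _ := exp_neg_le_half_pow (by
            have h₂ : (N : ℝ) * (w / 4) = 2 * ((n * n) * (l + 3)) * ((m * w) * (e * e)) := by
              rw [hNr]; ring
            have h₃ : (1 : ℝ) ≤ (m * w) * (e * e) := one_le_mul_of_one_le_of_one_le hmw he'
            have h₄ : (n * n : ℝ) + (l + 3) ≤ 2 * ((n * n) * (l + 3)) := by nlinarith
            push_cast
            rw [h₂]
            calc (n * n : ℝ) + (l + 3) ≤ 2 * ((n * n) * (l + 3)) * 1 := by linarith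
              _ ≤ _ := mul_le_mul_of_nonneg_left h₃ (by positivity))
    calc 2 ^ (n * n) * (1 - w / 4) ^ N ≤ 2 ^ (n * n) * (1 / 2) ^ (n * n + (l + 3)) :=
          mul_le_mul_of_nonneg_left hexp (by positivity)
      _ = (1 / 2) ^ (l + 3) := by
          rw [pow_add, ← mul_assoc, ← mul_pow]; norm_num
      _ ≤ δ / 8 := hpow
  have h₂ : Real.exp (-2 * N * (ε / 4) ^ 2) ≤ δ / 8 := by
    refine le_trans ?_ hpow
    -- The factor 8 in `N` cancels the 2/16 that comes from the exponent.
    have h₃ : -2 * (N : ℝ) * (ε / 4) ^ 2 = -((l + 3) * ((n * n) * m * ((e * ε) * (e * ε)))) := by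
      rw [hNr]; ring
    rw [h₃]
    refine exp_neg_le_half_pow ?_
    have h₄ : (1 : ℝ) ≤ (n * n) * m * ((e * ε) * (e * ε)) :=
      one_le_mul_of_one_le_of_one_le (one_le_mul_of_one_le_of_one_le hn' hm')
        (one_le_mul_of_one_le_of_one_le heε heε)
    push_cast
    nlinarith
  linarith

/-- The number of steps is polynomial. -/
theorem steps_le {n m e l N : ℕ} (hn : 1 ≤ n) (hm : 1 ≤ m) (he : 1 ≤ e)
    (hN : N = 8 * (n * n * m * e * e * (l + 3))) :
    12 * (n + 2 * m + 3 * e + 2 * (l + 3)) + 356 * N * n ^ 4 + 880 * n ^ 8 + 106 ≤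
      4000 * (n ^ 8 * m * (e * e) * (l + 3)) := by
  have h1 : 1 ≤ n ^ 8 := Nat.one_le_pow _ _ hn
  have h2 : n ≤ n ^ 8 := Nat.le_self_pow (by simp) n
  have h3 : n ^ 6 ≤ n ^ 8 := Nat.pow_le_pow_right hn (by simp)
  have hl : 1 ≤ l + 3 := by omega
  have hee : e ≤ e * e := Nat.le_mul_of_pos_left e he
  have hE : 1 ≤ e * e := he.trans hee
  set Q := n ^ 8 * m * (e * e) * (l + 3) with hQ
  -- Every summand of the cost is a monomial dominated by `Q`; the coefficients add up to 3930.
  have hq : ∀ a b c d : ℕ, a ≤ n ^ 8 → b ≤ m → c ≤ e * e → d ≤ l + 3 → a * b * c * d ≤ Q :=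
    fun a b c d ha hb hc hd =>
      Nat.mul_le_mul (Nat.mul_le_mul (Nat.mul_le_mul ha hb) hc) hd
  have q1 := hq n 1 1 1 h2 hm hE hl
  have q2 := hq 1 m 1 1 h1 le_rfl hE hl
  have q3 := hq 1 1 e 1 h1 hm hee hl
  have q4 := hq 1 1 1 (l + 3) h1 hm hE le_rfl
  have q5 := hq (n ^ 8) 1 1 1 le_rfl hm hE hl
  have q6 := hq (n ^ 6) m (e * e) (l + 3) h3 le_rfl le_rfl le_rfl
  have q7 := hq 1 1 1 1 h1 hm hE hl
  have hNn : 356 * N * n ^ 4 = 2848 * (n ^ 6 * m * (e * e) * (l + 3)) := by rw [hN]; ring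
  rw [hNn]
  simp only [mul_one, one_mul] at q1 q2 q3 q4 q5 q6 q7
  omega

/-- 256000 = 4000 · 2 · 4 · 8, from the roundings of 1/w, of 1/ε squared, and of the logarithm. As
an exponent, `C` only has to be at least 8, because n/w ≥ 1. -/
theorem steps_le_real {n m e l C : ℕ} {w δ ε : ℝ} (hC : 256000 ≤ C) (hn : 1 ≤ n) (hw : 0 < w)
    (hw1 : w ≤ 1) (hmw : m * w ≤ 2) (hε : 0 < ε) (heε : e * ε ≤ 2)
    (hl : (l + 3 : ℝ) ≤ 8 * Real.log (2 / δ)) :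
    (4000 * (n ^ 8 * m * (e * e) * (l + 3)) : ℝ) ≤
      C * ((n : ℝ) / w) ^ C * (1 / ε ^ 2) * Real.log (2 / δ) := by
  have hn' : (1 : ℝ) ≤ n := by exact_mod_cast hn
  have hC' : (256000 : ℝ) ≤ C := by exact_mod_cast hC
  have hL : 0 ≤ Real.log (2 / δ) := by
    have : (0 : ℝ) ≤ l := Nat.cast_nonneg l
    linarith
  have hm' : (m : ℝ) ≤ 2 / w := by rwa [le_div_iff₀ hw]
  have he' : (e : ℝ) ≤ 2 / ε := by rwa [le_div_iff₀ hε]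
  have hnw : (1 : ℝ) ≤ n / w := by rw [one_le_div hw]; linarith
  have hpow : (n : ℝ) ^ 8 * (1 / w) ≤ ((n : ℝ) / w) ^ C := by
    calc (n : ℝ) ^ 8 * (1 / w) ≤ (n : ℝ) ^ 8 * (1 / w) ^ 8 := by
          refine mul_le_mul_of_nonneg_left ?_ (by positivity)
          exact le_self_pow₀ (by rw [one_le_div hw]; exact hw1) (by norm_num)
      _ = ((n : ℝ) / w) ^ 8 := by rw [← mul_pow]; congr 1; ring
      _ ≤ _ := pow_le_pow_right₀ hnw (by omega)
  calc (4000 * (n ^ 8 * m * (e * e) * (l + 3)) : ℝ)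
      ≤ 4000 * (n ^ 8 * (2 / w) * ((2 / ε) * (2 / ε)) * (8 * Real.log (2 / δ))) := by gcongr
    _ = 256000 * ((n : ℝ) ^ 8 * (1 / w)) * (1 / ε ^ 2) * Real.log (2 / δ) := by
        field_simp; ring
    _ ≤ _ := by gcongr

/-- In dimension 0 there is only one subspace. The cost estimates need `1 ≤ n`. -/
theorem Incomparable.pos {n : ℕ} {A B : Subsp n} (h : Incomparable A B) : 1 ≤ n := by
  rcases Nat.eq_zero_or_pos n with rfl | hn
  · exact absurd (fun x _ => by rw [Subsingleton.elim x 0]; exact B.zero_mem) h.1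
  · exact hn

theorem theorem1 :
    ∃ (P : Prog) (C : ℕ),
      ∀ (n : ℕ) (A₀ A₁ : Subsp n) (w₀ w₁ : ℝ) (wmin δ ε : ℚ),
        Incomparable A₀ A₁ →
        w₀ + w₁ = 1 → 0 < wmin → (wmin : ℝ) ≤ min w₀ w₁ →
        0 < δ → δ < 1 → 0 < ε → ε ≤ 1 →
        (∀ ω : Tape n, ∃ (t : ℕ) (s : State),
          Exec ω P (initState n wmin δ ε) t s ∧
          (t : ℝ) ≤ C * ((n : ℝ) / wmin) ^ C * (1 / (ε : ℝ) ^ 2) * Real.log (2 / (δ : ℝ)) ∧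
          (s.samples : ℝ) ≤
            C * ((n : ℝ) / wmin) ^ C * (1 / (ε : ℝ) ^ 2) * Real.log (2 / (δ : ℝ))) ∧
        1 - (δ : ℝ) ≤
          (tapeLaw A₀ A₁ w₀ w₁).real
            {ω : Tape n | ∃ (t : ℕ) (s : State),
              Exec ω P (initState n wmin δ ε) t s ∧ Correct s A₀ A₁ w₀ w₁ (ε : ℝ)} := by
  -- Only the lower bound on `C` is retained, so the huge exponent never occurs as a numeral.
  obtain ⟨C, hC⟩ : ∃ C : ℕ, 256000 ≤ C := ⟨256000, le_rfl⟩
  refine ⟨.learn, C, fun n A₀ A₁ w₀ w₁ wmin δ ε hA hw hwmin hmin hδ hδ1 hε hε1 => ?_⟩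
  have hn := hA.pos
  have hwr : (0 : ℝ) < wmin := by exact_mod_cast hwmin
  have hδr : (0 : ℝ) < δ := by exact_mod_cast hδ
  have hεr : (0 : ℝ) < ε := by exact_mod_cast hε
  have hw₀ : (wmin : ℝ) ≤ w₀ := hmin.trans (min_le_left _ _)
  have hw₁ : (wmin : ℝ) ≤ w₁ := hmin.trans (min_le_right _ _)
  have hw1r : (wmin : ℝ) ≤ 1 := by linarith
  obtain ⟨m, m₁, m₂, m₃, m₄, m₅⟩ := exists_ceil_inv hwmin (by exact_mod_cast hw1r)
  obtain ⟨e, e₁, e₂, e₃, e₄, e₅⟩ := exists_ceil_inv hε hε1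
  obtain ⟨l, l₁, l₂, l₃, l₄⟩ := exists_ceil_log_inv hδ hδ1
  obtain ⟨N, hN⟩ : ∃ N, N = 8 * (n * n * m * e * e * (l + 3)) := ⟨_, rfl⟩
  have hNpos : 0 < N := by rw [hN]; positivity
  have hrun : ∀ ω : Tape n, _ := fun ω => Runs.learn (ω := ω) (s := initState n wmin δ ε) hn rfl rfl
    (fun x hx => by
      obtain ⟨k, rfl⟩ := Nat.exists_eq_add_of_lt hx
      rw [show 6 + k + 1 = k + 7 by ring]
      rfl) rfl m₁ m₂ e₁ e₂ l₁ l₂ hN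
  have hsteps := steps_le hn m₃ e₃ hN
  have hbound := steps_le_real hC hn hwr hw1r m₅ hεr e₅ l₄
  refine ⟨fun ω => ?_, ?_⟩
  · obtain ⟨t, s, hexec, ht, hs, -⟩ := hrun ω
    have hNle : N ≤ 356 * N * n ^ 4 :=
      (Nat.le_mul_of_pos_left N (by norm_num)).trans
        (Nat.le_mul_of_pos_right _ (Nat.pow_pos hn))
    refine ⟨t, s, hexec, le_trans ?_ hbound, le_trans ?_ hbound⟩
    · exact_mod_cast ht.trans hsteps
    · rw [hs]
      exact_mod_cast (hNle.trans (by omega)).trans hsteps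
  · have hfail := failure_le hn m₃ e₃ hw1r m₄ e₄ hδr l₃ hN
    have hgood := one_sub_le_real_good (A₀ := A₀) (A₁ := A₁) hw₀ hw₁ hwr.le hw hNpos hεr.le
    rw [← tapeLaw_real_fst (hwr.le.trans hw₀) (hwr.le.trans hw₁) hw] at hgood
    have := isProbabilityMeasure_tapeLaw (A₀ := A₀) (A₁ := A₁) (hwr.le.trans hw₀)
      (hwr.le.trans hw₁) hw
    -- Every tape with good samples yields a correct output, so the success event contains the good
    -- event.
    refine le_trans (by linarith) (hgood.trans (measureReal_mono fun ω hω => ?_))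
    obtain ⟨t, s, hexec, -, -, K, x, y, hL⟩ := hrun ω
    exact ⟨t, s, hexec, hL.correct_of_good hA hw (hwr.le.trans hw₀) (hwr.le.trans hw₁) hNpos hω⟩
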